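/- Let $(\Omega,\Sigma,\mu)$ and $(S,\mathcal F,m)$ be finite measure spaces with $\mu\neq 0$ and $L_2(S)$ infinite-dimensional. Let $L_0=L_0(\Omega)$ be the algebra of classes of complex measurable functions on $\Omega$, $L_0^h$ its real-valued part, and $L_{2,2}(\Omega\times S)$ the Hilbert space of measurable $f$ with $\|f\|_{2,2}^2=\int_\Omega\int_S|f|^2\,dm\,d\mu<\infty$. Let $E_0=L_0(\Omega,L_2(S))$ be the Kaplansky–Hilbert module over $L_0$ of classes of measurable $f(\omega,s)$ with $f(\omega,\cdot)\in L_2(S)$ for a.e. $\omega$, with the $L_0$-valued inner product $\langle x,y\rangle(\omega)=\int_S x(\omega,s)\overline{y(\omega,s)}\,dm(s)$ and norm $\|x\|=\sqrt{\langle x,x\rangle}$; it contains $L_{2,2}(\Omega\times S)$. Let $$(Tf)(\omega,t)=\int_S k(\omega,t,s)f(\omega,s)\,dm(s),$$ acting on $L_{2,2}(\Omega\times S)$ and on $E_0$, where $k\in L_\infty(\Omega\times S^2)$, $k(\omega,t,s)=\overline{k(\omega,s,t)}$ a.e., and $\int_S\int_S k(\omega,t,s)x(\omega,s)\overline{x(\omega,t)}\,dm(s)\,dm(t)\ge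 0$ for a.e. $\omega$, for all $x\in L_{2,2}(\Omega\times S)$. (Such $T$ is a self-adjoint, cyclically compact partially integral operator.) Let $\mathbf m=\inf\{\langle Tx,x\rangle:\ x\in E_0,\ \|x\|=\mathbf 1\}$ and $M=\sup\{\langle Tx,x\rangle:\ x\in E_0,\ \|x\|=\mathbf 1\}$. Then $\mathbf m$ and $M$ exist in $L_0^h$, and there are $\lambda_n\in L_0^h$ and $x_n\in E_0$ ($n\ge1$) such that the following hold. 1. $Tx_n=\lambda_nx_n$, $\langle x_i,x_j\rangle=\delta_{ij}\mathbf 1$, $\lambda_n(\omega)\to0$ for a.e. $\omega$, and $Tf=\sum_{n=1}^\infty\lambda_n\langle f,x_n\rangle x_n$ for all $f\in L_{2,2}(\Omega\times S)$, with convergence in the norm of $L_{2,2}$. If $L_2(S)$ is separable, then moreover $f=\sum_n\langle f,x_n\rangle x_n$ in $L_{2,2}$ for all $f\in L_{2,2}(\Omega\times S)$. 2. For every $\lambda\in L_0^h$ and $f\in L_{2,2}(\Omega\times S)$ the series $$E_\lambda f=\sum_{n}\chi_{\{\lambda_n\le\lambda\}}\langle f,x_n\rangle x_n+\chi_{\{\lambda\ge0\}}\Big(f-\sum_n\langle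 f,x_n\rangle x_n\Big)$$ converge in $L_{2,2}$ (the last term vanishes if $L_2(S)$ is separable), $E_\lambda$ is an orthogonal projection in $L_{2,2}(\Omega\times S)$, and for every $\varepsilon>0$ $$T=\int_{\mathbf m}^{M+\varepsilon\mathbf 1}\lambda\,dE_\lambda .$$ 3. For every $\varepsilon>0$ and every $f:\mathbb R\to\mathbb C$ that is continuous on $[\mathbf m(\omega),M(\omega)+\varepsilon]$ for a.e. $\omega$, $$f(T)=\int_{\mathbf m}^{M+\varepsilon\mathbf 1}f(\lambda)\,dE_\lambda ,$$ where $f(T)$ is given by the continuous functional calculus of the self-adjoint operator $T$ on the Hilbert space $L_{2,2}(\Omega\times S)$. In 2 and 3 the integral over the closed order interval $[a,b]\subset L_0^h$ is the limit, in the strong operator topology of $L_{2,2}(\Omega\times S)$, of the Riemann–Stieltjes sums $$f(a)E_a+\sum_{i=1}^{n}f(\xi_i)(E_{p_i}-E_{p_{i-1}}),\qquad a=p_0\le\xi_1\le p_1\le\dots\le\xi_n\le p_n=b,\quad p_i,\xi_i\in L_0^h,$$ as $\delta\to0$, where $p_i-p_{i-1}\le\delta\mathbf 1$ for all $i$. 4.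 Let $B$ be the algebra of $L_0$-linear $L_0$-bounded operators on $E_0$. Let $\operatorname{spm}(T)$ be the set of $\lambda\in L_0$ such that $T-\lambda I$ is not invertible in $B$ and $\pi(T-\lambda I)$ is not invertible in $\pi B$ for any nonzero idempotent $\pi$ of $L_0$, and let $\operatorname{spm}_{\mathrm{disc}}(T)$ be the set of $\lambda\in\operatorname{spm}(T)$ with $\lambda(\omega)\ne0$ for a.e. $\omega$. For each $\lambda\in\operatorname{spm}_{\mathrm{disc}}(T)$ the $L_0$-module $\ker(\lambda I-T)\subset E_0$ is $\sigma$-finitely generated: there is a countable measurable partition $(A_n)$ of $\Omega$ such that each $\chi_{A_n}\ker(\lambda I-T)$ is finitely generated over $L_0$. 5. With $\tilde\lambda_0=0$ and $\tilde\lambda_n=\lambda_n$ for $n\ge1$, $$\operatorname{spm}(T)=\operatorname{mix}\Big\{\sum_{n=0}^\infty\chi_{A_n}\tilde\lambda_n:\ A_n\in\Sigma,\ A_n\cap A_m=\varnothing\ (n\ne m)\Big\},$$ where $\operatorname{mix}K$ is the set of all $\sum_n\chi_{B_n}u_n$ with $u_n\in K$ and $(B_n)$ a countable measurable partition of $\Omega$.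 -/

import Mathlib

open MeasureTheory Filter Topology Set
open scoped ENNReal ComplexOrder ComplexConjugate

namespace PartInt

noncomputable section

/-! ### The algebra `L₀(Ω)` and the Kaplansky-Hilbert module `L₀(Ω, L₂(S))` -/

/-- `L₀(Ω)`: classes of complex measurable functions. -/
abbrev L0 {Ω : Type*} [MeasurableSpace Ω] (μ : Measure Ω) : Type _ := Ω →ₘ[μ] ℂ

/-- `L₀ʰ(Ω)`: classes of real measurable functions. -/
abbrev L0h {Ω : Type*} [MeasurableSpace Ω] (μ : Measure Ω) : Type _ := Ω →ₘ[μ] ℝ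

/-- The pointwise (a.e.) ring structure; it extends the additive and multiplicative structures
of Mathlib. -/
instance instCommRingL0 {α : Type*} [MeasurableSpace α] (ν : Measure α) :
    CommRing (α →ₘ[ν] ℂ) where
  __ := (AEEqFun.instAddCommGroup : AddCommGroup (α →ₘ[ν] ℂ))
  __ := (AEEqFun.instCommMonoid : CommMonoid (α →ₘ[ν] ℂ))
  left_distrib a b c := by
    apply AEEqFun.ext
    filter_upwards [AEEqFun.coeFn_mul a (b + c), AEEqFun.coeFn_add b c,
      AEEqFun.coeFn_add (a * b) (a * c), AEEqFun.coeFn_mul a b, AEEqFun.coeFn_mul a c]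
      with x h1 h2 h3 h4 h5
    simp only [h1, h2, h3, h4, h5, Pi.mul_apply, Pi.add_apply, mul_add]
  right_distrib a b c := by
    apply AEEqFun.ext
    filter_upwards [AEEqFun.coeFn_mul (a + b) c, AEEqFun.coeFn_add a b,
      AEEqFun.coeFn_add (a * c) (b * c), AEEqFun.coeFn_mul a c, AEEqFun.coeFn_mul b c]
      with x h1 h2 h3 h4 h5
    simp only [h1, h2, h3, h4, h5, Pi.mul_apply, Pi.add_apply, add_mul]
  zero_mul a := by
    apply AEEqFun.ext
    filter_upwards [AEEqFun.coeFn_mul 0 a, (AEEqFun.coeFn_zero : ⇑(0 : α →ₘ[ν] ℂ) =ᵐ[ν] 0)]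
      with x h1 h2
    simp only [h1, h2, Pi.mul_apply, Pi.zero_apply, zero_mul]
  mul_zero a := by
    apply AEEqFun.ext
    filter_upwards [AEEqFun.coeFn_mul a 0, (AEEqFun.coeFn_zero : ⇑(0 : α →ₘ[ν] ℂ) =ᵐ[ν] 0)]
      with x h1 h2
    simp only [h1, h2, Pi.mul_apply, Pi.zero_apply, mul_zero]

variable {Ω S : Type*} [MeasurableSpace Ω] [MeasurableSpace S]
variable {μ : Measure Ω} {m : Measure S}

/-- A function of `ω` read as a function of `(ω, s)`. -/
def pull (μ : Measure Ω) (m : Measure S) : L0 μ →+* (Ω × S →ₘ[μ.prod m] ℂ) where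
  toFun a := a.compQuasiMeasurePreserving Prod.fst Measure.quasiMeasurePreserving_fst
  map_one' := rfl
  map_zero' := rfl
  map_mul' a b := by
    induction a using AEEqFun.induction_on
    induction b using AEEqFun.induction_on
    rfl
  map_add' a b := by
    induction a using AEEqFun.induction_on
    induction b using AEEqFun.induction_on
    rfl

theorem coeFn_pull (a : L0 μ) : pull μ m a =ᵐ[μ.prod m] fun p => a p.1 :=
  AEEqFun.coeFn_compQuasiMeasurePreserving a Measure.quasiMeasurePreserving_fst

/-- `L₀(Ω)` acts on measurable functions of `(ω, s)` by `(a • f)(ω, s) = a(ω) f(ω, s)`. -/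
instance instModuleL0 : Module (L0 μ) (Ω × S →ₘ[μ.prod m] ℂ) := Module.compHom _ (pull μ m)

theorem coeFn_L0_smul (a : L0 μ) (f : Ω × S →ₘ[μ.prod m] ℂ) :
    ⇑(a • f) =ᵐ[μ.prod m] fun p => a p.1 * f p := by
  filter_upwards [AEEqFun.coeFn_mul (pull μ m a) f, coeFn_pull (m := m) a] with p h1 h2
  rw [← h2]
  exact h1

/-- The Kaplansky-Hilbert module `L₀(Ω, L₂(S))` over `L₀(Ω)`, realised by functions of two
variables: classes of measurable `f(ω, s)` with `f(ω, ·) ∈ L₂(S)` for almost every `ω`.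
It contains `L_{2,2}(Ω × S)` and is the module that `L_{2,2}(Ω × S)` generates over `L₀(Ω)`. -/
def KH (μ : Measure Ω) (m : Measure S) [SFinite m] :
    Submodule (L0 μ) (Ω × S →ₘ[μ.prod m] ℂ) where
  carrier := {f | ∀ᵐ ω ∂μ, MemLp (fun s => f (ω, s)) 2 m}
  zero_mem' := by
    filter_upwards [Measure.ae_ae_of_ae_prod
      (AEEqFun.coeFn_zero : ⇑(0 : Ω × S →ₘ[μ.prod m] ℂ) =ᵐ[μ.prod m] 0)] with ω h
    exact (memLp_congr_ae h).2 MemLp.zero'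
  add_mem' {f g} hf hg := by
    filter_upwards [hf, hg, Measure.ae_ae_of_ae_prod (AEEqFun.coeFn_add f g)] with ω h1 h2 h3
    exact (memLp_congr_ae h3).2 (h1.add h2)
  smul_mem' a f hf := by
    filter_upwards [hf, Measure.ae_ae_of_ae_prod (coeFn_L0_smul a f)] with ω h1 h2
    exact (memLp_congr_ae h2).2 (h1.const_mul (a ω))

/-- `L_{2,2}(Ω × S)`, with its norm `(∫∫ |f|² dm dμ)^{1/2}`. -/
abbrev L22 (μ : Measure Ω) (m : Measure S) : Type _ := Lp ℂ 2 (μ.prod m)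

theorem sections_memLp [SFinite μ] [SFinite m] (f : L22 μ m) :
    ∀ᵐ ω ∂μ, MemLp (fun s => f (ω, s)) 2 m := by
  have h0 : ∫⁻ p, ‖f p‖ₑ ^ (2 : ℝ) ∂(μ.prod m) < ∞ := by
    have := lintegral_rpow_enorm_lt_top_of_eLpNorm_lt_top (p := 2) (by norm_num) (by norm_num)
      (Lp.memLp f).2
    simpa using this
  have hm : AEMeasurable (fun p => ‖f p‖ₑ ^ (2 : ℝ)) (μ.prod m) :=
    (Lp.aestronglyMeasurable f).enorm.pow_const _
  rw [lintegral_prod _ hm] at h0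
  filter_upwards [ae_lt_top' hm.lintegral_prod_right' h0.ne,
    (Lp.aestronglyMeasurable f).prodMk_left] with ω h1 h2
  refine ⟨h2, ?_⟩
  rw [eLpNorm_lt_top_iff_lintegral_rpow_enorm_lt_top (by norm_num) (by norm_num)]
  simpa using h1

/-- The inclusion of `L_{2,2}(Ω × S)` into `L₀(Ω, L₂(S))`. -/
def toKH [SFinite μ] [SFinite m] (f : L22 μ m) : KH μ m := ⟨f.1, sections_memLp f⟩

/-- The norm of `L_{2,2}(Ω × S)`, with the value `∞` off this space. -/
def norm22 [SFinite m] (u : KH μ m) : ℝ≥0∞ := eLpNorm (u : Ω × S →ₘ[μ.prod m] ℂ) 2 (μ.prod m)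

/-- The `L₀`-valued inner product `⟨x, y⟩(ω) = ∫ x(ω, s) conj (y(ω, s)) dm(s)`. -/
def inner0 [SFinite m] (x y : KH μ m) : L0 μ :=
  AEEqFun.mk (fun ω => ∫ s, x.1 (ω, s) * conj (y.1 (ω, s)) ∂m)
    (AEStronglyMeasurable.integral_prod_right' (f := fun p => x.1 p * conj (y.1 p))
      (x.1.aestronglyMeasurable.mul
        (Complex.continuous_conj.comp_aestronglyMeasurable y.1.aestronglyMeasurable)))

/-- The `L₀`-valued norm `‖x‖ = √⟨x, x⟩`. -/
def norm0 [SFinite m] (x : KH μ m) : L0h μ :=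
  AEEqFun.comp (fun z : ℂ => Real.sqrt z.re) (by fun_prop) (inner0 x x)

/-- A real function as an element of `L₀(Ω)`. -/
def ofReal0 (a : L0h μ) : L0 μ := AEEqFun.comp (fun r : ℝ => (r : ℂ)) (by fun_prop) a

/-- The idempotent `χ_A` of `L₀(Ω)` given by a measurable set `A`. -/
def chi (μ : Measure Ω) (A : Set Ω) (hA : MeasurableSet A) : L0 μ :=
  AEEqFun.mk (A.indicator 1) (stronglyMeasurable_one.indicator hA).aestronglyMeasurable

/-- The idempotent `χ_{a ≤ b}` of `L₀(Ω)`. -/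
def chiLe (a b : L0h μ) : L0 μ :=
  chi μ {ω | a ω ≤ b ω} (measurableSet_le a.measurable b.measurable)

/-! ### The partially integral operator -/

theorem quasi_sections [SFinite μ] [SFinite m] :
    Measure.QuasiMeasurePreserving (fun q : (Ω × S) × S => (q.1.1, q.2))
      ((μ.prod m).prod m) (μ.prod m) := by
  refine ⟨by fun_prop, Measure.AbsolutelyContinuous.mk fun s hs h => ?_⟩
  rw [Measure.map_apply (by fun_prop) hs,
    Measure.measure_prod_null (hs.preimage (by fun_prop))]
  exact Measure.quasiMeasurePreserving_fst.ae (Measure.measure_ae_null_of_prod_null h)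

section Operator

variable [IsFiniteMeasure μ] [IsFiniteMeasure m]

/-- Bounded kernels `k(ω, t, s)`, that is, the elements of `L_∞(Ω × S²)`. -/
abbrev Kernel (μ : Measure Ω) (m : Measure S) : Type _ := Lp ℂ ∞ (μ.prod (m.prod m))

theorem kernel_measurable (k : Kernel μ m) (f : Ω × S →ₘ[μ.prod m] ℂ) :
    AEStronglyMeasurable (fun q : (Ω × S) × S => k (q.1.1, q.1.2, q.2) * f (q.1.1, q.2))
      ((μ.prod m).prod m) :=
  ((Lp.aestronglyMeasurable k).comp_measurePreserving (measurePreserving_prodAssoc μ m m)).mul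
    (f.aestronglyMeasurable.comp_quasiMeasurePreserving quasi_sections)

/-- `(T f)(ω, t) = ∫ k(ω, t, s) f(ω, s) dm(s)`. -/
def integralOp (k : Kernel μ m) (f : Ω × S →ₘ[μ.prod m] ℂ) : Ω × S →ₘ[μ.prod m] ℂ :=
  AEEqFun.mk (fun p => ∫ s, k (p.1, p.2, s) * f (p.1, s) ∂m)
    (kernel_measurable k f).integral_prod_right'

theorem coeFn_integralOp (k : Kernel μ m) (f : Ω × S →ₘ[μ.prod m] ℂ) :
    ∀ᵐ ω ∂μ, ∀ᵐ t ∂m, integralOp k f (ω, t) = ∫ s, k (ω, t, s) * f (ω, s) ∂m :=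
  Measure.ae_ae_of_ae_prod (AEEqFun.coeFn_mk _ _)

theorem kernel_bound (k : Kernel μ m) :
    ∀ᵐ ω ∂μ, ∀ᵐ t ∂m, ∀ᵐ s ∂m, ‖k (ω, t, s)‖ₑ ≤ ‖k‖ₑ := by
  have h : ∀ᵐ z ∂(μ.prod (m.prod m)), ‖k z‖ₑ ≤ ‖k‖ₑ := by
    rw [Lp.enorm_def, eLpNorm_exponent_top]
    exact ae_le_eLpNormEssSup
  filter_upwards [Measure.ae_ae_of_ae_prod h] with ω h1
  exact Measure.ae_ae_of_ae_prod h1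

theorem kernel_sections (k : Kernel μ m) :
    ∀ᵐ ω ∂μ, ∀ᵐ t ∂m, AEStronglyMeasurable (fun s => k (ω, t, s)) m := by
  filter_upwards [(Lp.aestronglyMeasurable k).prodMk_left] with ω h1
  exact h1.prodMk_left

theorem integrable_kernel_mul (k : Kernel μ m) {f : Ω × S →ₘ[μ.prod m] ℂ} (hf : f ∈ KH μ m) :
    ∀ᵐ ω ∂μ, ∀ᵐ t ∂m, Integrable (fun s => k (ω, t, s) * f (ω, s)) m := by
  filter_upwards [hf, kernel_bound k, kernel_sections k] with ω h1 h2 h3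
  filter_upwards [h2, h3] with t h4 h5
  refine (h1.integrable (by norm_num)).bdd_mul (c := ‖k‖) h5 ?_
  filter_upwards [h4] with s h6
  exact enorm_le_iff_norm_le.1 h6

theorem enorm_integral_le (k : Kernel μ m) (f : Ω × S →ₘ[μ.prod m] ℂ) :
    ∀ᵐ ω ∂μ, ∀ᵐ t ∂m, ‖integralOp k f (ω, t)‖ₑ ≤
      ‖k‖ₑ * eLpNorm (fun s => f (ω, s)) 1 m := by
  filter_upwards [coeFn_integralOp k f, kernel_bound k, f.aestronglyMeasurable.prodMk_left]
    with ω h1 h2 h3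
  filter_upwards [h1, h2] with t h4 h5
  rw [h4, eLpNorm_one_eq_lintegral_enorm, ← lintegral_const_mul'' _ h3.enorm]
  refine (enorm_integral_le_lintegral_enorm _).trans (lintegral_mono_ae ?_)
  filter_upwards [h5] with s h6
  rw [enorm_mul]
  gcongr

theorem integralOp_mem (k : Kernel μ m) {f : Ω × S →ₘ[μ.prod m] ℂ} (hf : f ∈ KH μ m) :
    integralOp k f ∈ KH μ m := by
  filter_upwards [hf, enorm_integral_le k f, (integralOp k f).aestronglyMeasurable.prodMk_left]
    with ω h1 h2 h3
  have hfin : ‖k‖ₑ * eLpNorm (fun s => f (ω, s)) 1 m ≠ ∞ :=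
    ENNReal.mul_ne_top enorm_ne_top (h1.mono_exponent (by norm_num)).2.ne
  refine MemLp.of_bound h3 (‖k‖ₑ * eLpNorm (fun s => f (ω, s)) 1 m).toReal ?_
  filter_upwards [h2] with t h4
  rw [← toReal_enorm]
  exact ENNReal.toReal_mono hfin h4

theorem ext_sections {F G : Ω × S →ₘ[μ.prod m] ℂ} (h : ∀ᵐ ω ∂μ, ∀ᵐ t ∂m, F (ω, t) = G (ω, t)) :
    F = G :=
  AEEqFun.ext ((Measure.ae_prod_iff_ae_ae (p := fun p => F p = G p)
    (measurableSet_eq_fun F.measurable G.measurable)).2 h)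

theorem integralOp_add (k : Kernel μ m) {f g : Ω × S →ₘ[μ.prod m] ℂ}
    (hf : f ∈ KH μ m) (hg : g ∈ KH μ m) :
    integralOp k (f + g) = integralOp k f + integralOp k g := by
  apply ext_sections
  filter_upwards [coeFn_integralOp k f, coeFn_integralOp k g, coeFn_integralOp k (f + g),
    integrable_kernel_mul k hf, integrable_kernel_mul k hg,
    Measure.ae_ae_of_ae_prod (AEEqFun.coeFn_add f g),
    Measure.ae_ae_of_ae_prod (AEEqFun.coeFn_add (integralOp k f) (integralOp k g))]
    with ω h1 h2 h3 h4 h5 h6 h7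
  filter_upwards [h1, h2, h3, h4, h5, h7] with t g1 g2 g3 g4 g5 g7
  rw [g3, g7, Pi.add_apply, g1, g2, ← integral_add g4 g5]
  refine integral_congr_ae ?_
  filter_upwards [h6] with s h
  rw [h, Pi.add_apply, mul_add]

theorem integralOp_smul (k : Kernel μ m) (a : L0 μ) (f : Ω × S →ₘ[μ.prod m] ℂ) :
    integralOp k (a • f) = a • integralOp k f := by
  apply ext_sections
  filter_upwards [coeFn_integralOp k f, coeFn_integralOp k (a • f),
    Measure.ae_ae_of_ae_prod (coeFn_L0_smul a f),
    Measure.ae_ae_of_ae_prod (coeFn_L0_smul a (integralOp k f))] with ω h1 h2 h3 h4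
  filter_upwards [h1, h2, h4] with t g1 g2 g4
  rw [g2, g4, g1, ← integral_const_mul]
  refine integral_congr_ae ?_
  filter_upwards [h3] with s h
  rw [h]
  ring

theorem integralOp_const_smul (k : Kernel μ m) (c : ℂ) (f : Ω × S →ₘ[μ.prod m] ℂ) :
    integralOp k (c • f) = c • integralOp k f := by
  apply ext_sections
  filter_upwards [coeFn_integralOp k f, coeFn_integralOp k (c • f),
    Measure.ae_ae_of_ae_prod (AEEqFun.coeFn_smul c f),
    Measure.ae_ae_of_ae_prod (AEEqFun.coeFn_smul c (integralOp k f))] with ω h1 h2 h3 h4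
  filter_upwards [h1, h2, h4] with t g1 g2 g4
  rw [g2, g4, Pi.smul_apply, g1, smul_eq_mul, ← integral_const_mul]
  refine integral_congr_ae ?_
  filter_upwards [h3] with s h
  rw [h, Pi.smul_apply, smul_eq_mul]
  ring

theorem eLpNorm_integralOp_le (k : Kernel μ m) (f : Ω × S →ₘ[μ.prod m] ℂ) :
    eLpNorm (integralOp k f) 2 (μ.prod m) ≤ ‖k‖ₑ * m univ * eLpNorm f 2 (μ.prod m) := by
  have key : ∀ᵐ ω ∂μ, ∫⁻ t, ‖integralOp k f (ω, t)‖ₑ ^ (2 : ℝ) ∂m ≤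
      (‖k‖ₑ * m univ) ^ (2 : ℝ) * ∫⁻ t, ‖f (ω, t)‖ₑ ^ (2 : ℝ) ∂m := by
    filter_upwards [enorm_integral_le k f, f.aestronglyMeasurable.prodMk_left] with ω h1 h2
    have h3 := eLpNorm_le_eLpNorm_mul_rpow_measure_univ (p := 1) (q := 2) (by norm_num) h2
    have h4 : eLpNorm (fun s => f (ω, s)) 2 m ^ (2 : ℝ) = ∫⁻ t, ‖f (ω, t)‖ₑ ^ (2 : ℝ) ∂m := by
      rw [eLpNorm_eq_lintegral_rpow_enorm_toReal (by norm_num) (by norm_num), ← ENNReal.rpow_mul]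
      norm_num
    have h5 : (m univ ^ (1 / (1 : ℝ≥0∞).toReal - 1 / (2 : ℝ≥0∞).toReal)) ^ (2 : ℝ) = m univ := by
      rw [← ENNReal.rpow_mul]
      norm_num
    calc ∫⁻ t, ‖integralOp k f (ω, t)‖ₑ ^ (2 : ℝ) ∂m
        ≤ ∫⁻ _, (‖k‖ₑ * eLpNorm (fun s => f (ω, s)) 1 m) ^ (2 : ℝ) ∂m := by
          refine lintegral_mono_ae ?_
          filter_upwards [h1] with t h
          gcongr
      _ = (‖k‖ₑ * eLpNorm (fun s => f (ω, s)) 1 m) ^ (2 : ℝ) * m univ := lintegral_const _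
      _ ≤ (‖k‖ₑ * (eLpNorm (fun s => f (ω, s)) 2 m *
            m univ ^ (1 / (1 : ℝ≥0∞).toReal - 1 / (2 : ℝ≥0∞).toReal))) ^ (2 : ℝ) * m univ := by
          gcongr
      _ = (‖k‖ₑ * m univ) ^ (2 : ℝ) * ∫⁻ t, ‖f (ω, t)‖ₑ ^ (2 : ℝ) ∂m := by
          rw [ENNReal.mul_rpow_of_nonneg _ _ (by norm_num),
            ENNReal.mul_rpow_of_nonneg _ _ (by norm_num), h5, h4,
            ENNReal.mul_rpow_of_nonneg _ _ (by norm_num), ENNReal.rpow_two (m univ)]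
          ring
  have hm1 : AEMeasurable (fun p => ‖f p‖ₑ ^ (2 : ℝ)) (μ.prod m) :=
    f.aestronglyMeasurable.enorm.pow_const _
  have hm2 : AEMeasurable (fun p => ‖integralOp k f p‖ₑ ^ (2 : ℝ)) (μ.prod m) :=
    (integralOp k f).aestronglyMeasurable.enorm.pow_const _
  rw [← ENNReal.rpow_le_rpow_iff (z := 2) (by norm_num),
    ENNReal.mul_rpow_of_nonneg _ _ (by norm_num)]
  have h2 : ∀ g : Ω × S → ℂ, eLpNorm g 2 (μ.prod m) ^ (2 : ℝ) =
      ∫⁻ p, ‖g p‖ₑ ^ (2 : ℝ) ∂(μ.prod m) := by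
    intro g
    rw [eLpNorm_eq_lintegral_rpow_enorm_toReal (by norm_num) (by norm_num), ← ENNReal.rpow_mul]
    norm_num
  rw [h2, h2, lintegral_prod _ hm1, lintegral_prod _ hm2,
    ← lintegral_const_mul'' _ hm1.lintegral_prod_right']
  exact lintegral_mono_ae key

/-- The partially integral operator with kernel `k` on `L₀(Ω, L₂(S))`. -/
def opKH (k : Kernel μ m) : KH μ m →ₗ[L0 μ] KH μ m where
  toFun u := ⟨integralOp k u.1, integralOp_mem k u.2⟩
  map_add' u v := Subtype.ext (integralOp_add k u.2 v.2)
  map_smul' a u := Subtype.ext (integralOp_smul k a u.1)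

theorem integralOp_memLp (k : Kernel μ m) (f : L22 μ m) :
    integralOp k f.1 ∈ Lp ℂ 2 (μ.prod m) :=
  Lp.mem_Lp_iff_eLpNorm_lt_top.2 ((eLpNorm_integralOp_le k f.1).trans_lt
    (ENNReal.mul_lt_top (ENNReal.mul_lt_top enorm_lt_top (measure_lt_top m univ))
      (Lp.eLpNorm_lt_top f)))

/-- The partially integral operator with kernel `k` on `L_{2,2}(Ω × S)`. -/
def op22 (k : Kernel μ m) : L22 μ m →L[ℂ] L22 μ m :=
  LinearMap.mkContinuous
    { toFun := fun f => ⟨integralOp k f.1, integralOp_memLp k f⟩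
      map_add' := fun f g => Subtype.ext
        (integralOp_add k (sections_memLp f) (sections_memLp g))
      map_smul' := fun c f => Subtype.ext (integralOp_const_smul k c f.1) }
    (‖k‖ * (m univ).toReal) (by
      intro f
      have h := ENNReal.toReal_mono (ENNReal.mul_ne_top
        (ENNReal.mul_ne_top enorm_ne_top (measure_ne_top m univ)) (Lp.eLpNorm_ne_top f))
        (eLpNorm_integralOp_le k f.1)
      rw [ENNReal.toReal_mul, ENNReal.toReal_mul, toReal_enorm] at h
      exact h)

/-- The kernel is Hermitian: `k(ω, t, s) = conj (k(ω, s, t))`. -/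
def IsHermitianKernel (k : Kernel μ m) : Prop :=
  ∀ᵐ z ∂(μ.prod (m.prod m)), k (z.1, z.2.1, z.2.2) = conj (k (z.1, z.2.2, z.2.1))

/-- The kernel is positive semidefinite: for all `x ∈ L_{2,2}(Ω × S)`, for almost every `ω`,
`∫∫ k(ω, t, s) x(ω, s) conj (x(ω, t)) dm(s) dm(t) ≥ 0`. -/
def IsPosSemidefKernel (k : Kernel μ m) : Prop :=
  ∀ x : L22 μ m, ∀ᵐ ω ∂μ,
    0 ≤ ∫ t, ∫ s, k (ω, t, s) * x (ω, s) * conj (x (ω, t)) ∂m ∂m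

/-- The values `⟨T x, x⟩` for `‖x‖ = 1`. -/
def numericalRange (k : Kernel μ m) : Set (L0h μ) :=
  {a | ∃ x : KH μ m, norm0 x = 1 ∧ ofReal0 a = inner0 (opKH k x) x}

/-! ### Expansions in eigenfunctions -/

/-- `λ_n ∈ L₀ʰ(Ω)` and `x_n` are eigenvalues and eigenfunctions of `T`, the `x_n(ω, ·)` are
orthonormal in `L₂(S)`, and `λ_n(ω) → 0`. -/
structure IsEigenSystem (k : Kernel μ m) (lam : ℕ → L0h μ) (x : ℕ → KH μ m) : Prop where
  eigen : ∀ n, opKH k (x n) = ofReal0 (lam n) • x n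
  orthonormal : ∀ i j, inner0 (x i) (x j) = if i = j then 1 else 0
  tendsto : ∀ᵐ ω ∂μ, Tendsto (fun n => lam n ω) atTop (𝓝 0)

/-- The partial sum `∑_{n < N} ⟨f, x_n⟩ x_n`. -/
def fourierSum (x : ℕ → KH μ m) (N : ℕ) (f : L22 μ m) : KH μ m :=
  ∑ n ∈ Finset.range N, inner0 (toKH f) (x n) • x n

/-- `T f = ∑ λ_n ⟨f, x_n⟩ x_n` with convergence in the norm of `L_{2,2}(Ω × S)`. -/
def HasEigenExpansion (k : Kernel μ m) (lam : ℕ → L0h μ) (x : ℕ → KH μ m) : Prop :=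
  ∀ f : L22 μ m, Tendsto (fun N => norm22 (toKH (op22 k f) -
    ∑ n ∈ Finset.range N, ofReal0 (lam n) • inner0 (toKH f) (x n) • x n)) atTop (𝓝 0)

/-- The eigenfunctions are complete in `L_{2,2}(Ω × S)`. -/
def IsCompleteSystem (x : ℕ → KH μ m) : Prop :=
  ∀ f : L22 μ m, Tendsto (fun N => norm22 (toKH f - fourierSum x N f)) atTop (𝓝 0)

/-- The family of orthogonal projections
`E_λ f = ∑_{n : λ_n(ω) ≤ λ(ω)} ⟨f, x_n⟩ x_n + χ_{0 ≤ λ} (f - ∑_n ⟨f, x_n⟩ x_n)`, `λ ∈ L₀ʰ(Ω)`.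
The last term vanishes if the `x_n` are complete; otherwise it accounts for the part of the
kernel of `T` that is orthogonal to all `x_n`. -/
def IsSpectralFamily (lam : ℕ → L0h μ) (x : ℕ → KH μ m)
    (E : L0h μ → L22 μ m →L[ℂ] L22 μ m) : Prop :=
  ∀ l : L0h μ, IsStarProjection (E l) ∧
    ∀ f : L22 μ m, Tendsto (fun N => norm22 (toKH (E l f) -
      ((∑ n ∈ Finset.range N, chiLe (lam n) l • inner0 (toKH f) (x n) • x n) +
        chiLe 0 l • (toKH f - fourierSum x N f)))) atTop (𝓝 0)

/-! ### Integrals with respect to a spectral family -/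

/-- `a = p 0 ≤ ξ 0 ≤ p 1 ≤ ξ 1 ≤ ... ≤ p n = b` is a tagged partition of the order interval
`[a, b]` in `L₀ʰ(Ω)` whose mesh is at most `δ`. -/
def IsTaggedPartition (a b : L0h μ) (δ : ℝ) (n : ℕ) (p ξ : ℕ → L0h μ) : Prop :=
  p 0 = a ∧ p n = b ∧
    ∀ i < n, p i ≤ ξ i ∧ ξ i ≤ p (i + 1) ∧ p (i + 1) ≤ p i + AEEqFun.const Ω δ

/-- The Riemann-Stieltjes sum `f(a) E_a g + ∑_i f(ξ_i) (E_{p (i+1)} - E_{p i}) g` over the closed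
order interval; the first term is the jump of the spectral family at the left end point `a`. -/
def stieltjesSum (f : ℝ → ℂ) (E : L0h μ → L22 μ m →L[ℂ] L22 μ m) (n : ℕ) (p ξ : ℕ → L0h μ)
    (g : L22 μ m) (z : Ω × S) : ℂ :=
  f (p 0 z.1) * E (p 0) g z +
    ∑ i ∈ Finset.range n, f (ξ i z.1) * (E (p (i + 1)) g - E (p i) g : L22 μ m) z

/-- `A = ∫_a^b f(λ) dE_λ`, as a limit of Riemann-Stieltjes sums in the strong operator topology
of `L_{2,2}(Ω × S)`. -/
def HasSpectralIntegral (f : ℝ → ℂ) (E : L0h μ → L22 μ m →L[ℂ] L22 μ m) (a b : L0h μ)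
    (A : L22 μ m →L[ℂ] L22 μ m) : Prop :=
  ∀ g : L22 μ m, ∀ η : ℝ, 0 < η → ∃ δ : ℝ, 0 < δ ∧
    ∀ (n : ℕ) (p ξ : ℕ → L0h μ), IsTaggedPartition a b δ n p ξ →
      eLpNorm (fun z => stieltjesSum f E n p ξ g z - A g z) 2 (μ.prod m) ≤ ENNReal.ofReal η

/-! ### Modular spectra -/

/-- `R` is `L₀`-bounded: `‖R u‖ ≤ c ‖u‖` for some `c ∈ L₀ʰ(Ω)`. -/
def IsL0Bounded (R : KH μ m →ₗ[L0 μ] KH μ m) : Prop :=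
  ∃ c : L0h μ, ∀ u, norm0 (R u) ≤ c * norm0 u

/-- `π A` is invertible in `π B`, where `B` is the algebra of `L₀`-linear `L₀`-bounded operators
and `π` is an idempotent of `L₀(Ω)`. -/
def IsInvertibleOn (π : L0 μ) (A : KH μ m →ₗ[L0 μ] KH μ m) : Prop :=
  ∃ R : KH μ m →ₗ[L0 μ] KH μ m, IsL0Bounded R ∧
    (π • A) ∘ₗ (π • R) = π • LinearMap.id ∧ (π • R) ∘ₗ (π • A) = π • LinearMap.id

/-- The modular spectrum `sp(A)`: all `λ ∈ L₀(Ω)` such that `A - λ I` is not invertible. -/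
def modularSpectrum (A : KH μ m →ₗ[L0 μ] KH μ m) : Set (L0 μ) :=
  {l | ¬ IsInvertibleOn 1 (A - l • LinearMap.id)}

/-- The cyclic modular spectrum `spm(A)`: all `λ ∈ sp(A)` such that `π (A - λ I)` is not
invertible in `π B` for any nonzero idempotent `π` of `L₀(Ω)`. -/
def cyclicSpectrum (A : KH μ m →ₗ[L0 μ] KH μ m) : Set (L0 μ) :=
  {l | l ∈ modularSpectrum A ∧
    ∀ π : L0 μ, IsIdempotentElem π → π ≠ 0 → ¬ IsInvertibleOn π (A - l • LinearMap.id)}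

/-- The discrete part of `spm(A)`, for a cyclically compact `A`: the `λ ∈ spm(A)` with
`λ(ω) ≠ 0` for almost every `ω`. -/
def discreteCyclicSpectrum (A : KH μ m →ₗ[L0 μ] KH μ m) : Set (L0 μ) :=
  {l | l ∈ cyclicSpectrum A ∧ ∀ᵐ ω ∂μ, l ω ≠ 0}

/-- Measurable partitions of `Ω` into countably many sets. -/
structure IsPartition (A : ℕ → Set Ω) : Prop where
  measurable : ∀ n, MeasurableSet (A n)
  disjoint : Pairwise (Function.onFun Disjoint A)
  cover : ⋃ n, A n = univ

/-- A submodule `N` is `σ`-finitely generated: there is a countable partition of unity `χ_{A n}`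
such that every `χ_{A n} N` is finitely generated over `L₀(Ω)`. -/
def IsSigmaFG (N : Submodule (L0 μ) (KH μ m)) : Prop :=
  ∃ (A : ℕ → Set Ω) (hA : IsPartition A),
    ∀ n, (N.map (LinearMap.lsmul (L0 μ) (KH μ m) (chi μ (A n) (hA.measurable n)))).FG

/-- All mixings `∑ χ_{A n} u_n` of elements `u_n ∈ K` with respect to partitions of unity
(which are countable, since the measure is finite). -/
def mix (K : Set (L0 μ)) : Set (L0 μ) :=
  {v | ∃ (A : ℕ → Set Ω) (u : ℕ → L0 μ), IsPartition A ∧ (∀ n, u n ∈ K) ∧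
    ∀ n, ∀ᵐ ω ∂μ, ω ∈ A n → v ω = u n ω}

/-- The functions `λ̃_0 = 0` and `λ̃_n = λ_n`, `n ≥ 1`. -/
def withZero (lam : ℕ → L0h μ) : ℕ → L0 μ
  | 0 => 0
  | n + 1 => ofReal0 (lam n)

/-- All sums `∑ χ_{A n} λ̃_n` with measurable and pairwise disjoint `A n`. -/
def disjointSums (v : ℕ → L0 μ) : Set (L0 μ) :=
  {u | ∃ A : ℕ → Set Ω, (∀ n, MeasurableSet (A n)) ∧ Pairwise (Function.onFun Disjoint A) ∧
    ∀ᵐ ω ∂μ, u ω = ∑' n, (A n).indicator (v n) ω}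

end Operator

end

end PartInt

/-! For almost every `ω` the operator `T` acts on the fibre `u(ω, ·) ∈ L₂(S)` as the Hilbert-Schmidt
operator `T_ω` with kernel `k(ω, ·, ·)`, so the theorem is the spectral theorem for compact
self-adjoint operators with measurable dependence on `ω`. Eigenvectors are chosen measurably by the
power method: for each field `u` the rescaled iterates `T²ⁿ u / ‖T²ⁿ u‖` converge on every fibre
with `T u ≠ 0`, and the limit field `y` satisfies `T² y = l² y`, so that `T y + l y`, or `y` itself,
is an eigenfield of `T`. Fix a sequence `e` of elements of `L₂(S)` with infinite-dimensional span,
dense if `L₂(S)` is separable. Zorn's lemma gives an orthogonal family of eigenfields, maximal among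
those orthogonal to every field that `T` annihilates and that is orthogonal to `e`. The family is
countable because `μ` is finite and the Hilbert-Schmidt norms of the `T_ω` are bounded. By the
choice of `e`, infinitely many members are nonzero on almost every fibre; enumerating them there
gives the orthonormal sequence `x_n`. On each fibre `T` and the projections `E_λ` are then diagonal
operators, so that the Riemann-Stieltjes sums reduce to those of the step functions
`r ↦ 1_{λ_n(ω) ≤ r}`, the spectrum consists of mixings of the `λ_n` and `0`, and the eigenmodules
are finitely generated over the sets where only `λ_1, …, λ_N` can equal `λ`. -/

namespace PartInt

open scoped NNReal

noncomputable section

/-! ### Compact symmetric operators -/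

section Hilbert

variable {𝕜 H : Type*} [RCLike 𝕜] [NormedAddCommGroup H] [InnerProductSpace 𝕜 H]

variable (𝕜) in
/-- A pairwise orthogonal family of vectors of norm zero or one. The fibres over a point of `Ω` of
an orthogonal family of partial units in `L₀(Ω, L₂(S))` form such a family. -/
structure PartialOrthonormal {ι : Type*} (v : ι → H) : Prop where
  norm_eq : ∀ i, ‖v i‖ = 0 ∨ ‖v i‖ = 1
  inner_eq : Pairwise fun i j => inner 𝕜 (v i) (v j) = 0

theorem PartialOrthonormal.sum_sq_inner_le {ι : Type*} {v : ι → H} (hv : PartialOrthonormal 𝕜 v)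
    (s : Finset ι) (x : H) : ∑ i ∈ s, ‖inner 𝕜 (v i) x‖ ^ 2 ≤ ‖x‖ ^ 2 := by
  classical
  have hw : Orthonormal 𝕜 fun i : {i // ‖v i‖ = 1} => v i :=
    ⟨fun i => i.2, fun i j hij => hv.inner_eq fun h => hij (Subtype.ext h)⟩
  refine le_trans (le_of_eq ?_) (hw.sum_inner_products_le x (s := s.subtype fun i => ‖v i‖ = 1))
  rw [Finset.sum_subtype_eq_sum_filter (f := fun i => ‖inner 𝕜 (v i) x‖ ^ 2),
    Finset.sum_filter_of_ne]
  intro i _ hi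
  refine (hv.norm_eq i).resolve_left fun h => hi ?_
  rw [norm_eq_zero.1 h]
  simp

section Compactness

variable {F : Type*} [NormedAddCommGroup F] [NormedSpace 𝕜 F]

theorem orthonormal_finset_insert [DecidableEq H] {s : Finset H} {x : H}
    (hs : Orthonormal 𝕜 (Subtype.val : s → H)) (hx : ‖x‖ = 1) (hxs : ∀ v ∈ s, inner 𝕜 v x = 0) :
    Orthonormal 𝕜 (Subtype.val : ↥(insert x s) → H) := by
  refine ⟨fun ⟨v, hv⟩ => ?_, fun ⟨v, hv⟩ ⟨w, hw⟩ hvw => ?_⟩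
  · rcases Finset.mem_insert.1 hv with rfl | hvs
    · exact hx
    · exact hs.1 ⟨v, hvs⟩
  · have hne : v ≠ w := fun h => hvw (Subtype.ext h)
    change inner 𝕜 v w = 0
    rcases Finset.mem_insert.1 hv with rfl | hvs <;> rcases Finset.mem_insert.1 hw with rfl | hws
    · exact absurd rfl hne
    · exact inner_eq_zero_symm.1 (hxs w hws)
    · exact hxs v hvs
    · exact hs.2 (i := ⟨v, hvs⟩) (j := ⟨w, hws⟩) fun h => hne (congrArg Subtype.val h)

theorem norm_map_le_of_forall_unit (T : H →L[𝕜] F) (U : Submodule 𝕜 H) {ε : ℝ}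
    (h : ∀ x ∈ U, ‖x‖ = 1 → ‖T x‖ ≤ ε) {x : H} (hx : x ∈ U) : ‖T x‖ ≤ ε * ‖x‖ := by
  rcases eq_or_ne x 0 with rfl | hx₀
  · simp
  have hpos : 0 < ‖x‖ := norm_pos_iff.2 hx₀
  have hunit := h (((‖x‖⁻¹ : ℝ) : 𝕜) • x) (U.smul_mem _ hx)
    (by rw [norm_smul, RCLike.norm_ofReal, abs_inv, abs_norm, inv_mul_cancel₀ hpos.ne'])
  rwa [map_smul, norm_smul, RCLike.norm_ofReal, abs_inv, abs_norm, inv_mul_le_iff₀ hpos,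
    mul_comm] at hunit

/-- A finite orthonormal set almost maximizing `∑ ‖T v‖²` leaves almost nothing for the vectors
orthogonal to it. -/
theorem exists_finset_norm_map_le_of_sum_sq_le (T : H →L[𝕜] F) {C ε : ℝ} (hε : 0 < ε)
    (hT : ∀ s : Finset H, Orthonormal 𝕜 (Subtype.val : s → H) → ∑ v ∈ s, ‖T v‖ ^ 2 ≤ C) :
    ∃ s : Finset H, ∀ x ∈ (Submodule.span 𝕜 (s : Set H))ᗮ, ‖T x‖ ≤ ε * ‖x‖ := by
  classical
  let sums : Set ℝ := {r | ∃ s : Finset H, Orthonormal 𝕜 (Subtype.val : s → H) ∧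
    r = ∑ v ∈ s, ‖T v‖ ^ 2}
  have hbdd : BddAbove sums := ⟨C, by rintro _ ⟨s, hs, rfl⟩; exact hT s hs⟩
  have hne : sums.Nonempty := ⟨_, ∅, Orthonormal.of_isEmpty _, rfl⟩
  obtain ⟨_, ⟨s, hs, rfl⟩, hlt⟩ := exists_lt_of_lt_csSup hne
    (show sSup sums - ε ^ 2 < sSup sums by linarith [pow_pos hε 2])
  refine ⟨s, fun x hx => norm_map_le_of_forall_unit T _ (fun y hy hy1 => ?_) hx⟩
  have hys : ∀ v ∈ s, inner 𝕜 v y = 0 := fun v hv => hy v (Submodule.subset_span hv)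
  have hyn : y ∉ s := fun h => by
    have hy0 : y = 0 := inner_self_eq_zero.1 (hys y h)
    simp [hy0] at hy1
  have hle := le_csSup hbdd ⟨_, orthonormal_finset_insert hs hy1 hys, rfl⟩
  rw [Finset.sum_insert hyn] at hle
  exact (abs_le_of_sq_le_sq' (by linarith) hε.le).2

theorem isCompactOperator_comp_starProjection (T : H →L[𝕜] F) (U : Submodule 𝕜 H)
    [FiniteDimensional 𝕜 U] : IsCompactOperator (T.comp U.starProjection) := by
  have : ProperSpace U := FiniteDimensional.proper 𝕜 U
  have hproj : IsCompactOperator U.orthogonalProjectionOnto :=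
    isCompactOperator_of_locallyCompactSpace_dom _
  exact hproj.clm_comp (T.comp U.subtypeL)

theorem norm_sub_comp_starProjection_le (T : H →L[𝕜] F) (U : Submodule 𝕜 H)
    [U.HasOrthogonalProjection] {ε : ℝ} (hε : 0 ≤ ε) (h : ∀ x ∈ Uᗮ, ‖T x‖ ≤ ε * ‖x‖) :
    ‖T - T.comp U.starProjection‖ ≤ ε := by
  refine ContinuousLinearMap.opNorm_le_bound _ hε fun x => ?_
  have hcompl : x - U.starProjection x = Uᗮ.starProjection x := by
    rw [Submodule.starProjection_orthogonal']
    rfl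
  calc ‖(T - T.comp U.starProjection) x‖ = ‖T (Uᗮ.starProjection x)‖ := by simp [← hcompl]
    _ ≤ ε * ‖Uᗮ.starProjection x‖ := h _ (Submodule.starProjection_apply_mem _ _)
    _ ≤ ε * ‖x‖ := by gcongr; exact Submodule.norm_starProjection_apply_le _ _

theorem isCompactOperator_of_sum_sq_le [CompleteSpace F] (T : H →L[𝕜] F) {C : ℝ}
    (hT : ∀ s : Finset H, Orthonormal 𝕜 (Subtype.val : s → H) → ∑ v ∈ s, ‖T v‖ ^ 2 ≤ C) :
    IsCompactOperator T := by
  choose s hs using fun n : ℕ => exists_finset_norm_map_le_of_sum_sq_le T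
    (Nat.one_div_pos_of_nat (α := ℝ) (n := n)) hT
  have (n : ℕ) : FiniteDimensional 𝕜 (Submodule.span 𝕜 (s n : Set H)) :=
    FiniteDimensional.span_finset 𝕜 (s n)
  refine isCompactOperator_of_tendsto (l := atTop)
    (F := fun n => T.comp (Submodule.span 𝕜 (s n : Set H)).starProjection) ?_
    (Eventually.of_forall fun n => isCompactOperator_comp_starProjection T _)
  rw [tendsto_iff_norm_sub_tendsto_zero]
  refine squeeze_zero (fun _ => norm_nonneg _) (fun n => ?_) tendsto_one_div_add_atTop_nhds_zero_nat
  rw [norm_sub_rev]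
  exact norm_sub_comp_starProjection_le T _ Nat.one_div_pos_of_nat.le (hs n)

end Compactness

section PowerIteration

variable {T : H →L[𝕜] H} {f : H}

theorem inner_iterate (hT : T.IsSymmetric) (n : ℕ) (x y : H) :
    inner 𝕜 (T^[n] x) y = inner 𝕜 x (T^[n] y) := by
  induction n generalizing x y with
  | zero => rfl
  | succ n ih =>
    rw [Function.iterate_succ_apply, ih, Function.iterate_succ_apply']
    exact hT _ _

theorem inner_iterate_iterate (hT : T.IsSymmetric) (n j : ℕ) (x : H) :
    inner 𝕜 (T^[2 * n] x) (T^[2 * j] x) = (‖T^[n + j] x‖ : 𝕜) ^ 2 := by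
  rw [← inner_self_eq_norm_sq_to_K, inner_iterate hT, inner_iterate hT,
    ← Function.iterate_add_apply, ← Function.iterate_add_apply]
  congr 2
  omega

theorem sq_norm_iterate_succ_le (hT : T.IsSymmetric) (f : H) (n : ℕ) :
    ‖T^[n + 1] f‖ ^ 2 ≤ ‖T^[n] f‖ * ‖T^[n + 2] f‖ := by
  have hinner : inner 𝕜 (T^[n + 1] f) (T^[n + 1] f) = inner 𝕜 (T^[n] f) (T^[n + 2] f) := by
    rw [Function.iterate_succ_apply' _ n, Function.iterate_succ_apply' _ (n + 1),
      Function.iterate_succ_apply' _ n]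
    exact hT _ _
  have hcs := norm_inner_le_norm (𝕜 := 𝕜) (T^[n] f) (T^[n + 2] f)
  rw [← hinner, inner_self_eq_norm_sq_to_K] at hcs
  simpa using hcs

theorem iterate_ne_zero (hT : T.IsSymmetric) (hf : T f ≠ 0) : ∀ n, T^[n] f ≠ 0
  | 0 => fun h => hf (by rw [show f = 0 from h, map_zero])
  | 1 => hf
  | n + 2 => fun h => iterate_ne_zero hT hf (n + 1) (by
      simpa [h] using (sq_norm_iterate_succ_le hT f n).antisymm (by simp [h]))

/-- The ratios `‖Tⁿ⁺¹ f‖ / ‖Tⁿ f‖` increase by the Cauchy-Schwarz inequality. -/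
theorem exists_tendsto_norm_iterate_ratio (hT : T.IsSymmetric) (hf : T f ≠ 0) :
    ∃ r : ℝ, 0 < r ∧ (∀ n, ‖T^[n + 1] f‖ ≤ r * ‖T^[n] f‖) ∧
      Tendsto (fun n => ‖T^[n + 1] f‖ / ‖T^[n] f‖) atTop (𝓝 r) := by
  have hpos : ∀ n, 0 < ‖T^[n] f‖ := fun n => norm_pos_iff.2 (iterate_ne_zero hT hf n)
  have hmono : Monotone fun n => ‖T^[n + 1] f‖ / ‖T^[n] f‖ := monotone_nat_of_le_succ fun n => by
    rw [div_le_div_iff₀ (hpos _) (hpos _)]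
    nlinarith [sq_norm_iterate_succ_le hT f n]
  have hbdd : BddAbove (range fun n => ‖T^[n + 1] f‖ / ‖T^[n] f‖) := by
    refine ⟨‖T‖, ?_⟩
    rintro _ ⟨n, rfl⟩
    refine (div_le_iff₀ (hpos n)).2 ?_
    rw [Function.iterate_succ_apply']
    exact T.le_opNorm _
  have hle := le_ciSup hbdd
  exact ⟨_, (div_pos (hpos 1) (hpos 0)).trans_le (hle 0), fun n => (div_le_iff₀ (hpos n)).1 (hle n),
    tendsto_atTop_ciSup hmono hbdd⟩

/-- The inner products of the rescaled iterates `vₙ = T²ⁿ f / r²ⁿ` are `⟨vₙ, vⱼ⟩ = aₙ₊ⱼ` with the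
decreasing sequence `aₙ = (‖Tⁿ f‖ / rⁿ)²`, so `‖vₙ - vⱼ‖² ≤ a₂ₙ - lim a` for `n ≤ j`. -/
theorem exists_tendsto_rescaled_iterate [CompleteSpace H] (hT : T.IsSymmetric) {r : ℝ} (hr : 0 < r)
    (hle : ∀ n, ‖T^[n + 1] f‖ ≤ r * ‖T^[n] f‖) :
    ∃ v : H, Tendsto (fun n => (((r ^ (2 * n))⁻¹ : ℝ) : 𝕜) • T^[2 * n] f) atTop (𝓝 v) := by
  let a : ℕ → ℝ := fun n => (‖T^[n] f‖ / r ^ n) ^ 2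
  have hanti : Antitone a := antitone_nat_of_succ_le fun n => by
    refine pow_le_pow_left₀ (by positivity) ?_ 2
    rw [div_le_div_iff₀ (by positivity) (by positivity), pow_succ']
    nlinarith [hle n, pow_pos hr n]
  have hbdd : BddBelow (range a) := ⟨0, by rintro _ ⟨n, rfl⟩; positivity⟩
  have hlim := tendsto_atTop_ciInf hanti hbdd
  have hinner (n j : ℕ) : RCLike.re (inner 𝕜 ((((r ^ (2 * n))⁻¹ : ℝ) : 𝕜) • T^[2 * n] f)
      ((((r ^ (2 * j))⁻¹ : ℝ) : 𝕜) • T^[2 * j] f)) = a (n + j) := by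
    rw [inner_smul_left, inner_smul_right, inner_iterate_iterate hT, RCLike.conj_ofReal,
      ← RCLike.ofReal_pow, ← RCLike.ofReal_mul, ← RCLike.ofReal_mul, RCLike.ofReal_re]
    simp only [a, div_pow]
    field_simp
    ring
  have hdist (n j : ℕ) (hnj : n ≤ j) : dist ((((r ^ (2 * n))⁻¹ : ℝ) : 𝕜) • T^[2 * n] f)
      ((((r ^ (2 * j))⁻¹ : ℝ) : 𝕜) • T^[2 * j] f) ≤ √(a (n + n) - ⨅ i, a i) := by
    rw [dist_eq_norm]
    refine Real.le_sqrt_of_sq_le ?_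
    rw [@norm_sub_sq 𝕜, ← inner_self_eq_norm_sq (𝕜 := 𝕜), ← inner_self_eq_norm_sq (𝕜 := 𝕜),
      hinner, hinner, hinner]
    linarith [hanti (show n + j ≤ j + j by omega), ciInf_le hbdd (n + j)]
  refine cauchySeq_tendsto_of_complete (cauchySeq_of_le_tendsto_0' _ hdist ?_)
  have hdouble : Tendsto (fun n : ℕ => n + n) atTop atTop :=
    tendsto_atTop_mono (fun n => Nat.le_add_left n n) tendsto_id
  simpa using ((hlim.comp hdouble).sub_const (⨅ i, a i)).sqrt

theorem norm_sq_iterate_two_sub (hT : T.IsSymmetric) (r : ℝ) (x : H) :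
    ‖T (T x) - (r : 𝕜) ^ 2 • x‖ ^ 2 =
      ‖T (T x)‖ ^ 2 - 2 * (r ^ 2 * ‖T x‖ ^ 2) + r ^ 4 * ‖x‖ ^ 2 := by
  have hinner : inner 𝕜 (T (T x)) x = (‖T x‖ : 𝕜) ^ 2 := by
    rw [← inner_self_eq_norm_sq_to_K]
    exact hT _ _
  rw [@norm_sub_sq 𝕜, inner_smul_right, hinner, norm_smul, ← RCLike.ofReal_pow, ← RCLike.ofReal_pow,
    ← RCLike.ofReal_mul, RCLike.ofReal_re, RCLike.norm_ofReal, abs_of_nonneg (by positivity)]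
  ring

theorem tendsto_iterate_two_sub_normalized (hT : T.IsSymmetric) (hf : T f ≠ 0) {r : ℝ}
    (hr : Tendsto (fun n => ‖T^[n + 1] f‖ / ‖T^[n] f‖) atTop (𝓝 r)) {u : ℕ → H}
    (hu : ∀ n, u n = ((‖T^[2 * n] f‖⁻¹ : ℝ) : 𝕜) • T^[2 * n] f) :
    Tendsto (fun n => T (T (u n)) - (r : 𝕜) ^ 2 • u n) atTop (𝓝 0) := by
  let q : ℕ → ℝ := fun n => ‖T^[n + 1] f‖ / ‖T^[n] f‖
  have hpos : ∀ n, 0 < ‖T^[n] f‖ := fun n => norm_pos_iff.2 (iterate_ne_zero hT hf n)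
  have hsq (n : ℕ) : ‖T (T (u n)) - (r : 𝕜) ^ 2 • u n‖ ^ 2 =
      (q (2 * n) * q (2 * n + 1)) ^ 2 - 2 * (r ^ 2 * q (2 * n) ^ 2) + r ^ 4 := by
    rw [norm_sq_iterate_two_sub hT, hu]
    simp only [map_smul, norm_smul, ← Function.iterate_succ_apply', RCLike.norm_ofReal, abs_inv,
      abs_norm, q]
    have heven := (hpos (2 * n)).ne'
    have hodd := (hpos (2 * n + 1)).ne'
    field_simp
  have hdouble : Tendsto (fun n : ℕ => 2 * n) atTop atTop :=
    tendsto_id.const_mul_atTop' (by norm_num)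
  have hq0 : Tendsto (fun n => q (2 * n)) atTop (𝓝 r) := hr.comp hdouble
  have hq1 : Tendsto (fun n => q (2 * n + 1)) atTop (𝓝 r) :=
    hr.comp ((tendsto_add_atTop_nat 1).comp hdouble)
  have hlim := (((hq0.mul hq1).pow 2).sub (((hq0.pow 2).const_mul (r ^ 2)).const_mul 2)).add_const
    (r ^ 4)
  rw [tendsto_zero_iff_norm_tendsto_zero]
  simp_rw [← hsq, show (r * r) ^ 2 - 2 * (r ^ 2 * r ^ 2) + r ^ 4 = 0 by ring] at hlim
  simpa [Real.sqrt_sq (norm_nonneg _)] using hlim.sqrt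

theorem exists_subseq_tendsto_of_isCompactOperator (hcomp : IsCompactOperator T) {r : ℝ}
    (hr : 0 < r) {u : ℕ → H} (hu1 : ∀ n, ‖u n‖ = 1)
    (hu : Tendsto (fun n => T (T (u n)) - (r : 𝕜) ^ 2 • u n) atTop (𝓝 0)) :
    ∃ w : H, ∃ φ : ℕ → ℕ, StrictMono φ ∧ Tendsto (fun n => u (φ n)) atTop (𝓝 w) ∧ ‖w‖ = 1 ∧
      T (T w) = (r : 𝕜) ^ 2 • w := by
  obtain ⟨K, hK, hKsub⟩ := hcomp.image_closedBall_subset_compact (f := (T : H →ₗ[𝕜] H)) ‖T‖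
  obtain ⟨z, -, φ, hφ, hz⟩ := hK.tendsto_subseq (x := fun n => T (T (u n))) fun n =>
    hKsub ⟨T (u n), by simpa [hu1] using T.le_opNorm (u n), rfl⟩
  have hr2 : (r : 𝕜) ^ 2 ≠ 0 := pow_ne_zero _ (RCLike.ofReal_ne_zero.2 hr.ne')
  have hw : Tendsto (fun n => u (φ n)) atTop (𝓝 (((r : 𝕜) ^ 2)⁻¹ • z)) := by
    have := (hz.sub (hu.comp hφ.tendsto_atTop)).const_smul ((r : 𝕜) ^ 2)⁻¹
    simpa [smul_smul, hr2] using this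
  refine ⟨_, φ, hφ, hw, tendsto_nhds_unique hw.norm (by simp [hu1]), ?_⟩
  have hTT : Tendsto (fun n => T (T (u (φ n)))) atTop (𝓝 (T (T (((r : 𝕜) ^ 2)⁻¹ • z)))) :=
    ((T.continuous.comp T.continuous).tendsto _).comp hw
  rw [tendsto_nhds_unique hTT hz, smul_inv_smul₀ hr2]

theorem inner_iterate_of_sq_eigen (hT : T.IsSymmetric) {r : ℝ} {w : H}
    (hw : T (T w) = (r : 𝕜) ^ 2 • w) (f : H) (n : ℕ) :
    inner 𝕜 (T^[2 * n] f) w = ((r ^ (2 * n) : ℝ) : 𝕜) * inner 𝕜 f w := by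
  have hiter : ∀ n, T^[2 * n] w = ((r ^ (2 * n) : ℝ) : 𝕜) • w := fun n => by
    induction n with
    | zero => simp
    | succ n ih =>
      rw [Nat.mul_succ, Function.iterate_add_apply]
      change T^[2 * n] (T (T w)) = _
      rw [hw, (Function.Commute.iterate_left (fun x => T.map_smul ((r : 𝕜) ^ 2) x) _).eq, ih,
        smul_smul, ← RCLike.ofReal_pow, ← RCLike.ofReal_mul, pow_add, mul_comm]
  rw [inner_iterate hT, hiter, inner_smul_right]

theorem rescaled_iterate_limit_ne_zero (hT : T.IsSymmetric) (hcomp : IsCompactOperator T)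
    (hf : T f ≠ 0) {r : ℝ} (hr0 : 0 < r)
    (hr : Tendsto (fun n => ‖T^[n + 1] f‖ / ‖T^[n] f‖) atTop (𝓝 r)) {v : H}
    (hv : Tendsto (fun n => (((r ^ (2 * n))⁻¹ : ℝ) : 𝕜) • T^[2 * n] f) atTop (𝓝 v)) : v ≠ 0 := by
  rintro rfl
  have hres := tendsto_iterate_two_sub_normalized hT hf hr (fun _ => rfl)
  obtain ⟨w, φ, -, hw, hw1, hTTw⟩ := exists_subseq_tendsto_of_isCompactOperator hcomp hr0
    (fun n => by simp [norm_smul, norm_ne_zero_iff.2 (iterate_ne_zero hT hf (2 * n))]) hres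
  have hrescaled (n : ℕ) : inner 𝕜 ((((r ^ (2 * n))⁻¹ : ℝ) : 𝕜) • T^[2 * n] f) w =
      inner 𝕜 f w := by
    have hrn : ((r ^ (2 * n) : ℝ) : 𝕜) ≠ 0 := RCLike.ofReal_ne_zero.2 (by positivity)
    rw [inner_smul_left, RCLike.conj_ofReal, inner_iterate_of_sq_eigen hT hTTw, RCLike.ofReal_inv,
      inv_mul_cancel_left₀ hrn]
  have hfw : inner 𝕜 f w = 0 := by
    have hlim := hv.inner (𝕜 := 𝕜) (tendsto_const_nhds (x := w))
    simp only [hrescaled, inner_zero_left] at hlim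
    exact tendsto_nhds_unique tendsto_const_nhds hlim
  have hww := hw.inner (𝕜 := 𝕜) (tendsto_const_nhds (x := w))
  simp only [inner_smul_left, inner_iterate_of_sq_eigen hT hTTw, hfw, mul_zero,
    inner_self_eq_norm_sq_to_K, hw1, RCLike.ofReal_one, one_pow] at hww
  exact zero_ne_one (tendsto_nhds_unique tendsto_const_nhds hww)

/-- The rescaled iterates converge for every symmetric `T`; compactness is what keeps their limit
from vanishing. -/
theorem tendsto_power_iteration [CompleteSpace H] (hT : T.IsSymmetric)
    (hcomp : IsCompactOperator T) (hf : T f ≠ 0) :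
    ∃ r : ℝ, 0 < r ∧ ∃ u : H, ‖u‖ = 1 ∧ T (T u) = (r : 𝕜) ^ 2 • u ∧
      Tendsto (fun n : ℕ => ((‖T^[2 * n] f‖⁻¹ : ℝ) : 𝕜) • T^[2 * n] f) atTop (𝓝 u) := by
  obtain ⟨r, hr0, hle, hr⟩ := exists_tendsto_norm_iterate_ratio hT hf
  obtain ⟨v, hv⟩ := exists_tendsto_rescaled_iterate hT hr0 hle
  have hvnorm : ‖v‖ ≠ 0 :=
    norm_ne_zero_iff.2 (rescaled_iterate_limit_ne_zero hT hcomp hf hr0 hr hv)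
  have hu : Tendsto (fun n : ℕ => ((‖T^[2 * n] f‖⁻¹ : ℝ) : 𝕜) • T^[2 * n] f) atTop
      (𝓝 (((‖v‖⁻¹ : ℝ) : 𝕜) • v)) := by
    refine (((RCLike.continuous_ofReal.tendsto _).comp (hv.norm.inv₀ hvnorm)).smul hv).congr
      fun n => ?_
    have hn : ‖T^[2 * n] f‖ ≠ 0 := norm_ne_zero_iff.2 (iterate_ne_zero hT hf _)
    rw [Function.comp_apply, smul_smul, ← RCLike.ofReal_mul, norm_smul, RCLike.norm_ofReal,
      abs_of_nonneg (by positivity)]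
    congr 2
    field_simp
  refine ⟨r, hr0, _, by simp [norm_smul, hvnorm], sub_eq_zero.1 (tendsto_nhds_unique ?_
    (tendsto_iterate_two_sub_normalized hT hf hr fun _ => rfl)), hu⟩
  exact (((T.continuous.comp T.continuous).tendsto _).comp hu).sub (hu.const_smul _)

end PowerIteration

end Hilbert

/-! ### Diagonal operators in a Hilbert space -/

section Diagonal

variable {𝕜 H : Type*} [RCLike 𝕜] [NormedAddCommGroup H] [InnerProductSpace 𝕜 H]

variable (𝕜) in
/-- `y` is the image of `h` under the operator with eigenvectors `v n`, eigenvalues `a n`, that is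
multiplication by `c` on the orthogonal complement of the `v n`. -/
structure IsDiag (v : ℕ → H) (a : ℕ → 𝕜) (c : 𝕜) (h y : H) : Prop where
  inner_eq : ∀ n, inner 𝕜 (v n) y = a n * inner 𝕜 (v n) h
  inner_perp : ∀ w, (∀ n, inner 𝕜 (v n) w = 0) → inner 𝕜 w y = c * inner 𝕜 w h

variable {v : ℕ → H} {a b : ℕ → 𝕜} {c d : 𝕜} {h h' y y' : H}

theorem IsDiag.unique (hy : IsDiag 𝕜 v a c h y) (hy' : IsDiag 𝕜 v a c h y') : y = y' := by
  have hperp : ∀ n, inner 𝕜 (v n) (y - y') = 0 := fun n => by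
    rw [inner_sub_right, hy.inner_eq, hy'.inner_eq, sub_self]
  have hself : inner 𝕜 (y - y') (y - y') = 0 := by
    rw [inner_sub_right (y - y') y y', hy.inner_perp _ hperp, hy'.inner_perp _ hperp, sub_self]
  exact sub_eq_zero.1 (inner_self_eq_zero.1 hself)

theorem IsDiag.add (hy : IsDiag 𝕜 v a c h y) (hy' : IsDiag 𝕜 v a c h' y') :
    IsDiag 𝕜 v a c (h + h') (y + y') where
  inner_eq n := by rw [inner_add_right, inner_add_right, hy.inner_eq, hy'.inner_eq, mul_add]
  inner_perp w hw := by
    rw [inner_add_right, inner_add_right, hy.inner_perp w hw, hy'.inner_perp w hw, mul_add]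

theorem IsDiag.smul (z : 𝕜) (hy : IsDiag 𝕜 v a c h y) : IsDiag 𝕜 v a c (z • h) (z • y) where
  inner_eq n := by rw [inner_smul_right, inner_smul_right, hy.inner_eq]; ring
  inner_perp w hw := by rw [inner_smul_right, inner_smul_right, hy.inner_perp w hw]; ring

theorem IsDiag.add_coeff (hy : IsDiag 𝕜 v a c h y) (hy' : IsDiag 𝕜 v b d h y') :
    IsDiag 𝕜 v (fun n => a n + b n) (c + d) h (y + y') where
  inner_eq n := by rw [inner_add_right, hy.inner_eq, hy'.inner_eq, add_mul]
  inner_perp w hw := by rw [inner_add_right, hy.inner_perp w hw, hy'.inner_perp w hw, add_mul]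

theorem IsDiag.smul_coeff (z : 𝕜) (hy : IsDiag 𝕜 v a c h y) :
    IsDiag 𝕜 v (fun n => z * a n) (z * c) h (z • y) where
  inner_eq n := by rw [inner_smul_right, hy.inner_eq, mul_assoc]
  inner_perp w hw := by rw [inner_smul_right, hy.inner_perp w hw, mul_assoc]

theorem IsDiag.sub_coeff (hy : IsDiag 𝕜 v a c h y) (hy' : IsDiag 𝕜 v b d h y') :
    IsDiag 𝕜 v (fun n => a n - b n) (c - d) h (y - y') where
  inner_eq n := by rw [inner_sub_right, hy.inner_eq, hy'.inner_eq, sub_mul]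
  inner_perp w hw := by rw [inner_sub_right, hy.inner_perp w hw, hy'.inner_perp w hw, sub_mul]

theorem isDiag_self (z : 𝕜) : IsDiag 𝕜 v (fun _ => z) z h (z • h) where
  inner_eq n := by rw [inner_smul_right]
  inner_perp w _ := by rw [inner_smul_right]

theorem IsDiag.comp (hy : IsDiag 𝕜 v a c h y) (hy' : IsDiag 𝕜 v b d y y') :
    IsDiag 𝕜 v (fun n => b n * a n) (d * c) h y' where
  inner_eq n := by rw [hy'.inner_eq, hy.inner_eq, mul_assoc]
  inner_perp w hw := by rw [hy'.inner_perp w hw, hy.inner_perp w hw, mul_assoc]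

theorem IsDiag.congr (hy : IsDiag 𝕜 v a c h y) (hab : ∀ n, a n = b n) (hcd : c = d) :
    IsDiag 𝕜 v b d h y := by
  rw [← hcd, ← funext hab]
  exact hy

theorem isDiag_sum {ι : Type*} (s : Finset ι) (A : ι → ℕ → 𝕜) (C : ι → 𝕜) (Y : ι → H)
    (hY : ∀ i ∈ s, IsDiag 𝕜 v (A i) (C i) h (Y i)) :
    IsDiag 𝕜 v (fun n => ∑ i ∈ s, A i n) (∑ i ∈ s, C i) h (∑ i ∈ s, Y i) where
  inner_eq n := by
    rw [inner_sum, Finset.sum_mul]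
    exact Finset.sum_congr rfl fun i hi => (hY i hi).inner_eq n
  inner_perp w hw := by
    rw [inner_sum, Finset.sum_mul]
    exact Finset.sum_congr rfl fun i hi => (hY i hi).inner_perp w hw

/-- The partial sums of the expansion of a diagonal operator. -/
def diagSum (v : ℕ → H) (a : ℕ → 𝕜) (c : 𝕜) (h : H) (N : ℕ) : H :=
  (∑ n ∈ Finset.range N, (a n * inner 𝕜 (v n) h) • v n) +
    c • (h - ∑ n ∈ Finset.range N, inner 𝕜 (v n) h • v n)

theorem isDiag_diagSum (hv : Orthonormal 𝕜 v) (a : ℕ → 𝕜) (c : 𝕜) (h : H) (N : ℕ) :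
    IsDiag 𝕜 v (fun n => if n < N then a n else c) c h (diagSum v a c h N) where
  inner_eq n := by
    have hcoord : ∀ b : ℕ → 𝕜, inner 𝕜 (v n) (∑ i ∈ Finset.range N, b i • v i) =
        if n < N then b n else 0 := fun b => by
      split_ifs with hn
      · exact hv.inner_right_sum b (Finset.mem_range.2 hn)
      · rw [inner_sum]
        refine Finset.sum_eq_zero fun i hi => ?_
        rw [inner_smul_right, hv.inner_eq_zero, mul_zero]
        rintro rfl
        exact hn (Finset.mem_range.1 hi)
    rw [diagSum, inner_add_right, hcoord (fun i => a i * inner 𝕜 (v i) h), inner_smul_right,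
      inner_sub_right, hcoord (fun i => inner 𝕜 (v i) h)]
    split_ifs <;> ring
  inner_perp w hw := by
    have hzero : ∀ b : ℕ → 𝕜, inner 𝕜 w (∑ i ∈ Finset.range N, b i • v i) = 0 := fun b => by
      rw [inner_sum]
      refine Finset.sum_eq_zero fun i _ => ?_
      rw [inner_smul_right, ← inner_conj_symm, hw, map_zero, mul_zero]
    rw [diagSum, inner_add_right, hzero (fun i => a i * inner 𝕜 (v i) h), inner_smul_right,
      inner_sub_right, hzero (fun i => inner 𝕜 (v i) h)]
    ring

theorem diagSum_eq (v : ℕ → H) (a : ℕ → 𝕜) (c : 𝕜) (h : H) (N : ℕ) :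
    diagSum v a c h N =
      c • h + ∑ n ∈ Finset.range N, ((a n - c) * inner 𝕜 (v n) h) • v n := by
  simp only [diagSum, sub_mul, sub_smul, Finset.sum_sub_distrib, smul_sub, Finset.smul_sum,
    smul_smul]
  abel

theorem summable_smul_of_orthonormal [CompleteSpace H] (hv : Orthonormal 𝕜 v) {C : ℝ}
    (ha : ∀ n, ‖a n‖ ≤ C) (h : H) :
    Summable fun n => (a n * inner 𝕜 (v n) h) • v n := by
  refine (hv.orthogonalFamily.summable_iff_norm_sq_summable fun n => a n * inner 𝕜 (v n) h).2
    (Summable.of_nonneg_of_le (fun _ => by positivity) (fun n => ?_)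
      ((hv.inner_products_summable h).mul_left (C ^ 2)))
  rw [norm_mul, mul_pow]
  gcongr
  exact ha n

theorem exists_tendsto_diagSum [CompleteSpace H] (hv : Orthonormal 𝕜 v) {C : ℝ}
    (ha : ∀ n, ‖a n‖ ≤ C) (c : 𝕜) (h : H) :
    ∃ y, IsDiag 𝕜 v a c h y ∧ Tendsto (diagSum v a c h) atTop (𝓝 y) := by
  have hs := summable_smul_of_orthonormal hv (a := fun n => a n - c) (C := C + ‖c‖)
    (fun n => (norm_sub_le _ _).trans (by gcongr; exact ha n)) h
  have ht : Tendsto (diagSum v a c h) atTop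
      (𝓝 (c • h + ∑' n, ((a n - c) * inner 𝕜 (v n) h) • v n)) := by
    refine (hs.hasSum.tendsto_sum_nat.const_add (c • h)).congr fun N => ?_
    rw [diagSum_eq]
  refine ⟨_, ⟨fun n => ?_, fun w hw => ?_⟩, ht⟩
  · refine tendsto_nhds_unique ((tendsto_const_nhds (x := v n)).inner ht) ?_
    refine tendsto_const_nhds.congr' ?_
    filter_upwards [eventually_gt_atTop n] with N hN
    rw [(isDiag_diagSum hv a c h N).inner_eq, if_pos hN]
  · refine tendsto_nhds_unique ((tendsto_const_nhds (x := w)).inner ht) ?_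
    refine tendsto_const_nhds.congr fun N => ?_
    rw [(isDiag_diagSum hv a c h N).inner_perp w hw]

theorem IsDiag.tendsto [CompleteSpace H] (hv : Orthonormal 𝕜 v) {C : ℝ} (ha : ∀ n, ‖a n‖ ≤ C)
    (hy : IsDiag 𝕜 v a c h y) : Tendsto (diagSum v a c h) atTop (𝓝 y) := by
  obtain ⟨y', hy', hlim⟩ := exists_tendsto_diagSum hv ha c h
  rwa [hy.unique hy']

theorem IsDiag.inner_symm [CompleteSpace H] (hv : Orthonormal 𝕜 v) {C : ℝ} (ha : ∀ n, ‖a n‖ ≤ C)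
    (hy : IsDiag 𝕜 v a c h y) (hy' : IsDiag 𝕜 v (fun n => conj (a n)) (conj c) h' y') :
    inner 𝕜 y' h = inner 𝕜 h' y := by
  have hlim := (hy.tendsto hv ha).inner (tendsto_const_nhds (x := h')) (𝕜 := 𝕜)
  have hlim_conj := (tendsto_const_nhds (x := h)).inner
    (hy'.tendsto hv (C := C) fun n => by rw [RCLike.norm_conj]; exact ha n) (𝕜 := 𝕜)
  have heq := tendsto_nhds_unique hlim (hlim_conj.congr fun N => ?_)
  · rw [← inner_conj_symm, ← heq, inner_conj_symm]
  · simp only [diagSum_eq, inner_add_left, inner_add_right, inner_sum, sum_inner,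
      inner_smul_left, inner_smul_right, map_mul, map_sub]
    congr 1
    refine Finset.sum_congr rfl fun n _ => ?_
    rw [inner_conj_symm]
    ring

theorem norm_sq_sum_smul_add (hv : Orthonormal 𝕜 v) (s : Finset ℕ) (b : ℕ → 𝕜) {w : H}
    (hw : ∀ n ∈ s, inner 𝕜 (v n) w = 0) :
    ‖(∑ n ∈ s, b n • v n) + w‖ ^ 2 = ∑ n ∈ s, ‖b n‖ ^ 2 + ‖w‖ ^ 2 := by
  have horth : inner 𝕜 (∑ n ∈ s, b n • v n) w = 0 := by
    rw [sum_inner]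
    exact Finset.sum_eq_zero fun n hn => by rw [inner_smul_left, hw n hn, mul_zero]
  have hsum : ‖∑ n ∈ s, b n • v n‖ ^ 2 = ∑ n ∈ s, ‖b n‖ ^ 2 := by
    rw [← inner_self_eq_norm_sq (𝕜 := 𝕜), hv.inner_sum b b s, map_sum]
    exact Finset.sum_congr rfl fun n _ => by
      rw [RCLike.conj_mul, ← RCLike.ofReal_pow, RCLike.ofReal_re]
  rw [sq, norm_add_sq_eq_norm_sq_add_norm_sq_of_inner_eq_zero _ _ horth, ← sq, ← sq, hsum]

theorem norm_diagSum_le (hv : Orthonormal 𝕜 v) {C : ℝ} (ha : ∀ n, ‖a n‖ ≤ C) (hc : ‖c‖ ≤ C)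
    (h : H) (N : ℕ) : ‖diagSum v a c h N‖ ≤ C * ‖h‖ := by
  have hC : 0 ≤ C := (norm_nonneg c).trans hc
  set w : H := h - ∑ n ∈ Finset.range N, inner 𝕜 (v n) h • v n with hw
  have hw0 : ∀ n ∈ Finset.range N, inner 𝕜 (v n) w = 0 := fun n hn => by
    rw [hw, inner_sub_right, hv.inner_right_sum _ hn, sub_self]
  have hh := norm_sq_sum_smul_add hv _ (fun n => inner 𝕜 (v n) h) hw0
  rw [add_sub_cancel] at hh
  refine (abs_le_of_sq_le_sq' ?_ (by positivity)).2
  rw [diagSum, norm_sq_sum_smul_add hv _ (fun n => a n * inner 𝕜 (v n) h) (w := c • w)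
    fun n hn => by rw [inner_smul_right, hw0 n hn, mul_zero], mul_pow, hh, mul_add, Finset.mul_sum]
  gcongr with n
  · rw [norm_mul, mul_pow]
    gcongr
    exact ha n
  · rw [norm_smul, mul_pow]
    gcongr

theorem IsDiag.norm_le [CompleteSpace H] (hv : Orthonormal 𝕜 v) {C : ℝ} (ha : ∀ n, ‖a n‖ ≤ C)
    (hc : ‖c‖ ≤ C) (hy : IsDiag 𝕜 v a c h y) : ‖y‖ ≤ C * ‖h‖ :=
  le_of_tendsto (hy.tendsto hv ha).norm (Eventually.of_forall (norm_diagSum_le hv ha hc h))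

end Diagonal

/-! ### Fibres -/

section Fibres

variable {Ω S : Type*} [MeasurableSpace Ω] [MeasurableSpace S]
variable {μ : Measure Ω} {m : Measure S}

theorem ofReal0_apply (a : L0h μ) : ∀ᵐ ω ∂μ, ofReal0 a ω = (a ω : ℂ) :=
  AEEqFun.coeFn_comp (fun r : ℝ => (r : ℂ)) (by fun_prop) a

theorem chi_apply (A : Set Ω) (hA : MeasurableSet A) :
    ∀ᵐ ω ∂μ, chi μ A hA ω = A.indicator 1 ω :=
  AEEqFun.coeFn_mk _ _

/-- A measurable function as an element of `L₀(Ω)`. -/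
def toL0 (μ : Measure Ω) (g : Ω → ℂ) (hg : Measurable g) : L0 μ :=
  AEEqFun.mk g hg.aestronglyMeasurable

theorem toL0_apply (g : Ω → ℂ) (hg : Measurable g) : ∀ᵐ ω ∂μ, toL0 μ g hg ω = g ω :=
  AEEqFun.coeFn_mk _ _

theorem eLpNorm_two_sq {α E : Type*} [MeasurableSpace α] [NormedAddCommGroup E] (ν : Measure α)
    (g : α → E) :
    eLpNorm g 2 ν ^ 2 = ∫⁻ p, ‖g p‖ₑ ^ 2 ∂ν := by
  rw [eLpNorm_eq_lintegral_rpow_enorm_toReal (by norm_num) (by norm_num), ← ENNReal.rpow_natCast,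
    ← ENNReal.rpow_mul]
  norm_num

variable [SFinite m]

open Classical in
/-- The fibre `u(ω, ·)` as an element of `L₂(S)`, set to `0` at the negligible set of `ω` where
`u(ω, ·)` is not square integrable. -/
def fib (u : KH μ m) (ω : Ω) : Lp ℂ 2 m :=
  if h : MemLp (fun s => u.1 (ω, s)) 2 m then h.toLp _ else 0

theorem coeFn_fib (u : KH μ m) : ∀ᵐ ω ∂μ, ∀ᵐ s ∂m, fib u ω s = u.1 (ω, s) := by
  filter_upwards [u.2] with ω h
  rw [fib, dif_pos h]
  exact h.coeFn_toLp

theorem KH_ext {u v : KH μ m} (h : ∀ᵐ ω ∂μ, fib u ω = fib v ω) : u = v := by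
  refine Subtype.ext (AEEqFun.ext ((Measure.ae_prod_iff_ae_ae (p := fun p => u.1 p = v.1 p)
    (measurableSet_eq_fun u.1.measurable v.1.measurable)).2 ?_))
  filter_upwards [h, coeFn_fib u, coeFn_fib v] with ω huv hu hv
  filter_upwards [hu, hv] with s hus hvs
  rw [← hus, ← hvs, huv]

theorem fib_congr {u : KH μ m} {g : Ω → Lp ℂ 2 m} (h : ∀ᵐ ω ∂μ, ∀ᵐ s ∂m, u.1 (ω, s) = g ω s) :
    ∀ᵐ ω ∂μ, fib u ω = g ω := by
  filter_upwards [h, coeFn_fib u] with ω hg hu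
  apply Lp.ext
  filter_upwards [hg, hu] with s hgs hus
  rw [hus, hgs]

theorem fib_zero : ∀ᵐ ω ∂μ, fib (0 : KH μ m) ω = 0 := by
  apply fib_congr (g := fun _ => 0)
  filter_upwards [Measure.ae_ae_of_ae_prod
    (AEEqFun.coeFn_zero : ⇑(0 : Ω × S →ₘ[μ.prod m] ℂ) =ᵐ[μ.prod m] 0)] with ω h
  filter_upwards [h, Lp.coeFn_zero ℂ 2 m] with s hs hzero
  rw [hzero]
  exact hs

theorem fib_add (u v : KH μ m) : ∀ᵐ ω ∂μ, fib (u + v) ω = fib u ω + fib v ω := by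
  apply fib_congr
  filter_upwards [Measure.ae_ae_of_ae_prod (AEEqFun.coeFn_add u.1 v.1), coeFn_fib u,
    coeFn_fib v] with ω hadd hu hv
  filter_upwards [hadd, hu, hv, Lp.coeFn_add (fib u ω) (fib v ω)] with s hadds hus hvs hcoe
  rw [hcoe, Pi.add_apply, hus, hvs]
  exact hadds

theorem fib_smul (a : L0 μ) (u : KH μ m) : ∀ᵐ ω ∂μ, fib (a • u) ω = a ω • fib u ω := by
  apply fib_congr (g := fun ω => a ω • fib u ω)
  filter_upwards [Measure.ae_ae_of_ae_prod (coeFn_L0_smul a u.1), coeFn_fib u] with ω hsmul hu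
  filter_upwards [hsmul, hu, Lp.coeFn_smul (a ω) (fib u ω)] with s hsmuls hus hcoe
  rw [hcoe, Pi.smul_apply, hus, smul_eq_mul]
  exact hsmuls

theorem fib_sub (u v : KH μ m) : ∀ᵐ ω ∂μ, fib (u - v) ω = fib u ω - fib v ω := by
  apply fib_congr
  filter_upwards [Measure.ae_ae_of_ae_prod (AEEqFun.coeFn_sub u.1 v.1), coeFn_fib u,
    coeFn_fib v] with ω hsub hu hv
  filter_upwards [hsub, hu, hv, Lp.coeFn_sub (fib u ω) (fib v ω)] with s hsubs hus hvs hcoe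
  rw [hcoe, Pi.sub_apply, hus, hvs]
  exact hsubs

theorem fib_sum {ι : Type*} (s : Finset ι) (u : ι → KH μ m) :
    ∀ᵐ ω ∂μ, fib (∑ i ∈ s, u i) ω = ∑ i ∈ s, fib (u i) ω := by
  classical
  induction s using Finset.induction_on with
  | empty => simpa using fib_zero
  | insert i s hi ih =>
    rw [Finset.sum_insert hi]
    filter_upwards [fib_add (u i) (∑ j ∈ s, u j), ih] with ω hadd hsum
    rw [hadd, hsum, Finset.sum_insert hi]

theorem inner0_apply (x y : KH μ m) :
    ∀ᵐ ω ∂μ, inner0 x y ω = inner ℂ (fib y ω) (fib x ω) := by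
  have hdef : inner0 x y =ᵐ[μ] fun ω => ∫ s, x.1 (ω, s) * conj (y.1 (ω, s)) ∂m :=
    AEEqFun.coeFn_mk _ _
  filter_upwards [hdef, coeFn_fib x, coeFn_fib y] with ω hω hx hy
  rw [hω, L2.inner_def]
  refine integral_congr_ae ?_
  filter_upwards [hx, hy] with s hxs hys
  rw [← hxs, ← hys]
  rfl

theorem norm0_apply (x : KH μ m) : ∀ᵐ ω ∂μ, norm0 x ω = ‖fib x ω‖ := by
  filter_upwards [inner0_apply x x, AEEqFun.coeFn_comp (fun z : ℂ => Real.sqrt z.re)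
    (by fun_prop) (inner0 x x)] with ω hinner hcomp
  refine hcomp.trans ?_
  rw [Function.comp_apply, hinner, inner_self_eq_norm_sq_to_K]
  have hre : (((‖fib x ω‖ : ℝ) : ℂ) ^ 2).re = ‖fib x ω‖ ^ 2 := by
    rw [← Complex.ofReal_pow, Complex.ofReal_re]
  exact (congrArg Real.sqrt hre).trans (Real.sqrt_sq (norm_nonneg _))

theorem aemeasurable_enorm_fib (u : KH μ m) : AEMeasurable (fun ω => ‖fib u ω‖ₑ) μ := by
  refine (norm0 u).aestronglyMeasurable.aemeasurable.ennreal_ofReal.congr ?_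
  filter_upwards [norm0_apply u] with ω h
  rw [h, ofReal_norm]

theorem norm22_sq (u : KH μ m) : norm22 u ^ 2 = ∫⁻ ω, ‖fib u ω‖ₑ ^ 2 ∂μ := by
  rw [norm22, eLpNorm_two_sq, lintegral_prod _ (u.1.aestronglyMeasurable.enorm.pow_const _)]
  refine lintegral_congr_ae ?_
  filter_upwards [coeFn_fib u] with ω h
  rw [Lp.enorm_def, eLpNorm_two_sq]
  refine lintegral_congr_ae ?_
  filter_upwards [h] with s hs
  rw [hs]

theorem norm22_le_of_fib_le {u v : KH μ m} {C : ℝ} (hC : 0 ≤ C)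
    (h : ∀ᵐ ω ∂μ, ‖fib u ω‖ ≤ C * ‖fib v ω‖) : norm22 u ≤ ENNReal.ofReal C * norm22 v := by
  rw [← ENNReal.pow_le_pow_left_iff (n := 2) (by norm_num), mul_pow, norm22_sq, norm22_sq,
    ← lintegral_const_mul'' _ ((aemeasurable_enorm_fib v).pow_const 2)]
  refine lintegral_mono_ae ?_
  filter_upwards [h] with ω hω
  rw [← mul_pow, ← ofReal_norm, ← ofReal_norm, ← ENNReal.ofReal_mul hC]
  gcongr

section SFinite

variable [SFinite μ]

theorem exists_L22_of_norm22 (u : KH μ m) (h : norm22 u ≠ ∞) : ∃ f : L22 μ m, toKH f = u :=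
  ⟨⟨u.1, Lp.mem_Lp_iff_eLpNorm_lt_top.2 (lt_top_iff_ne_top.2 h)⟩, rfl⟩

theorem norm22_toKH (f : L22 μ m) : norm22 (toKH f) = ‖f‖ₑ := (Lp.enorm_def f).symm

theorem exists_L22_of_fib_le {u : KH μ m} {C : ℝ} (hC : 0 ≤ C) (f : L22 μ m)
    (h : ∀ᵐ ω ∂μ, ‖fib u ω‖ ≤ C * ‖fib (toKH f) ω‖) : ∃ g : L22 μ m, toKH g = u := by
  refine exists_L22_of_norm22 u ((norm22_le_of_fib_le hC h).trans_lt ?_).ne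
  rw [norm22_toKH]
  exact ENNReal.mul_lt_top ENNReal.ofReal_lt_top enorm_lt_top

end SFinite

section Finite

variable [IsFiniteMeasure μ]

theorem exists_L22_of_fib_bounded {u : KH μ m} {C : ℝ} (h : ∀ᵐ ω ∂μ, ‖fib u ω‖ ≤ C) :
    ∃ g : L22 μ m, toKH g = u := by
  have hsq : norm22 u ^ 2 < ∞ := by
    calc norm22 u ^ 2 ≤ ∫⁻ _, ENNReal.ofReal C ^ 2 ∂μ := by
          rw [norm22_sq]
          refine lintegral_mono_ae ?_
          filter_upwards [h] with ω hω
          rw [← ofReal_norm]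
          gcongr
      _ = ENNReal.ofReal C ^ 2 * μ univ := lintegral_const _
      _ < ∞ := ENNReal.mul_lt_top (ENNReal.pow_lt_top ENNReal.ofReal_lt_top)
          (measure_lt_top μ univ)
  exact exists_L22_of_norm22 u (ENNReal.pow_lt_top_iff.1 hsq |>.resolve_right two_ne_zero).ne

theorem exists_scaled_L22 (u : ℕ → KH μ m)
    (hu : ∀ᵐ ω ∂μ, BddAbove (range fun n => ‖fib (u n) ω‖)) :
    ∃ (r : Ω → ℝ) (f : ℕ → L22 μ m), Measurable r ∧ (∀ ω, 0 < r ω) ∧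
      (∀ n, ∀ᵐ ω ∂μ, ‖fib (toKH (f n)) ω‖ ≤ 1) ∧
      ∀ᵐ ω ∂μ, ∀ n, fib (toKH (f n)) ω = (r ω : ℂ) • fib (u n) ω := by
  let c : Ω → ℝ := fun ω => ⨆ n, |norm0 (u n) ω|
  have hc : Measurable c := Measurable.iSup fun n => (norm0 (u n)).measurable.abs
  have hc_nonneg : ∀ ω, 0 ≤ c ω := fun ω => Real.iSup_nonneg fun n => abs_nonneg _
  let r : Ω → ℝ := fun ω => (1 + c ω)⁻¹
  have hr : Measurable r := (hc.const_add 1).inv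
  have hr_pos : ∀ ω, 0 < r ω := fun ω => inv_pos.2 (by linarith [hc_nonneg ω])
  have hrc : Measurable fun ω => (r ω : ℂ) := Complex.measurable_ofReal.comp hr
  have hle : ∀ᵐ ω ∂μ, ∀ n, ‖fib (u n) ω‖ ≤ c ω := by
    filter_upwards [hu, ae_all_iff.2 fun n => norm0_apply (u n)] with ω hω hnorm n
    simp only [c, hnorm, abs_norm]
    exact le_ciSup hω n
  have hfib : ∀ᵐ ω ∂μ, ∀ n, fib (toL0 μ _ hrc • u n) ω = (r ω : ℂ) • fib (u n) ω := by
    filter_upwards [toL0_apply (μ := μ) _ hrc,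
      ae_all_iff.2 fun n => fib_smul (toL0 μ _ hrc) (u n)] with ω hrω hsmul n
    rw [hsmul, hrω]
  have hbound : ∀ n, ∀ᵐ ω ∂μ, ‖fib (toL0 μ _ hrc • u n) ω‖ ≤ 1 := fun n => by
    filter_upwards [hle, hfib] with ω hω hfibω
    rw [hfibω, norm_smul, Complex.norm_real, Real.norm_of_nonneg (hr_pos ω).le,
      inv_mul_le_iff₀ (by linarith [hc_nonneg ω])]
    linarith [hω n]
  choose f hf using fun n => exists_L22_of_fib_bounded (hbound n)
  refine ⟨r, f, hr, hr_pos, fun n => ?_, ?_⟩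
  · rw [hf]
    exact hbound n
  · simpa only [hf] using hfib

end Finite

end Fibres

/-! ### Integral operators on the fibres -/

/-- The bound `C √(m S)` on the `L₂`-norms of the rows of a kernel that is bounded by `C`. -/
def rowBound {S : Type*} [MeasurableSpace S] (m : Measure S) (C : ℝ≥0) : ℝ :=
  (measureUnivNNReal m : ℝ) ^ ((2 : ℝ≥0∞).toReal⁻¹) * C

theorem rowBound_nonneg {S : Type*} [MeasurableSpace S] {m : Measure S} {C : ℝ≥0} :
    0 ≤ rowBound m C := by
  rw [rowBound]
  positivity

section BoundedKernel

variable {S : Type*} [MeasurableSpace S] {m : Measure S} [IsFiniteMeasure m]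
variable {κ : S × S → ℂ} {C : ℝ≥0}

theorem memLp_conj_row (hκ : StronglyMeasurable κ) (hC : ∀ z, ‖κ z‖ ≤ C) (t : S) :
    MemLp (fun s => conj (κ (t, s))) 2 m :=
  MemLp.of_bound (Complex.continuous_conj.comp_stronglyMeasurable
    (hκ.comp_measurable measurable_prodMk_left)).aestronglyMeasurable C
    (Eventually.of_forall fun s => by rw [RCLike.norm_conj]; exact hC _)

theorem integrable_conj_kernel_mul (hκ : StronglyMeasurable κ) (hC : ∀ z, ‖κ z‖ ≤ C)
    (g h : Lp ℂ 2 m) :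
    Integrable (fun z : S × S => conj (κ z * g z.2) * h z.1) (m.prod m) := by
  have hg : Integrable g m := (Lp.memLp g).integrable (by norm_num)
  have hh : Integrable h m := (Lp.memLp h).integrable (by norm_num)
  have hgh : Integrable (fun z : S × S => h z.1 * conj (g z.2)) (m.prod m) :=
    hh.mul_prod (f := fun t => h t) (g := fun s => conj (g s))
      ((Complex.conjCLE : ℂ →L[ℝ] ℂ).integrable_comp hg)
  refine (hgh.bdd_mul (c := C) (f := fun z => conj (κ z))
    (Complex.continuous_conj.comp_stronglyMeasurable hκ).aestronglyMeasurable
    (Eventually.of_forall fun z => by rw [RCLike.norm_conj]; exact hC z)).congr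
    (Eventually.of_forall fun z => ?_)
  simp only [map_mul]
  ring

/-- The element of `L₂(S)` that represents the functional `g ↦ ∫ κ(t, s) g(s) dm(s)`, that is,
the conjugate of the row `κ(t, ·)` of a bounded kernel. -/
def kernelRow (m : Measure S) [IsFiniteMeasure m] (hκ : StronglyMeasurable κ)
    (hC : ∀ z, ‖κ z‖ ≤ C) (t : S) : Lp ℂ 2 m :=
  (memLp_conj_row hκ hC t).toLp _

variable (hκ : StronglyMeasurable κ) (hC : ∀ z, ‖κ z‖ ≤ C)

theorem norm_kernelRow_le (t : S) : ‖kernelRow m hκ hC t‖ ≤ rowBound m C := by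
  refine Lp.norm_le_of_ae_bound C.2 ?_
  filter_upwards [(memLp_conj_row (m := m) hκ hC t).coeFn_toLp] with s hs
  rw [kernelRow, hs, RCLike.norm_conj]
  exact hC _

theorem inner_kernelRow (t : S) (g : Lp ℂ 2 m) :
    inner ℂ (kernelRow m hκ hC t) g = ∫ s, κ (t, s) * g s ∂m := by
  rw [L2.inner_def]
  refine integral_congr_ae ?_
  filter_upwards [(memLp_conj_row (m := m) hκ hC t).coeFn_toLp] with s hs
  rw [kernelRow, hs]
  simp [mul_comm]

theorem stronglyMeasurable_inner_kernelRow (g : Lp ℂ 2 m) :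
    StronglyMeasurable fun t => inner ℂ (kernelRow m hκ hC t) g := by
  simp_rw [inner_kernelRow]
  exact StronglyMeasurable.integral_prod_right' (f := fun p : S × S => κ p * g p.2)
    (hκ.mul ((Lp.stronglyMeasurable g).comp_measurable measurable_snd))

theorem norm_inner_kernelRow_le (g : Lp ℂ 2 m) (t : S) :
    ‖inner ℂ (kernelRow m hκ hC t) g‖ ≤ rowBound m C * ‖g‖ :=
  (norm_inner_le_norm _ _).trans (by gcongr; exact norm_kernelRow_le hκ hC t)

theorem memLp_inner_kernelRow (g : Lp ℂ 2 m) :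
    MemLp (fun t => inner ℂ (kernelRow m hκ hC t) g) 2 m :=
  MemLp.of_bound (stronglyMeasurable_inner_kernelRow hκ hC g).aestronglyMeasurable _
    (Eventually.of_forall (norm_inner_kernelRow_le hκ hC g))

/-- The integral operator on `L₂(S)` with a bounded kernel. -/
def kernelOp (m : Measure S) [IsFiniteMeasure m] (hκ : StronglyMeasurable κ)
    (hC : ∀ z, ‖κ z‖ ≤ C) : Lp ℂ 2 m →L[ℂ] Lp ℂ 2 m :=
  LinearMap.mkContinuous
    { toFun := fun g => (memLp_inner_kernelRow hκ hC g).toLp _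
      map_add' := fun f g => by
        rw [← MemLp.toLp_add]
        exact MemLp.toLp_congr _ _ (Eventually.of_forall fun t => inner_add_right _ _ _)
      map_smul' := fun c g => by
        rw [RingHom.id_apply, ← MemLp.toLp_const_smul]
        exact MemLp.toLp_congr _ _ (Eventually.of_forall fun t => inner_smul_right _ _ _) }
    ((measureUnivNNReal m : ℝ) ^ ((2 : ℝ≥0∞).toReal⁻¹) * rowBound m C) (fun g => by
      rw [mul_assoc]
      refine Lp.norm_le_of_ae_bound (mul_nonneg rowBound_nonneg (norm_nonneg _)) ?_
      filter_upwards [(memLp_inner_kernelRow hκ hC g).coeFn_toLp] with t ht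
      exact (congrArg norm ht).trans_le (norm_inner_kernelRow_le hκ hC g t))

theorem coeFn_kernelOp (g : Lp ℂ 2 m) :
    ∀ᵐ t ∂m, kernelOp m hκ hC g t = inner ℂ (kernelRow m hκ hC t) g :=
  (memLp_inner_kernelRow hκ hC g).coeFn_toLp

theorem norm_sq_kernelOp (g : Lp ℂ 2 m) :
    ‖kernelOp m hκ hC g‖ ^ 2 = ∫ t, ‖inner ℂ (kernelRow m hκ hC t) g‖ ^ 2 ∂m := by
  apply Complex.ofReal_injective
  rw [Complex.ofReal_pow, ← integral_complex_ofReal]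
  refine (inner_self_eq_norm_sq_to_K (𝕜 := ℂ) (kernelOp m hκ hC g)).symm.trans ?_
  rw [L2.inner_def]
  refine integral_congr_ae ?_
  filter_upwards [coeFn_kernelOp hκ hC g] with t ht
  rw [ht, inner_self_eq_norm_sq_to_K, Complex.ofReal_pow]
  rfl

theorem sum_sq_kernelOp_le {ι : Type*} {v : ι → Lp ℂ 2 m} (hv : PartialOrthonormal ℂ v)
    (s : Finset ι) :
    ∑ i ∈ s, ‖kernelOp m hκ hC (v i)‖ ^ 2 ≤ rowBound m C ^ 2 * m.real univ := by
  have hint : ∀ i ∈ s, Integrable (fun t => ‖inner ℂ (kernelRow m hκ hC t) (v i)‖ ^ 2) m :=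
    fun i _ => (memLp_two_iff_integrable_sq_norm
      (stronglyMeasurable_inner_kernelRow hκ hC (v i)).aestronglyMeasurable).1
      (memLp_inner_kernelRow hκ hC (v i))
  have hbessel : ∀ t, ∑ i ∈ s, ‖inner ℂ (kernelRow m hκ hC t) (v i)‖ ^ 2 ≤ rowBound m C ^ 2 := by
    intro t
    simp_rw [norm_inner_symm (kernelRow m hκ hC t)]
    refine (hv.sum_sq_inner_le s _).trans ?_
    gcongr
    exact norm_kernelRow_le hκ hC t
  calc ∑ i ∈ s, ‖kernelOp m hκ hC (v i)‖ ^ 2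
      = ∫ t, ∑ i ∈ s, ‖inner ℂ (kernelRow m hκ hC t) (v i)‖ ^ 2 ∂m := by
        simp_rw [norm_sq_kernelOp]
        exact (integral_finsetSum s hint).symm
    _ ≤ ∫ _, rowBound m C ^ 2 ∂m := integral_mono (integrable_finsetSum s hint)
        (integrable_const _) hbessel
    _ = rowBound m C ^ 2 * m.real univ := by rw [integral_const, smul_eq_mul, mul_comm]

theorem isCompactOperator_kernelOp : IsCompactOperator (kernelOp m hκ hC) :=
  isCompactOperator_of_sum_sq_le _ fun s hs =>
    (Finset.sum_coe_sort s fun v => ‖kernelOp m hκ hC v‖ ^ 2).symm.trans_le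
      (sum_sq_kernelOp_le (m := m) hκ hC ⟨fun i => Or.inr (hs.1 i), hs.2⟩ Finset.univ)

theorem inner_kernelOp_left (g h : Lp ℂ 2 m) :
    inner ℂ (kernelOp m hκ hC g) h = ∫ t, ∫ s, conj (κ (t, s) * g s) * h t ∂m ∂m := by
  rw [L2.inner_def]
  refine integral_congr_ae ?_
  filter_upwards [coeFn_kernelOp hκ hC g] with t ht
  rw [ht, inner_kernelRow, RCLike.inner_apply, ← integral_conj, ← integral_const_mul]
  simp_rw [mul_comm (h t)]

theorem inner_kernelOp_right (g h : Lp ℂ 2 m) :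
    inner ℂ g (kernelOp m hκ hC h) = ∫ t, ∫ s, conj (g t) * (κ (t, s) * h s) ∂m ∂m := by
  rw [L2.inner_def]
  refine integral_congr_ae ?_
  filter_upwards [coeFn_kernelOp hκ hC h] with t ht
  rw [ht, inner_kernelRow, RCLike.inner_apply, integral_const_mul, mul_comm]

theorem isSymmetric_kernelOp (hsym : ∀ᵐ z ∂(m.prod m), κ (z.1, z.2) = conj (κ (z.2, z.1))) :
    (kernelOp m hκ hC : Lp ℂ 2 m →ₗ[ℂ] Lp ℂ 2 m).IsSymmetric := by
  intro g h
  change inner ℂ (kernelOp m hκ hC g) h = inner ℂ g (kernelOp m hκ hC h)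
  rw [inner_kernelOp_left, inner_kernelOp_right,
    integral_integral_swap (integrable_conj_kernel_mul hκ hC g h)]
  refine integral_congr_ae ?_
  filter_upwards [Measure.ae_ae_of_ae_prod hsym] with s hs
  refine integral_congr_ae ?_
  filter_upwards [hs] with t (ht : κ (s, t) = conj (κ (t, s)))
  rw [ht, map_mul]
  ring

end BoundedKernel

section PartiallyIntegral

variable {Ω S : Type*} [MeasurableSpace Ω] [MeasurableSpace S]
variable {μ : Measure Ω} {m : Measure S}

open Classical in
/-- A version of the kernel that is bounded everywhere, so that `k(ω, ·, ·)` defines an operator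
on `L₂(S)` for every `ω`. -/
def boundedKernel (k : Kernel μ m) (z : Ω × S × S) : ℂ := if ‖k z‖ ≤ ‖k‖ then k z else 0

theorem norm_boundedKernel_le (k : Kernel μ m) (z : Ω × S × S) : ‖boundedKernel k z‖ ≤ ‖k‖ := by
  rw [boundedKernel]
  split_ifs with h
  · exact h
  · simp

theorem stronglyMeasurable_boundedKernel (k : Kernel μ m) :
    StronglyMeasurable (boundedKernel k) :=
  StronglyMeasurable.ite ((Lp.stronglyMeasurable k).norm.measurable measurableSet_Iic)
    (Lp.stronglyMeasurable k) stronglyMeasurable_const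

variable [IsFiniteMeasure m]

/-- The integral operator on `L₂(S)` with kernel `k(ω, ·, ·)`. -/
def fibOp (k : Kernel μ m) (ω : Ω) : Lp ℂ 2 m →L[ℂ] Lp ℂ 2 m :=
  kernelOp m (κ := fun z => boundedKernel k (ω, z)) (C := ‖k‖₊)
    ((stronglyMeasurable_boundedKernel k).comp_measurable measurable_prodMk_left)
    fun z => (norm_boundedKernel_le k (ω, z) : _ ≤ ((‖k‖₊ : ℝ≥0) : ℝ))

theorem coeFn_fibOp (k : Kernel μ m) (ω : Ω) (g : Lp ℂ 2 m) :
    ∀ᵐ t ∂m, fibOp k ω g t = ∫ s, boundedKernel k (ω, t, s) * g s ∂m := by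
  filter_upwards [coeFn_kernelOp (m := m) (κ := fun z => boundedKernel k (ω, z)) (C := ‖k‖₊)
    ((stronglyMeasurable_boundedKernel k).comp_measurable measurable_prodMk_left)
    (fun z => norm_boundedKernel_le k (ω, z)) g] with t ht
  exact ht.trans (inner_kernelRow _ _ t g)

theorem sum_sq_fibOp_le (k : Kernel μ m) (ω : Ω) {ι : Type*} {v : ι → Lp ℂ 2 m}
    (hv : PartialOrthonormal ℂ v) (s : Finset ι) :
    ∑ i ∈ s, ‖fibOp k ω (v i)‖ ^ 2 ≤ rowBound m ‖k‖₊ ^ 2 * m.real univ :=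
  sum_sq_kernelOp_le _ _ hv s

theorem isCompactOperator_fibOp (k : Kernel μ m) (ω : Ω) : IsCompactOperator (fibOp k ω) :=
  isCompactOperator_kernelOp _ _

theorem isSymmetric_fibOp {k : Kernel μ m} (hk : IsHermitianKernel k) :
    ∀ᵐ ω ∂μ, (fibOp k ω : Lp ℂ 2 m →ₗ[ℂ] Lp ℂ 2 m).IsSymmetric := by
  filter_upwards [Measure.ae_ae_of_ae_prod hk] with ω hω
  refine isSymmetric_kernelOp _ _ ?_
  filter_upwards [hω] with z (hz : k (ω, z.1, z.2) = conj (k (ω, z.2, z.1)))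
  rw [boundedKernel, boundedKernel, hz, RCLike.norm_conj]
  split_ifs <;> simp

variable [IsFiniteMeasure μ]

theorem boundedKernel_ae_eq (k : Kernel μ m) :
    ∀ᵐ ω ∂μ, ∀ᵐ t ∂m, ∀ᵐ s ∂m, boundedKernel k (ω, t, s) = k (ω, t, s) := by
  filter_upwards [kernel_bound k] with ω h
  filter_upwards [h] with t h
  filter_upwards [h] with s h
  rw [boundedKernel, if_pos (enorm_le_iff_norm_le.1 h)]

theorem fib_opKH (k : Kernel μ m) (u : KH μ m) :
    ∀ᵐ ω ∂μ, fib (opKH k u) ω = fibOp k ω (fib u ω) := by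
  apply fib_congr (g := fun ω => fibOp k ω (fib u ω))
  filter_upwards [coeFn_integralOp k u.1, coeFn_fib u, boundedKernel_ae_eq k] with ω hT hu hk
  filter_upwards [hT, hk, coeFn_fibOp k ω (fib u ω)] with t hTt hkt hfibt
  refine (show (opKH k u).1 (ω, t) = _ from hTt).trans ?_
  rw [hfibt]
  refine integral_congr_ae ?_
  filter_upwards [hu, hkt] with s hus hks
  rw [hus, hks]

theorem toKH_op22 (k : Kernel μ m) (f : L22 μ m) : toKH (op22 k f) = opKH k (toKH f) := rfl

theorem inner_fibOp_toKH (k : Kernel μ m) (f : L22 μ m) :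
    ∀ᵐ ω ∂μ, inner ℂ (fib (toKH f) ω) (fibOp k ω (fib (toKH f) ω)) =
      ∫ t, ∫ s, k (ω, t, s) * f (ω, s) * conj (f (ω, t)) ∂m ∂m := by
  filter_upwards [coeFn_fib (toKH f), coeFn_integralOp k f.1, fib_opKH k (toKH f),
    coeFn_fib (opKH k (toKH f))] with ω hf hTf hop hfop
  rw [← hop, L2.inner_def]
  refine integral_congr_ae ?_
  filter_upwards [hf, hTf, hfop] with t hft hTft hfopt
  rw [hft, hfopt]
  refine (RCLike.inner_apply _ _).trans ?_
  rw [integral_mul_const]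
  exact congrArg (· * conj (f (ω, t))) hTft

theorem inner_fibOp_nonneg {k : Kernel μ m} (hpos : IsPosSemidefKernel k) (u : KH μ m) :
    ∀ᵐ ω ∂μ, 0 ≤ inner ℂ (fib u ω) (fibOp k ω (fib u ω)) := by
  obtain ⟨r, f, -, hr, -, hf⟩ := exists_scaled_L22 (fun _ => u)
    (Eventually.of_forall fun ω => ⟨‖fib u ω‖, by rintro _ ⟨_, rfl⟩; rfl⟩)
  filter_upwards [hpos (f 0), hf, inner_fibOp_toKH k (f 0)] with ω hposω hfib hinner
  rw [← hinner, hfib, map_smul, inner_smul_left, inner_smul_right, ← mul_assoc,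
    Complex.conj_ofReal, ← Complex.ofReal_mul] at hposω
  have hr2 : 0 < r ω * r ω := mul_pos (hr ω) (hr ω)
  have hinv : (0 : ℂ) ≤ (((r ω * r ω)⁻¹ : ℝ) : ℂ) := by exact_mod_cast (inv_pos.2 hr2).le
  simpa only [← mul_assoc, ← Complex.ofReal_mul, inv_mul_cancel₀ hr2.ne', Complex.ofReal_one,
    one_mul] using mul_nonneg hinv hposω

end PartiallyIntegral

/-! ### Fibrewise limits -/

section Limits

variable {Ω S : Type*} [MeasurableSpace Ω] [MeasurableSpace S]
variable {μ : Measure Ω} {m : Measure S} [SFinite m]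

theorem eLpNorm_norm0 (u : KH μ m) : eLpNorm (norm0 u) 2 μ = norm22 u := by
  rw [← (ENNReal.pow_right_strictMono two_ne_zero).injective.eq_iff, norm22_sq, eLpNorm_two_sq]
  refine lintegral_congr_ae ?_
  filter_upwards [norm0_apply u] with ω hω
  rw [hω, enorm_norm]

theorem tendsto_norm22_zero {ι : Type*} [Countable ι] {l : Filter ι} [l.IsCountablyGenerated]
    (u : ι → KH μ m) (b : Ω → ℝ≥0∞) (hb : ∫⁻ ω, b ω ^ 2 ∂μ ≠ ∞)
    (hub : ∀ i, ∀ᵐ ω ∂μ, ‖fib (u i) ω‖ₑ ≤ b ω)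
    (hlim : ∀ᵐ ω ∂μ, Tendsto (fun i => fib (u i) ω) l (𝓝 0)) :
    Tendsto (fun i => norm22 (u i)) l (𝓝 0) := by
  have hint : Tendsto (fun i => ∫⁻ ω, ‖norm0 (u i) ω‖ₑ ^ 2 ∂μ) l (𝓝 (∫⁻ _, 0 ∂μ)) := by
    refine tendsto_lintegral_filter_of_dominated_convergence (fun ω => b ω ^ 2)
      (Eventually.of_forall fun i => (norm0 (u i)).measurable.enorm.pow_const 2)
      (Eventually.of_forall fun i => ?_) hb ?_
    · filter_upwards [norm0_apply (u i), hub i] with ω hnorm hω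
      rw [hnorm, enorm_norm]
      gcongr
    · filter_upwards [hlim, ae_all_iff.2 fun i => norm0_apply (u i)] with ω hω hnorm
      simp_rw [hnorm, enorm_norm]
      simpa using ENNReal.Tendsto.pow (n := 2) hω.enorm
  have hsq : Tendsto (fun i => norm22 (u i) ^ 2) l (𝓝 0) := by
    simp_rw [← eLpNorm_norm0, eLpNorm_two_sq]
    simpa using hint
  refine (ENNReal.zero_rpow_of_pos (y := 1 / 2) (by norm_num) ▸ hsq.ennrpow_const (1 / 2)).congr
    fun i => ?_
  rw [← ENNReal.rpow_natCast, ← ENNReal.rpow_mul]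
  norm_num

theorem exists_glue (N : Ω → ℕ) (hN : Measurable N) (u : ℕ → KH μ m) :
    ∃ w : KH μ m, ∀ᵐ ω ∂μ, fib w ω = fib (u (N ω)) ω := by
  have hmeas : Measurable fun p : Ω × S => (u (N p.1)).1 p := by
    have huncurry : Measurable fun q : ℕ × (Ω × S) => (u q.1).1 q.2 :=
      measurable_from_prod_countable_right fun n => (u n).1.measurable
    exact huncurry.comp ((hN.comp measurable_fst).prodMk measurable_id)
  let F : Ω × S →ₘ[μ.prod m] ℂ := AEEqFun.mk _ hmeas.aestronglyMeasurable
  have hF : ∀ᵐ ω ∂μ, ∀ᵐ s ∂m, F (ω, s) = (u (N ω)).1 (ω, s) :=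
    Measure.ae_ae_of_ae_prod (AEEqFun.coeFn_mk _ _)
  refine ⟨⟨F, ?_⟩, ?_⟩
  · filter_upwards [hF, ae_all_iff.2 fun n => (u n).2] with ω hFω hmem
    exact (memLp_congr_ae hFω).2 (hmem (N ω))
  · apply fib_congr (g := fun ω => fib (u (N ω)) ω)
    filter_upwards [hF, ae_all_iff.2 fun n => coeFn_fib (u n)] with ω hFω hu
    filter_upwards [hFω, hu (N ω)] with s hFs hus
    rw [hus]
    exact hFs

theorem exists_const_fib (e : Lp ℂ 2 m) : ∃ u : KH μ m, ∀ᵐ ω ∂μ, fib u ω = e := by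
  let F : Ω × S →ₘ[μ.prod m] ℂ :=
    AEEqFun.mk (fun p => e p.2) ((Lp.stronglyMeasurable e).comp_measurable
      measurable_snd).aestronglyMeasurable
  have hF : ∀ᵐ ω ∂μ, ∀ᵐ s ∂m, F (ω, s) = e s :=
    Measure.ae_ae_of_ae_prod (AEEqFun.coeFn_mk _ _)
  refine ⟨⟨F, ?_⟩, fib_congr (g := fun _ => e) hF⟩
  filter_upwards [hF] with ω hFω
  exact (memLp_congr_ae hFω).2 (Lp.memLp e)

section SFinite

variable [SFinite μ]

theorem tendsto_norm22_zero_of_le {ι : Type*} [Countable ι] {l : Filter ι}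
    [l.IsCountablyGenerated] (u : ι → KH μ m) {C : ℝ} (f : L22 μ m)
    (hub : ∀ i, ∀ᵐ ω ∂μ, ‖fib (u i) ω‖ ≤ C * ‖fib (toKH f) ω‖)
    (hlim : ∀ᵐ ω ∂μ, Tendsto (fun i => fib (u i) ω) l (𝓝 0)) :
    Tendsto (fun i => norm22 (u i)) l (𝓝 0) := by
  refine tendsto_norm22_zero u (fun ω => ENNReal.ofReal C * ‖fib (toKH f) ω‖ₑ) ?_ (fun i => ?_) hlim
  · simp_rw [mul_pow]
    rw [lintegral_const_mul'' _ ((aemeasurable_enorm_fib _).pow_const 2), ← norm22_sq,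
      norm22_toKH]
    exact ENNReal.mul_ne_top (by simp) (by simp)
  · filter_upwards [hub i] with ω h
    rw [← ofReal_norm, ← ofReal_norm, ← ENNReal.ofReal_mul' (norm_nonneg _)]
    exact ENNReal.ofReal_le_ofReal h

theorem toKH_sub (f g : L22 μ m) : toKH (f - g) = toKH f - toKH g := rfl

theorem exists_subseq_fib_tendsto {f : ℕ → L22 μ m} {g : L22 μ m}
    (h : Tendsto f atTop (𝓝 g)) :
    ∃ φ : ℕ → ℕ, StrictMono φ ∧
      ∀ᵐ ω ∂μ, Tendsto (fun n => fib (toKH (f (φ n))) ω) atTop (𝓝 (fib (toKH g) ω)) := by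
  have hmeas : TendstoInMeasure μ (fun n => ⇑(norm0 (toKH (f n) - toKH g))) atTop (0 : Ω → ℝ) := by
    refine tendstoInMeasure_of_tendsto_eLpNorm two_ne_zero
      (fun n => (norm0 _).aestronglyMeasurable) aestronglyMeasurable_zero ?_
    simp_rw [sub_zero, eLpNorm_norm0, ← toKH_sub, norm22_toKH, ← edist_eq_enorm_sub]
    exact tendsto_iff_edist_tendsto_0.1 h
  obtain ⟨φ, hφ, hlim⟩ := hmeas.exists_seq_tendsto_ae
  refine ⟨φ, hφ, ?_⟩
  filter_upwards [hlim, ae_all_iff.2 fun n => norm0_apply (toKH (f n) - toKH g),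
    ae_all_iff.2 fun n => fib_sub (toKH (f n)) (toKH g)] with ω hω hnorm hsub
  simp_rw [hnorm, hsub] at hω
  exact tendsto_iff_norm_sub_tendsto_zero.2 hω

end SFinite

section Finite

variable [IsFiniteMeasure μ]

theorem cauchySeq_of_fib_tendsto (f : ℕ → L22 μ m) {C : ℝ}
    (hC : ∀ n, ∀ᵐ ω ∂μ, ‖fib (toKH (f n)) ω‖ ≤ C)
    (h : ∀ᵐ ω ∂μ, ∃ v, Tendsto (fun n => fib (toKH (f n)) ω) atTop (𝓝 v)) : CauchySeq f := by
  rw [cauchySeq_iff_tendsto_dist_atTop_0]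
  simp_rw [dist_edist, edist_eq_enorm_sub, ← norm22_toKH, toKH_sub]
  refine (ENNReal.tendsto_toReal ENNReal.zero_ne_top).comp <|
    tendsto_norm22_zero (l := (atTop : Filter (ℕ × ℕ))) _
      (fun _ => ENNReal.ofReal (C + C)) ?_ (fun p => ?_) ?_
  · rw [lintegral_const]
    exact ENNReal.mul_ne_top (by simp) (measure_ne_top μ univ)
  · filter_upwards [hC p.1, hC p.2, fib_sub (toKH (f p.1)) (toKH (f p.2))] with ω hp hq hsub
    rw [hsub, ← ofReal_norm]
    exact ENNReal.ofReal_le_ofReal ((norm_sub_le _ _).trans (add_le_add hp hq))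
  · filter_upwards [h, ae_all_iff.2 fun p : ℕ × ℕ => fib_sub (toKH (f p.1)) (toKH (f p.2))]
      with ω ⟨v, hv⟩ hsub
    simp_rw [hsub]
    have hlim : Tendsto (fun p : ℕ × ℕ => fib (toKH (f p.1)) ω - fib (toKH (f p.2)) ω)
        (atTop ×ˢ atTop) (𝓝 (v - v)) := (hv.comp tendsto_fst).sub (hv.comp tendsto_snd)
    rwa [sub_self, prod_atTop_atTop_eq] at hlim

theorem exists_fib_limit_of_bounded (f : ℕ → L22 μ m) {C : ℝ}
    (hC : ∀ n, ∀ᵐ ω ∂μ, ‖fib (toKH (f n)) ω‖ ≤ C)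
    (h : ∀ᵐ ω ∂μ, ∃ v, Tendsto (fun n => fib (toKH (f n)) ω) atTop (𝓝 v)) :
    ∃ g : L22 μ m, ∀ᵐ ω ∂μ, Tendsto (fun n => fib (toKH (f n)) ω) atTop (𝓝 (fib (toKH g) ω)) := by
  obtain ⟨g, hg⟩ := cauchySeq_tendsto_of_complete (cauchySeq_of_fib_tendsto f hC h)
  obtain ⟨φ, hφ, hlim⟩ := exists_subseq_fib_tendsto hg
  refine ⟨g, ?_⟩
  filter_upwards [h, hlim] with ω ⟨v, hv⟩ hω
  rwa [tendsto_nhds_unique hω (hv.comp hφ.tendsto_atTop)]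

theorem exists_fib_limit (u : ℕ → KH μ m)
    (h : ∀ᵐ ω ∂μ, ∃ v, Tendsto (fun n => fib (u n) ω) atTop (𝓝 v)) :
    ∃ w : KH μ m, ∀ᵐ ω ∂μ, Tendsto (fun n => fib (u n) ω) atTop (𝓝 (fib w ω)) := by
  obtain ⟨r, f, hr, hr_pos, hbound, hf⟩ := exists_scaled_L22 u
    (h.mono fun ω ⟨v, hv⟩ => hv.norm.bddAbove_range)
  obtain ⟨g, hg⟩ := exists_fib_limit_of_bounded f hbound (by
    filter_upwards [h, hf] with ω ⟨v, hv⟩ hfω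
    simp_rw [hfω]
    exact ⟨_, hv.const_smul _⟩)
  have hinv : Measurable fun ω => (((r ω)⁻¹ : ℝ) : ℂ) := Complex.measurable_ofReal.comp hr.inv
  refine ⟨toL0 μ _ hinv • toKH g, ?_⟩
  filter_upwards [hg, hf, toL0_apply (μ := μ) _ hinv, fib_smul (toL0 μ _ hinv) (toKH g)]
    with ω hgω hfω hinvω hsmul
  rw [hsmul, hinvω]
  refine (hgω.const_smul (((r ω)⁻¹ : ℝ) : ℂ)).congr fun n => ?_
  rw [hfω, smul_smul, ← Complex.ofReal_mul, inv_mul_cancel₀ (hr_pos ω).ne', Complex.ofReal_one,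
    one_smul]

end Finite

end Limits

/-! ### Eigenfields -/

section Orthogonality

variable {Ω S : Type*} [MeasurableSpace Ω] [MeasurableSpace S]
variable {μ : Measure Ω} {m : Measure S} [SFinite m]

theorem eq_zero_iff_fib {u : KH μ m} : u = 0 ↔ ∀ᵐ ω ∂μ, fib u ω = 0 := by
  refine ⟨by rintro rfl; exact fib_zero, fun h => KH_ext ?_⟩
  filter_upwards [h, fib_zero (μ := μ) (m := m)] with ω hu hzero
  rw [hu, hzero]

theorem inner0_eq_zero_iff {x y : KH μ m} :
    inner0 x y = 0 ↔ ∀ᵐ ω ∂μ, inner ℂ (fib y ω) (fib x ω) = 0 := by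
  constructor <;> intro h
  · filter_upwards [inner0_apply x y, (AEEqFun.coeFn_zero : ⇑(0 : L0 μ) =ᵐ[μ] 0)] with ω hω hzero
    rw [← hω, h, hzero, Pi.zero_apply]
  · apply AEEqFun.ext
    filter_upwards [inner0_apply x y, h, (AEEqFun.coeFn_zero : ⇑(0 : L0 μ) =ᵐ[μ] 0)]
      with ω hω h hzero
    rw [hω, h, hzero, Pi.zero_apply]

theorem inner0_eq_zero_symm {x y : KH μ m} : inner0 x y = 0 ↔ inner0 y x = 0 := by
  simp_rw [inner0_eq_zero_iff, inner_eq_zero_symm]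

theorem inner0_self_eq_zero {x : KH μ m} : inner0 x x = 0 ↔ x = 0 := by
  simp_rw [inner0_eq_zero_iff, inner_self_eq_zero, eq_zero_iff_fib]

theorem inner0_zero_left (y : KH μ m) : inner0 0 y = 0 := by
  rw [inner0_eq_zero_iff]
  filter_upwards [fib_zero (μ := μ) (m := m)] with ω hω
  rw [hω, inner_zero_right]

/-- The orthogonal complement, for the `L₀`-valued inner product, of a set of fields. -/
def perp (A : Set (KH μ m)) : Submodule (L0 μ) (KH μ m) where
  carrier := {g | ∀ a ∈ A, inner0 g a = 0}
  zero_mem' a _ := inner0_zero_left a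
  add_mem' {g h} hg hh a ha := by
    rw [inner0_eq_zero_iff]
    filter_upwards [inner0_eq_zero_iff.1 (hg a ha), inner0_eq_zero_iff.1 (hh a ha), fib_add g h]
      with ω hgω hhω hadd
    rw [hadd, inner_add_right, hgω, hhω, add_zero]
  smul_mem' c g hg a ha := by
    rw [inner0_eq_zero_iff]
    filter_upwards [inner0_eq_zero_iff.1 (hg a ha), fib_smul c g] with ω hω hsmul
    rw [hsmul, inner_smul_right, hω, mul_zero]

theorem mem_perp {A : Set (KH μ m)} {g : KH μ m} : g ∈ perp A ↔ ∀ a ∈ A, inner0 g a = 0 :=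
  Iff.rfl

theorem perp_anti {A B : Set (KH μ m)} (h : A ⊆ B) : perp B ≤ perp A :=
  fun _ hg a ha => hg a (h ha)

theorem perp_union (A B : Set (KH μ m)) : perp (A ∪ B) = perp A ⊓ perp B := by
  ext g
  simp only [Submodule.mem_inf, mem_perp, mem_union, or_imp, forall_and]

theorem subset_perp_perp (A : Set (KH μ m)) : A ⊆ perp (perp A : Set (KH μ m)) :=
  fun _ ha _ hg => inner0_eq_zero_symm.1 (hg _ ha)

theorem eq_zero_of_mem_perp {A : Set (KH μ m)} {g : KH μ m} (hg : g ∈ A) (hperp : g ∈ perp A) :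
    g = 0 :=
  inner0_self_eq_zero.1 (hperp g hg)

theorem mem_perp_of_fib_tendsto {A : Set (KH μ m)} {u : ℕ → KH μ m} {y : KH μ m}
    (hu : ∀ n, u n ∈ perp A)
    (h : ∀ᵐ ω ∂μ, Tendsto (fun n => fib (u n) ω) atTop (𝓝 (fib y ω))) : y ∈ perp A := by
  intro g hg
  rw [inner0_eq_zero_iff]
  filter_upwards [h, ae_all_iff.2 fun n => inner0_eq_zero_iff.1 (hu n g hg)] with ω hlim hω
  exact tendsto_nhds_unique ((tendsto_const_nhds (x := fib g ω)).inner hlim)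
    (tendsto_const_nhds.congr fun n => (hω n).symm)

/-- A field whose fibres have norm zero or one. -/
def IsPartialUnit (u : KH μ m) : Prop := ∀ᵐ ω ∂μ, ‖fib u ω‖ = 0 ∨ ‖fib u ω‖ = 1

theorem measurable_inv_norm0 (u : KH μ m) : Measurable fun ω => (((norm0 u ω)⁻¹ : ℝ) : ℂ) :=
  Complex.measurable_ofReal.comp (norm0 u).measurable.inv

/-- The pointwise inverse of `norm0 u`, with value zero where the norm vanishes. -/
def invNorm (u : KH μ m) : L0 μ := toL0 μ _ (measurable_inv_norm0 u)

theorem fib_invNorm_smul (u : KH μ m) :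
    ∀ᵐ ω ∂μ, fib (invNorm u • u) ω = ((‖fib u ω‖⁻¹ : ℝ) : ℂ) • fib u ω := by
  filter_upwards [fib_smul (invNorm u) u, toL0_apply (μ := μ) _ (measurable_inv_norm0 u),
    norm0_apply u] with ω hsmul hinv hnorm
  rw [hsmul, invNorm, hinv, hnorm]

theorem isPartialUnit_invNorm_smul (u : KH μ m) : IsPartialUnit (invNorm u • u) := by
  filter_upwards [fib_invNorm_smul u] with ω hω
  rw [hω, norm_smul, Complex.norm_real, norm_inv, norm_norm]
  exact (eq_or_ne ‖fib u ω‖ 0).imp (fun h => by rw [h, mul_zero]) inv_mul_cancel₀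

theorem norm0_smul_invNorm_smul (u : KH μ m) : ofReal0 (norm0 u) • invNorm u • u = u := by
  apply KH_ext
  filter_upwards [fib_smul (ofReal0 (norm0 u)) (invNorm u • u), fib_invNorm_smul u,
    ofReal0_apply (norm0 u), norm0_apply u] with ω hsmul hinv hof hnorm
  rw [hsmul, hinv, hof, hnorm, smul_smul, ← Complex.ofReal_mul]
  by_cases h : ‖fib u ω‖ = 0
  · rw [norm_eq_zero.1 h, smul_zero]
  · rw [mul_inv_cancel₀ h, Complex.ofReal_one, one_smul]

theorem ofReal0_zero : ofReal0 (0 : L0h μ) = 0 := by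
  apply AEEqFun.ext
  filter_upwards [ofReal0_apply (0 : L0h μ), (AEEqFun.coeFn_zero : ⇑(0 : L0h μ) =ᵐ[μ] 0),
    (AEEqFun.coeFn_zero : ⇑(0 : L0 μ) =ᵐ[μ] 0)] with ω hof hzero hzero'
  rw [hof, hzero, hzero', Pi.zero_apply, Pi.zero_apply, Complex.ofReal_zero]

theorem ofReal0_neg (l : L0h μ) : ofReal0 (-l) = -ofReal0 l := by
  apply AEEqFun.ext
  filter_upwards [ofReal0_apply l, ofReal0_apply (-l), AEEqFun.coeFn_neg l,
    AEEqFun.coeFn_neg (ofReal0 l)] with ω hl hnl hneg hneg'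
  rw [hnl, hneg, hneg', Pi.neg_apply, Pi.neg_apply, hl, Complex.ofReal_neg]

end Orthogonality

section Eigenfields

variable {Ω S : Type*} [MeasurableSpace Ω] [MeasurableSpace S]
variable {μ : Measure Ω} {m : Measure S} [IsFiniteMeasure μ] [IsFiniteMeasure m]
variable {k : Kernel μ m}

theorem inner0_opKH_left (hk : IsHermitianKernel k) (x y : KH μ m) :
    inner0 (opKH k x) y = inner0 x (opKH k y) := by
  apply AEEqFun.ext
  filter_upwards [inner0_apply (opKH k x) y, inner0_apply x (opKH k y), fib_opKH k x,
    fib_opKH k y, isSymmetric_fibOp hk] with ω hl hr hx hy hsymm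
  rw [hl, hr, hx, hy]
  exact (hsymm _ _).symm

theorem mapsTo_opKH_perp (hk : IsHermitianKernel k) {A : Set (KH μ m)}
    (hA : MapsTo (opKH k) A A) : MapsTo (opKH k) (perp A) (perp A) := fun g hg a ha => by
  rw [inner0_opKH_left hk]
  exact hg _ (hA ha)

theorem fib_opKH_iterate (k : Kernel μ m) (u : KH μ m) :
    ∀ᵐ ω ∂μ, ∀ n, fib ((opKH k)^[n] u) ω = (fibOp k ω)^[n] (fib u ω) := by
  filter_upwards [ae_all_iff.2 fun n => fib_opKH k ((opKH k)^[n] u)] with ω h n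
  induction n with
  | zero => rfl
  | succ n ih => rw [Function.iterate_succ_apply', h, ih, Function.iterate_succ_apply']

theorem exists_power_limit (hk : IsHermitianKernel k) (f : KH μ m) :
    ∃ y ∈ perp (perp (range fun n => (opKH k)^[n] f) : Set (KH μ m)), ∀ᵐ ω ∂μ,
      (fibOp k ω (fib f ω) = 0 → fib y ω = 0) ∧
      (fibOp k ω (fib f ω) ≠ 0 → ‖fib y ω‖ = 1 ∧ ∃ r : ℝ, 0 < r ∧
        fibOp k ω (fibOp k ω (fib y ω)) = (r : ℂ) ^ 2 • fib y ω) := by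
  let u : ℕ → KH μ m := fun n => invNorm ((opKH k)^[2 * n] f) • (opKH k)^[2 * n] f
  have hu : ∀ᵐ ω ∂μ, ∀ n, fib (u n) ω =
      ((‖(fibOp k ω)^[2 * n] (fib f ω)‖⁻¹ : ℝ) : ℂ) • (fibOp k ω)^[2 * n] (fib f ω) := by
    filter_upwards [ae_all_iff.2 fun n => fib_invNorm_smul ((opKH k)^[2 * n] f),
      fib_opKH_iterate k f] with ω hinv hiter n
    rw [hinv, hiter]
  have hlim : ∀ᵐ ω ∂μ, ∃ v, Tendsto (fun n => fib (u n) ω) atTop (𝓝 v) ∧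
      (fibOp k ω (fib f ω) = 0 → v = 0) ∧
      (fibOp k ω (fib f ω) ≠ 0 → ‖v‖ = 1 ∧ ∃ r : ℝ, 0 < r ∧
        fibOp k ω (fibOp k ω v) = (r : ℂ) ^ 2 • v) := by
    filter_upwards [hu, isSymmetric_fibOp hk] with ω hu hsymm
    simp_rw [hu]
    by_cases hf : fibOp k ω (fib f ω) = 0
    · refine ⟨0, tendsto_const_nhds.congr' ?_, fun _ => rfl, fun h => absurd hf h⟩
      filter_upwards [eventually_ge_atTop 1] with n hn
      obtain ⟨j, hj⟩ := Nat.exists_eq_add_of_le' (show 1 ≤ 2 * n by omega)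
      rw [hj, Function.iterate_succ_apply, hf, iterate_map_zero, smul_zero]
    · obtain ⟨r, hr, v, hv, hTv, hlim⟩ :=
        tendsto_power_iteration hsymm (isCompactOperator_fibOp k ω) hf
      exact ⟨v, hlim, fun h => absurd h hf, fun _ => ⟨hv, r, hr, hTv⟩⟩
  obtain ⟨y, hy⟩ := exists_fib_limit u (hlim.mono fun ω ⟨v, hv, _⟩ => ⟨v, hv⟩)
  refine ⟨y, mem_perp_of_fib_tendsto (fun n => Submodule.smul_mem _ _
    (subset_perp_perp _ (mem_range_self (2 * n)))) hy, ?_⟩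
  filter_upwards [hlim, hy] with ω ⟨v, hv, hTf⟩ hyω
  rwa [tendsto_nhds_unique hyω hv]

theorem exists_eigenfield_sq (hk : IsHermitianKernel k) {f : KH μ m} (hf : opKH k f ≠ 0) :
    ∃ y ∈ perp (perp (range fun n => (opKH k)^[n] f) : Set (KH μ m)), ∃ l : L0h μ,
      y ≠ 0 ∧ opKH k (opKH k y) = ofReal0 l • ofReal0 l • y := by
  obtain ⟨y, hmem, hy⟩ := exists_power_limit hk f
  let l : L0h μ := AEEqFun.comp Real.sqrt Real.continuous_sqrt (norm0 (opKH k (opKH k y)))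
  have hfib : ∀ᵐ ω ∂μ, fib (opKH k (opKH k y)) ω = fibOp k ω (fibOp k ω (fib y ω)) := by
    filter_upwards [fib_opKH k (opKH k y), fib_opKH k y] with ω hω hω'
    rw [hω, hω']
  have hl : ∀ᵐ ω ∂μ, l ω = √‖fibOp k ω (fibOp k ω (fib y ω))‖ := by
    filter_upwards [AEEqFun.coeFn_comp Real.sqrt Real.continuous_sqrt
      (norm0 (opKH k (opKH k y))), norm0_apply (opKH k (opKH k y)), hfib] with ω hω hnorm hfib
    rw [← hfib, ← hnorm]
    exact hω
  refine ⟨y, hmem, l, fun h => hf ?_, KH_ext ?_⟩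
  · rw [eq_zero_iff_fib] at h ⊢
    filter_upwards [h, hy, fib_opKH k f] with ω hyω hω hfib
    rw [hfib]
    by_contra hne
    simpa [hyω] using (hω.2 hne).1
  · filter_upwards [hy, hl, hfib, fib_smul (ofReal0 l) (ofReal0 l • y), fib_smul (ofReal0 l) y,
      ofReal0_apply l] with ω hyω hlω hTT hsmul hsmul' hof
    rw [hTT, hsmul, hsmul', hof, hlω]
    by_cases h : fibOp k ω (fib f ω) = 0
    · simp only [hyω.1 h, map_zero, smul_zero]
    · obtain ⟨hnorm, r, hr, heigen⟩ := hyω.2 h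
      rw [heigen, norm_smul, hnorm, mul_one, norm_pow, Complex.norm_real, Real.sqrt_sq_eq_abs,
        abs_norm, Real.norm_of_nonneg hr.le, smul_smul, sq]

-- On the range of `T + l`, the identity `T² y = l² y` becomes `T = l`; if `(T + l) y = 0`, then `y`
-- itself is an eigenfield for `-l`.
theorem exists_eigenfield (hk : IsHermitianKernel k) {f : KH μ m} (hf : f ≠ 0) :
    ∃ y ∈ perp (perp (range fun n => (opKH k)^[n] f) : Set (KH μ m)), ∃ l : L0h μ,
      y ≠ 0 ∧ IsPartialUnit y ∧ opKH k y = ofReal0 l • y := by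
  suffices h : ∃ w ∈ perp (perp (range fun n => (opKH k)^[n] f) : Set (KH μ m)), ∃ l : L0h μ,
      w ≠ 0 ∧ opKH k w = ofReal0 l • w by
    obtain ⟨w, hmem, l, hw, hTw⟩ := h
    refine ⟨invNorm w • w, Submodule.smul_mem _ _ hmem, l, fun h => hw ?_,
      isPartialUnit_invNorm_smul w, by rw [map_smul, hTw, smul_comm]⟩
    rw [← norm0_smul_invNorm_smul w, h, smul_zero]
  have horbit : MapsTo (opKH k) (range fun n => (opKH k)^[n] f)
      (range fun n => (opKH k)^[n] f) := by
    rintro _ ⟨n, rfl⟩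
    exact ⟨n + 1, Function.iterate_succ_apply' _ _ _⟩
  by_cases hTf : opKH k f = 0
  · exact ⟨f, subset_perp_perp _ ⟨0, rfl⟩, 0, hf, by rw [hTf, ofReal0_zero, zero_smul]⟩
  obtain ⟨y, hmem, l, hy, hTT⟩ := exists_eigenfield_sq hk hTf
  by_cases hw : opKH k y + ofReal0 l • y = 0
  · exact ⟨y, hmem, -l, hy, by
      rw [ofReal0_neg]
      exact (eq_neg_of_add_eq_zero_left hw).trans (neg_smul _ _).symm⟩
  · exact ⟨opKH k y + ofReal0 l • y, Submodule.add_mem _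
      (mapsTo_opKH_perp hk (mapsTo_opKH_perp hk horbit) hmem) (Submodule.smul_mem _ _ hmem), l, hw,
      by rw [map_add, map_smul, hTT, smul_add, add_comm]⟩

end Eigenfields

/-! ### Maximal orthogonal families of eigenfields -/

section OrthogonalFamilies

variable {Ω S : Type*} [MeasurableSpace Ω] [MeasurableSpace S]
variable {μ : Measure Ω} {m : Measure S} [SFinite m]

theorem exists_maximal_orthogonal (A : Set (KH μ m)) :
    ∃ F ⊆ A, F.Pairwise (fun x y => inner0 x y = 0) ∧ ∀ y ∈ A, y ∈ perp F → y = 0 := by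
  obtain ⟨F, hF⟩ := zorn_subset
    {F : Set (KH μ m) | F ⊆ A ∧ F.Pairwise (fun x y => inner0 x y = 0)} fun c hc hchain =>
      ⟨⋃₀ c, ⟨sUnion_subset fun s hs => (hc hs).1,
        (pairwise_sUnion hchain.directedOn).2 fun s hs => (hc hs).2⟩,
        fun s hs => subset_sUnion_of_mem hs⟩
  refine ⟨F, hF.prop.1, hF.prop.2, fun y hy hperp => ?_⟩
  have hinsert : insert y F ∈
      {F : Set (KH μ m) | F ⊆ A ∧ F.Pairwise (fun x y => inner0 x y = 0)} :=
    ⟨insert_subset hy hF.prop.1, hF.prop.2.insert fun x hx _ =>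
      ⟨hperp x hx, inner0_eq_zero_symm.1 (hperp x hx)⟩⟩
  exact eq_zero_of_mem_perp (hF.le_of_ge hinsert (subset_insert y F) (mem_insert y F)) hperp

theorem countable_of_sum_le {ι : Type*} (F : Set ι) (G : ι → Ω → ℝ≥0∞)
    (hG : ∀ u, AEMeasurable (G u) μ) (b : Ω → ℝ≥0∞) (hb : ∫⁻ ω, b ω ∂μ ≠ ∞)
    (h : ∀ s : Finset ι, (s : Set ι) ⊆ F → ∀ᵐ ω ∂μ, ∑ u ∈ s, G u ω ≤ b ω) :
    {u ∈ F | ¬ ∀ᵐ ω ∂μ, G u ω = 0}.Countable := by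
  classical
  have hsum : ∑' u : F, ∫⁻ ω, G u ω ∂μ ≤ ∫⁻ ω, b ω ∂μ := by
    rw [ENNReal.tsum_eq_iSup_sum]
    refine iSup_le fun s => ?_
    rw [← lintegral_finsetSum' s (f := fun u : F => G u) fun u _ => hG u]
    refine lintegral_mono_ae ?_
    filter_upwards [h (s.map (Function.Embedding.subtype _)) (by simp)] with ω hω
    rwa [Finset.sum_map] at hω
  refine ((Summable.countable_support_ennreal (ne_top_of_le_ne_top hb hsum)).image
    Subtype.val).mono ?_
  rintro u ⟨hu, hne⟩
  exact ⟨⟨u, hu⟩, fun hzero => hne ((lintegral_eq_zero_iff' (hG u)).1 hzero), rfl⟩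

theorem ae_partialOrthonormal {ι : Type*} [Countable ι] (y : ι → KH μ m)
    (hy : ∀ i, IsPartialUnit (y i)) (ho : Pairwise fun i j => inner0 (y i) (y j) = 0) :
    ∀ᵐ ω ∂μ, PartialOrthonormal ℂ fun i => fib (y i) ω := by
  have hinner : ∀ᵐ ω ∂μ, ∀ i j, i ≠ j → inner ℂ (fib (y i) ω) (fib (y j) ω) = 0 := by
    simp_rw [ae_all_iff]
    exact fun i j hij => inner0_eq_zero_iff.1 (ho hij.symm)
  filter_upwards [hinner, ae_all_iff.2 hy] with ω hω hnorm
  exact ⟨hnorm, fun i j => hω i j⟩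

theorem ae_partialOrthonormal_finset {F : Set (KH μ m)} (hF : ∀ u ∈ F, IsPartialUnit u)
    (ho : F.Pairwise fun x y => inner0 x y = 0) (s : Finset (KH μ m))
    (hs : (s : Set (KH μ m)) ⊆ F) :
    ∀ᵐ ω ∂μ, PartialOrthonormal ℂ fun u : s => fib (u : KH μ m) ω :=
  ae_partialOrthonormal (fun u : s => (u : KH μ m)) (fun u => hF u (hs u.2))
    fun u v huv => ho (hs u.2) (hs v.2) fun h => huv (Subtype.ext h)

theorem countable_of_sum_sq_le [IsFiniteMeasure μ] {ι E : Type*} [NormedAddCommGroup E]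
    (F : Set ι) (G : ι → Ω → E) (hG : ∀ u, AEMeasurable (fun ω => ‖G u ω‖ₑ) μ) (C : ℝ)
    (h : ∀ s : Finset ι, (s : Set ι) ⊆ F → ∀ᵐ ω ∂μ, ∑ u ∈ s, ‖G u ω‖ ^ 2 ≤ C) :
    {u ∈ F | ¬ ∀ᵐ ω ∂μ, G u ω = 0}.Countable := by
  refine (countable_of_sum_le (μ := μ) F (fun u ω => ‖G u ω‖ₑ ^ 2) (fun u => (hG u).pow_const 2)
    (fun _ => ENNReal.ofReal C) ?_ fun s hs => ?_).mono ?_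
  · rw [lintegral_const]
    exact ENNReal.mul_ne_top (by simp) (measure_ne_top μ univ)
  · filter_upwards [h s hs] with ω hω
    refine le_trans (le_of_eq ?_) (ENNReal.ofReal_le_ofReal hω)
    rw [ENNReal.ofReal_sum_of_nonneg fun u _ => by positivity]
    exact Finset.sum_congr rfl fun u _ => by rw [ENNReal.ofReal_pow (norm_nonneg _), ofReal_norm]
  · rintro u ⟨hu, hne⟩
    exact ⟨hu, fun hsq => hne (by simpa using hsq)⟩

theorem countable_not_orthogonal [IsFiniteMeasure μ] {F : Set (KH μ m)}
    (hF : ∀ u ∈ F, IsPartialUnit u) (ho : F.Pairwise fun x y => inner0 x y = 0) {z : KH μ m} {C : ℝ}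
    (hz : ∀ᵐ ω ∂μ, ‖fib z ω‖ ≤ C) : {u ∈ F | inner0 u z ≠ 0}.Countable := by
  refine (countable_of_sum_sq_le (μ := μ) F (fun u ω => inner0 z u ω)
    (fun u => (inner0 z u).measurable.enorm.aemeasurable) (C ^ 2) fun s hs => ?_).mono ?_
  · filter_upwards [ae_partialOrthonormal_finset hF ho s hs, hz,
      (ae_ball_iff s.countable_toSet).2 fun u _ => inner0_apply z u] with ω hort hzω hinner
    calc ∑ u ∈ s, ‖inner0 z u ω‖ ^ 2 = ∑ u ∈ s, ‖inner ℂ (fib u ω) (fib z ω)‖ ^ 2 :=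
          Finset.sum_congr rfl fun u hu => by rw [hinner u hu]
      _ = ∑ u : s, ‖inner ℂ (fib (u : KH μ m) ω) (fib z ω)‖ ^ 2 := (Finset.sum_coe_sort s _).symm
      _ ≤ ‖fib z ω‖ ^ 2 := hort.sum_sq_inner_le Finset.univ (fib z ω)
      _ ≤ C ^ 2 := by gcongr
  · rintro u ⟨hu, hne⟩
    refine ⟨hu, fun h => hne (inner0_eq_zero_symm.1 (AEEqFun.ext ?_))⟩
    exact EventuallyEq.trans h AEEqFun.coeFn_zero.symm

theorem exists_seq_of_countable {α : Type*} [Zero α] {F : Set α} (hF : F.Countable) :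
    ∃ y : ℕ → α, (∀ n, y n ∈ F ∨ y n = 0) ∧ F ⊆ range y ∧ ∀ i j, i ≠ j → y i = y j → y i = 0 := by
  have := hF.toEncodable
  let y : ℕ → α := Function.extend (Encodable.encode : F → ℕ) Subtype.val 0
  have hy (u : F) : y (Encodable.encode u) = u := Encodable.encode_injective.extend_apply _ _ u
  have hy_zero (n : ℕ) (hn : ¬ ∃ u : F, Encodable.encode u = n) : y n = 0 :=
    Function.extend_apply' _ _ _ hn
  refine ⟨y, fun n => ?_, fun u hu => ⟨_, hy ⟨u, hu⟩⟩, fun i j hij heq => ?_⟩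
  · by_cases hn : ∃ u : F, Encodable.encode u = n
    · obtain ⟨u, rfl⟩ := hn
      exact Or.inl (hy u ▸ u.2)
    · exact Or.inr (hy_zero n hn)
  · by_contra hne
    obtain ⟨u, rfl⟩ : ∃ u : F, Encodable.encode u = i := of_not_not (mt (hy_zero i) hne)
    obtain ⟨v, rfl⟩ : ∃ v : F, Encodable.encode v = j := of_not_not (mt (hy_zero j) (heq ▸ hne))
    exact hij (by rw [Subtype.ext ((hy u).symm.trans (heq.trans (hy v)))])

end OrthogonalFamilies

section EigenSequences

variable {Ω S : Type*} [MeasurableSpace Ω] [MeasurableSpace S]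
variable {μ : Measure Ω} {m : Measure S} [IsFiniteMeasure μ] [IsFiniteMeasure m]

theorem exists_countable_perp_le_ker (k : Kernel μ m) :
    ∃ Z : Set (KH μ m), Z.Countable ∧ (∀ z ∈ Z, IsPartialUnit z) ∧
      perp Z ≤ LinearMap.ker (opKH k) := by
  obtain ⟨F, hFA, hFo, hFm⟩ :=
    exists_maximal_orthogonal {u : KH μ m | IsPartialUnit u ∧ opKH k u ≠ 0}
  refine ⟨F, ?_, fun z hz => (hFA hz).1, fun f hf => ?_⟩
  · refine (countable_of_sum_sq_le (μ := μ) F (fun u => fib (opKH k u))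
      (fun u => aemeasurable_enorm_fib _) (rowBound m ‖k‖₊ ^ 2 * m.real univ) fun s hs => ?_).mono
      fun u hu => mem_sep hu fun h => (hFA hu).2 (eq_zero_iff_fib.2 h)
    filter_upwards [ae_partialOrthonormal_finset (fun u hu => (hFA hu).1) hFo s hs,
      (ae_ball_iff s.countable_toSet).2 fun u _ => fib_opKH k u] with ω hort hfib
    calc ∑ u ∈ s, ‖fib (opKH k u) ω‖ ^ 2 = ∑ u ∈ s, ‖fibOp k ω (fib u ω)‖ ^ 2 :=
          Finset.sum_congr rfl fun u hu => by rw [hfib u hu]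
      _ = ∑ u : s, ‖fibOp k ω (fib (u : KH μ m) ω)‖ ^ 2 := (Finset.sum_coe_sort s _).symm
      _ ≤ _ := sum_sq_fibOp_le k ω hort Finset.univ
  · by_contra hne
    rw [LinearMap.mem_ker, ← norm0_smul_invNorm_smul f, map_smul] at hne
    refine hne ?_
    rw [hFm (invNorm f • f) ⟨isPartialUnit_invNorm_smul f, fun h => hne ?_⟩
      (Submodule.smul_mem _ _ hf), map_zero, smul_zero]
    rw [h, smul_zero]

/-- The fields annihilated by `T` and orthogonal to all `e j`: the part of the module that an
eigenfield sequence need not reach. -/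
def nullPerp (k : Kernel μ m) (e : ℕ → KH μ m) : Submodule (L0 μ) (KH μ m) :=
  perp (range e) ⊓ LinearMap.ker (opKH k)

/-- A sequence of mutually orthogonal eigenfields, with fibres of norm zero or one, that is total
in the orthogonal complement of `nullPerp k e`. -/
structure IsEigenSequence (k : Kernel μ m) (e y : ℕ → KH μ m) (l : ℕ → L0h μ) : Prop where
  isPartialUnit : ∀ n, IsPartialUnit (y n)
  orthogonal : Pairwise fun i j => inner0 (y i) (y j) = 0
  eigen : ∀ n, opKH k (y n) = ofReal0 (l n) • y n
  mem : ∀ n, y n ∈ perp (nullPerp k e : Set (KH μ m))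
  eq_zero : ∀ f ∈ perp (nullPerp k e : Set (KH μ m)), f ∈ perp (range y) → f = 0

theorem opKH_mem_perp_nullPerp {k : Kernel μ m} (hk : IsHermitianKernel k) (e : ℕ → KH μ m)
    (f : KH μ m) : opKH k f ∈ perp (nullPerp k e : Set (KH μ m)) := fun g hg => by
  rw [inner0_opKH_left hk, LinearMap.mem_ker.1 hg.2, inner0_eq_zero_symm, inner0_zero_left]

theorem inner0_opKH_of_eigen {k : Kernel μ m} (hk : IsHermitianKernel k) {y f : KH μ m}
    {l : L0h μ} (hy : opKH k y = ofReal0 l • y) (hf : inner0 f y = 0) :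
    inner0 (opKH k f) y = 0 := by
  rw [inner0_opKH_left hk, hy, inner0_eq_zero_symm]
  exact (perp {f}).smul_mem _ (fun a ha => by
    rw [mem_singleton_iff.1 ha, inner0_eq_zero_symm, hf]) f rfl

theorem eq_zero_of_forall_eigenfield {k : Kernel μ m} (hk : IsHermitianKernel k)
    {A : Set (KH μ m)} (hA : MapsTo (opKH k) (perp A) (perp A))
    (h : ∀ y ∈ perp A, IsPartialUnit y → ∀ l : L0h μ, opKH k y = ofReal0 l • y → y = 0)
    {f : KH μ m} (hf : f ∈ perp A) : f = 0 := by
  by_contra hne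
  obtain ⟨y, hmem, l, hy, hunit, heigen⟩ := exists_eigenfield hk hne
  refine hy (h y (perp_anti (fun a ha => ?_) hmem) hunit l heigen)
  rintro _ ⟨n, rfl⟩
  exact inner0_eq_zero_symm.1 (hA.iterate n hf a ha)

theorem countable_of_subset_perp_nullPerp (k : Kernel μ m) {e : ℕ → KH μ m} {C : ℕ → ℝ}
    (he : ∀ j, ∀ᵐ ω ∂μ, ‖fib (e j) ω‖ ≤ C j) {F : Set (KH μ m)} (hF : ∀ u ∈ F, IsPartialUnit u)
    (ho : F.Pairwise fun x y => inner0 x y = 0)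
    (hsub : F ⊆ perp (nullPerp k e : Set (KH μ m))) : F.Countable := by
  obtain ⟨Z, hZ, hZ_unit, hZ_perp⟩ := exists_countable_perp_le_ker k
  have hZ_count (z) (hz : z ∈ Z) : {u ∈ F | inner0 u z ≠ 0}.Countable :=
    countable_not_orthogonal hF ho (C := 1) <| by
      filter_upwards [hZ_unit z hz] with ω hω
      rcases hω with hω | hω <;> simp [hω]
  refine ((countable_singleton 0).union ((hZ.biUnion hZ_count).union
    (countable_iUnion fun j => countable_not_orthogonal hF ho (he j)))).mono fun u hu => ?_
  by_contra hcon
  simp only [mem_union, mem_iUnion, mem_singleton_iff, not_or, not_exists, mem_ofPred_eq,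
    not_and, not_not] at hcon
  obtain ⟨hne, hperpZ, hperpe⟩ := hcon
  refine hne (eq_zero_of_mem_perp (show u ∈ nullPerp k e from ⟨?_, ?_⟩) (hsub hu))
  · rintro _ ⟨j, rfl⟩
    exact hperpe j hu
  · exact hZ_perp fun z hz => hperpZ z hz hu

theorem exists_isEigenSequence {k : Kernel μ m} (hk : IsHermitianKernel k) {e : ℕ → KH μ m}
    {C : ℕ → ℝ} (he : ∀ j, ∀ᵐ ω ∂μ, ‖fib (e j) ω‖ ≤ C j) :
    ∃ (y : ℕ → KH μ m) (l : ℕ → L0h μ), IsEigenSequence k e y l := by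
  obtain ⟨F, hFA, hFo, hFmax⟩ := exists_maximal_orthogonal {y : KH μ m | IsPartialUnit y ∧
    y ∈ perp (nullPerp k e : Set (KH μ m)) ∧ ∃ l : L0h μ, opKH k y = ofReal0 l • y}
  have hFc : F.Countable := countable_of_subset_perp_nullPerp k he (fun u hu => (hFA hu).1) hFo
    fun u hu => (hFA hu).2.1
  obtain ⟨y, hyF, hFy, hyne⟩ := exists_seq_of_countable hFc
  have hy_eigen (n) : ∃ l : L0h μ, opKH k (y n) = ofReal0 l • y n :=
    (hyF n).elim (fun h => (hFA h).2.2) fun h => ⟨0, by rw [h, map_zero, smul_zero]⟩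
  choose l hl using hy_eigen
  refine ⟨y, l, fun n => ?_, fun i j hij => ?_, hl, fun n => ?_, fun f hf hfy => ?_⟩
  · refine (hyF n).elim (fun h => (hFA h).1) fun h => ?_
    filter_upwards [eq_zero_iff_fib.1 h] with ω hω
    exact Or.inl (norm_eq_zero.2 hω)
  · rcases hyF i with hi | hi
    · rcases hyF j with hj | hj
      · by_cases heq : y i = y j
        · rw [hyne i j hij heq, inner0_zero_left]
        · exact hFo hi hj heq
      · rw [hj, inner0_eq_zero_symm, inner0_zero_left]
    · rw [hi, inner0_zero_left]
  · exact (hyF n).elim (fun h => (hFA h).2.1) fun h => h ▸ Submodule.zero_mem _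
  · have hmaps : MapsTo (opKH k) (perp (nullPerp k e ∪ range y))
        (perp (nullPerp k e ∪ range y)) := by
      rw [perp_union]
      refine fun g hg => ⟨opKH_mem_perp_nullPerp hk e g, ?_⟩
      rintro _ ⟨n, rfl⟩
      exact inner0_opKH_of_eigen hk (hl n) (hg.2 _ (mem_range_self n))
    refine eq_zero_of_forall_eigenfield hk hmaps (fun z hz hunit lz hTz => ?_)
      (perp_union (nullPerp k e : Set (KH μ m)) (range y) ▸ ⟨hf, hfy⟩)
    rw [perp_union] at hz
    exact hFmax z ⟨hunit, hz.1, lz, hTz⟩ (perp_anti hFy hz.2)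

end EigenSequences

/-! ### Orthonormal sequences of eigenfields -/

theorem exists_seq_infiniteDimensional_span {𝕜 E : Type*} [NontriviallyNormedField 𝕜]
    [CompleteSpace 𝕜] [NormedAddCommGroup E] [NormedSpace 𝕜 E] (hE : ¬ FiniteDimensional 𝕜 E) :
    ∃ e : ℕ → E, ¬ FiniteDimensional 𝕜 (Submodule.span 𝕜 (range e)) ∧
      (TopologicalSpace.SeparableSpace E → DenseRange e) := by
  by_cases hsep : TopologicalSpace.SeparableSpace E
  · have hdense := TopologicalSpace.denseRange_denseSeq E
    refine ⟨TopologicalSpace.denseSeq E, fun hfin => hE ?_, fun _ => hdense⟩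
    have hclosed := Submodule.closed_of_finiteDimensional
      (Submodule.span 𝕜 (range (TopologicalSpace.denseSeq E)))
    have htop : Submodule.span 𝕜 (range (TopologicalSpace.denseSeq E)) = ⊤ :=
      eq_top_iff.2 fun x _ => hclosed.closure_subset_iff.2 Submodule.subset_span (hdense x)
    rw [htop] at hfin
    exact (Submodule.topEquiv (R := 𝕜) (M := E)).finiteDimensional
  · let b := Module.Basis.ofVectorSpace 𝕜 E
    have hinf : Infinite (Module.Basis.ofVectorSpaceIndex 𝕜 E) := by
      by_contra h
      rw [not_infinite_iff_finite] at h
      exact hE (Module.Finite.of_basis b)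
    let g := Infinite.natEmbedding (Module.Basis.ofVectorSpaceIndex 𝕜 E)
    refine ⟨fun n => b (g n), fun hfin => ?_, fun h => absurd h hsep⟩
    have hli : LinearIndependent 𝕜 fun n => b (g n) := b.linearIndependent.comp g g.injective
    exact not_finite_iff_infinite.2 inferInstance (Module.Basis.span hli).linearIndependent.finite

theorem PartialOrthonormal.inner_sub_sum {𝕜 H ι : Type*} [RCLike 𝕜] [NormedAddCommGroup H]
    [InnerProductSpace 𝕜 H] {v : ι → H} (hv : PartialOrthonormal 𝕜 v) (s : Finset ι) (x : H)
    {i : ι} (hi : i ∈ s) : inner 𝕜 (v i) (x - ∑ n ∈ s, inner 𝕜 (v n) x • v n) = 0 := by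
  rw [inner_sub_right, inner_sum, Finset.sum_eq_single_of_mem i hi fun n _ hn => by
    rw [inner_smul_right, hv.inner_eq hn.symm, mul_zero], inner_smul_right,
    inner_self_eq_norm_sq_to_K]
  rcases hv.norm_eq i with hnorm | hnorm
  · rw [norm_eq_zero.1 hnorm, inner_zero_left, zero_mul, sub_zero]
  · rw [hnorm, RCLike.ofReal_one, one_pow, mul_one, sub_self]

section Enumeration

variable {Ω : Type*} [MeasurableSpace Ω]

open Classical in
theorem measurable_count {p : Ω → ℕ → Prop} (hp : ∀ i, MeasurableSet {ω | p ω i}) (n : ℕ) :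
    Measurable fun ω => Nat.count (p ω) n := by
  induction n with
  | zero => exact measurable_const
  | succ n ih =>
    simp_rw [Nat.count_succ]
    exact ih.add (Measurable.ite (hp n) measurable_const measurable_const)

/-- `Nat.nth p n` is the junk value `0` where `p` has at most `n` solutions; this is why the
preimage of `0` is treated as the complement of the others. -/
theorem measurable_nth {p : Ω → ℕ → Prop} (hp : ∀ i, MeasurableSet {ω | p ω i}) (n : ℕ) :
    Measurable fun ω => Nat.nth (p ω) n := by
  classical
  have hsucc (i : ℕ) : MeasurableSet ((fun ω => Nat.nth (p ω) n) ⁻¹' {i + 1}) := by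
    have heq : (fun ω => Nat.nth (p ω) n) ⁻¹' {i + 1} =
        {ω | p ω (i + 1)} ∩ (fun ω => Nat.count (p ω) (i + 1)) ⁻¹' {n} := by
      ext ω
      simp only [mem_preimage, mem_singleton_iff, mem_inter_iff, mem_ofPred_eq]
      refine ⟨fun h => ?_, fun ⟨hpi, hcount⟩ => hcount ▸ Nat.nth_count hpi⟩
      have hlt (hfin : {j | p ω j}.Finite) : n < hfin.toFinset.card := by
        by_contra! hle
        exact i.succ_ne_zero (h.symm.trans (Nat.nth_of_card_le hfin hle))
      exact h ▸ ⟨Nat.nth_mem n hlt, Nat.count_nth hlt⟩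
    rw [heq]
    exact (hp _).inter (measurable_count hp _ (measurableSet_singleton n))
  refine measurable_to_countable' fun i => ?_
  cases i with
  | zero =>
    have heq : (fun ω => Nat.nth (p ω) n) ⁻¹' {0} =
        (⋃ i, (fun ω => Nat.nth (p ω) n) ⁻¹' {i + 1})ᶜ := by
      ext ω
      simp only [mem_preimage, mem_singleton_iff, mem_compl_iff, mem_iUnion, not_exists]
      exact ⟨fun h i => by omega, fun h => by
        by_contra hne
        exact h _ (Nat.succ_pred hne).symm⟩
    rw [heq]
    exact (MeasurableSet.iUnion hsucc).compl
  | succ i => exact hsucc i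

theorem exists_measurable_enumeration {p : Ω → ℕ → Prop} (hp : ∀ i, MeasurableSet {ω | p ω i}) :
    ∃ N : ℕ → Ω → ℕ, (∀ n, Measurable (N n)) ∧ ∀ ω, {i | p ω i}.Infinite →
      Function.Injective (fun n => N n ω) ∧ range (fun n => N n ω) = {i | p ω i} :=
  ⟨fun n ω => Nat.nth (p ω) n, measurable_nth hp, fun _ hinf =>
    ⟨Nat.nth_injective hinf, Nat.range_nth_of_infinite hinf⟩⟩

end Enumeration

section EigenBases

variable {Ω S : Type*} [MeasurableSpace Ω] [MeasurableSpace S]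
variable {μ : Measure Ω} {m : Measure S}

theorem exists_glue_L0h (N : Ω → ℕ) (hN : Measurable N) (l : ℕ → L0h μ) :
    ∃ a : L0h μ, ∀ᵐ ω ∂μ, a ω = l (N ω) ω := by
  have hmeas : Measurable fun ω => l (N ω) ω :=
    (measurable_from_prod_countable_right fun i => (l i).measurable :
      Measurable fun q : ℕ × Ω => l q.1 q.2).comp (hN.prodMk measurable_id)
  exact ⟨AEEqFun.mk _ hmeas.aestronglyMeasurable, AEEqFun.coeFn_mk _ _⟩

theorem coeFn_ite (p : Prop) [Decidable p] :
    ∀ᵐ ω ∂μ, (if p then 1 else 0 : L0 μ) ω = if p then 1 else 0 := by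
  split_ifs
  · exact AEEqFun.coeFn_one
  · exact AEEqFun.coeFn_zero

theorem fib_sum_inner0_smul [SFinite m] {ι : Type*} (s : Finset ι) (u : KH μ m) (y : ι → KH μ m) :
    ∀ᵐ ω ∂μ, fib (∑ n ∈ s, inner0 u (y n) • y n) ω =
      ∑ n ∈ s, inner ℂ (fib (y n) ω) (fib u ω) • fib (y n) ω := by
  filter_upwards [fib_sum s fun n => inner0 u (y n) • y n,
    (ae_ball_iff s.countable_toSet).2 fun n _ => fib_smul (inner0 u (y n)) (y n),
    (ae_ball_iff s.countable_toSet).2 fun n _ => inner0_apply u (y n)] with ω hsum hsmul hinner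
  rw [hsum]
  exact Finset.sum_congr rfl fun n hn => by rw [hsmul n hn, hinner n hn]

theorem fib_sub_sum_inner0_smul [SFinite m] {ι : Type*} (s : Finset ι) (u : KH μ m)
    (y : ι → KH μ m) :
    ∀ᵐ ω ∂μ, fib (u - ∑ n ∈ s, inner0 u (y n) • y n) ω =
      fib u ω - ∑ n ∈ s, inner ℂ (fib (y n) ω) (fib u ω) • fib (y n) ω := by
  filter_upwards [fib_sub u (∑ n ∈ s, inner0 u (y n) • y n), fib_sum_inner0_smul s u y]
    with ω hsub hsum
  rw [hsub, hsum]

variable [IsFiniteMeasure μ] [IsFiniteMeasure m]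
variable {k : Kernel μ m} {e y : ℕ → KH μ m} {l : ℕ → L0h μ}

theorem IsEigenSequence.sub_sum_mem_perp (hy : IsEigenSequence k e y l) (N j : ℕ) :
    e j - ∑ n ∈ Finset.range N, inner0 (e j) (y n) • y n ∈
      perp (nullPerp k e : Set (KH μ m)) :=
  sub_mem (perp_anti (fun _ hg => hg.1) (subset_perp_perp _ (mem_range_self j)))
    (sum_mem fun n _ => Submodule.smul_mem _ _ (hy.mem n))

/-- Cut down to the set `A` of points where all `y n` with `N ≤ n` vanish, `e j` minus its
projection onto the first `N` eigenfields is orthogonal to the whole eigenfield sequence. -/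
theorem IsEigenSequence.fib_eq_sum (hy : IsEigenSequence k e y l) (N j : ℕ) :
    ∀ᵐ ω ∂μ, (∀ n ≥ N, norm0 (y n) ω = 0) → fib (e j) ω =
      ∑ n ∈ Finset.range N, inner ℂ (fib (y n) ω) (fib (e j) ω) • fib (y n) ω := by
  let A : Set Ω := {ω | ∀ n ≥ N, norm0 (y n) ω = 0}
  have hA : MeasurableSet A := by
    have hinter : A = ⋂ n ≥ N, {ω | norm0 (y n) ω = 0} := by
      ext
      simp only [A, mem_iInter, mem_ofPred_eq]
    rw [hinter]
    exact MeasurableSet.iInter fun n => MeasurableSet.iInter fun _ =>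
      (norm0 (y n)).measurable (measurableSet_singleton 0)
  let g : KH μ m := e j - ∑ n ∈ Finset.range N, inner0 (e j) (y n) • y n
  have hchi : ∀ᵐ ω ∂μ, fib (chi μ A hA • g) ω = (A.indicator 1 ω : ℂ) • fib g ω := by
    filter_upwards [fib_smul (chi μ A hA) g, chi_apply (μ := μ) A hA] with ω hsmul hω
    rw [hsmul, hω]
  have hzero : chi μ A hA • g = 0 := by
    refine hy.eq_zero _ (Submodule.smul_mem _ _ (hy.sub_sum_mem_perp N j)) ?_
    rintro _ ⟨i, rfl⟩
    rw [inner0_eq_zero_iff]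
    filter_upwards [fib_sub_sum_inner0_smul (Finset.range N) (e j) y, hchi, norm0_apply (y i),
      ae_partialOrthonormal y hy.isPartialUnit hy.orthogonal] with ω hg hchiω hnorm hort
    rw [hchiω, inner_smul_right, hg]
    by_cases hω : ω ∈ A
    · rcases lt_or_ge i N with hi | hi
      · rw [hort.inner_sub_sum _ _ (Finset.mem_range.2 hi), mul_zero]
      · rw [norm_eq_zero.1 (hnorm.symm.trans (hω i hi)), inner_zero_left, mul_zero]
    · rw [indicator_of_notMem hω, zero_mul]
  filter_upwards [fib_sub_sum_inner0_smul (Finset.range N) (e j) y, hchi, eq_zero_iff_fib.1 hzero]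
    with ω hg hchiω hzeroω hω
  rw [hzeroω, indicator_of_mem (show ω ∈ A from hω), Pi.one_apply, one_smul, hg] at hchiω
  exact sub_eq_zero.1 hchiω.symm

theorem IsEigenSequence.ae_infinite (hy : IsEigenSequence k e y l) {v : ℕ → Lp ℂ 2 m}
    (he : ∀ j, ∀ᵐ ω ∂μ, fib (e j) ω = v j)
    (hv : ¬ FiniteDimensional ℂ (Submodule.span ℂ (range v))) :
    ∀ᵐ ω ∂μ, {n | norm0 (y n) ω ≠ 0}.Infinite := by
  filter_upwards [ae_all_iff.2 he,
    ae_all_iff.2 fun N => ae_all_iff.2 fun j => hy.fib_eq_sum N j] with ω heω hsum hfin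
  obtain ⟨N, hN⟩ := hfin.bddAbove
  let V : Submodule ℂ (Lp ℂ 2 m) :=
    Submodule.span ℂ ((fun n => fib (y n) ω) '' (Finset.range (N + 1) : Set ℕ))
  have : FiniteDimensional ℂ V :=
    FiniteDimensional.span_of_finite ℂ ((Finset.range (N + 1)).finite_toSet.image _)
  refine hv (Submodule.finiteDimensional_of_le (S₂ := V) (Submodule.span_le.2 ?_))
  rintro _ ⟨j, rfl⟩
  rw [← heω j, hsum (N + 1) j fun n hn => by_contra fun hne => by
    have : n ≤ N := hN hne
    omega]
  exact Submodule.sum_mem _ fun n hn => Submodule.smul_mem _ _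
    (Submodule.subset_span (mem_image_of_mem _ hn))

/-- An orthonormal sequence of eigenfields of `T`, with eigenvalues `lam n`, whose orthogonal
complement is annihilated by `T`. -/
structure IsEigenBasis (k : Kernel μ m) (lam : ℕ → L0h μ) (x : ℕ → KH μ m) : Prop where
  eigen : ∀ n, opKH k (x n) = ofReal0 (lam n) • x n
  orthonormal : ∀ i j, inner0 (x i) (x j) = if i = j then 1 else 0
  perp_le_ker : perp (range x) ≤ LinearMap.ker (opKH k)

theorem opKH_eigen_of_glue {x : KH μ m} {a : L0h μ} {N : Ω → ℕ}
    (hy : ∀ n, opKH k (y n) = ofReal0 (l n) • y n) (hx : ∀ᵐ ω ∂μ, fib x ω = fib (y (N ω)) ω)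
    (ha : ∀ᵐ ω ∂μ, a ω = l (N ω) ω) : opKH k x = ofReal0 a • x := by
  apply KH_ext
  filter_upwards [fib_opKH k x, fib_smul (ofReal0 a) x, ofReal0_apply a, hx, ha,
    ae_all_iff.2 fun i => fib_opKH k (y i), ae_all_iff.2 fun i => fib_smul (ofReal0 (l i)) (y i),
    ae_all_iff.2 fun i => ofReal0_apply (l i)] with ω hT hsmul hof hxω haω hTy hsmuly hofy
  rw [hT, hsmul, hof, hxω, haω, ← hTy, hy, hsmuly, hofy]

theorem IsEigenSequence.exists_isEigenBasis (hk : IsHermitianKernel k)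
    (hy : IsEigenSequence k e y l) (hinf : ∀ᵐ ω ∂μ, {n | norm0 (y n) ω ≠ 0}.Infinite) :
    ∃ (lam : ℕ → L0h μ) (x : ℕ → KH μ m), IsEigenBasis k lam x ∧
      perp (range x) ≤ perp (range y) := by
  obtain ⟨N, hN, hN_enum⟩ := exists_measurable_enumeration (p := fun ω n => norm0 (y n) ω ≠ 0)
    fun n => ((norm0 (y n)).measurable (measurableSet_singleton 0)).compl
  choose x hx using fun n => exists_glue (N n) (hN n) y
  choose lam hlam using fun n => exists_glue_L0h (N n) (hN n) l
  have hperp : perp (range x) ≤ perp (range y) := by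
    rintro f hf _ ⟨i, rfl⟩
    rw [inner0_eq_zero_iff]
    filter_upwards [ae_all_iff.2 hx, hinf, norm0_apply (y i),
      ae_all_iff.2 fun n => inner0_eq_zero_iff.1 (hf (x n) (mem_range_self n))]
      with ω hxω hinfω hnorm hfω
    by_cases hi : norm0 (y i) ω = 0
    · rw [hnorm, norm_eq_zero] at hi
      rw [hi, inner_zero_left]
    · obtain ⟨n, rfl⟩ : i ∈ range fun n => N n ω := (hN_enum ω hinfω).2 ▸ hi
      rw [← hxω, hfω]
  have horth (i j : ℕ) : inner0 (x i) (x j) = if i = j then 1 else 0 := by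
    apply AEEqFun.ext
    filter_upwards [inner0_apply (x i) (x j), ae_all_iff.2 hx, hinf, coeFn_ite (μ := μ) (i = j),
      ae_partialOrthonormal y hy.isPartialUnit hy.orthogonal,
      ae_all_iff.2 fun n => norm0_apply (y n)] with ω hinner hxω hinfω hite hort hnorm
    have hne : norm0 (y (N i ω)) ω ≠ 0 := by
      have hmem : N i ω ∈ {n | norm0 (y n) ω ≠ 0} := (hN_enum ω hinfω).2 ▸ mem_range_self i
      exact hmem
    rw [hnorm] at hne
    rw [hinner, hite, hxω, hxω]
    split_ifs with hij
    · rw [hij, inner_self_eq_norm_sq_to_K, (hort.norm_eq _).resolve_left (hij ▸ hne),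
        RCLike.ofReal_one, one_pow]
    · exact hort.inner_eq fun h => hij ((hN_enum ω hinfω).1 h).symm
  refine ⟨lam, x, ⟨fun n => opKH_eigen_of_glue hy.eigen (hx n) (hlam n), horth, fun f hf => ?_⟩,
    hperp⟩
  refine hy.eq_zero _ (opKH_mem_perp_nullPerp hk e f) ?_
  rintro _ ⟨i, rfl⟩
  exact inner0_opKH_of_eigen hk (hy.eigen i) (hperp hf _ (mem_range_self i))

theorem exists_isEigenBasis (hm : ¬ FiniteDimensional ℂ (Lp ℂ 2 m)) (hk : IsHermitianKernel k) :
    ∃ (lam : ℕ → L0h μ) (x : ℕ → KH μ m), IsEigenBasis k lam x ∧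
      (TopologicalSpace.SeparableSpace (Lp ℂ 2 m) → perp (range x) = ⊥) := by
  obtain ⟨v, hv, hdense⟩ := exists_seq_infiniteDimensional_span hm
  choose e he using fun j => exists_const_fib (μ := μ) (v j)
  obtain ⟨y, l, hy⟩ := exists_isEigenSequence hk (e := e) (C := fun j => ‖v j‖) fun j => by
    filter_upwards [he j] with ω hω
    rw [hω]
  obtain ⟨lam, x, hx, hperp⟩ := hy.exists_isEigenBasis hk (hy.ae_infinite he hv)
  refine ⟨lam, x, hx, fun hsep => eq_bot_iff.2 fun f hf => hy.eq_zero f (fun g hg => ?_) (hperp hf)⟩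
  have hg0 : g = 0 := by
    rw [eq_zero_iff_fib]
    filter_upwards [ae_all_iff.2 he,
      ae_all_iff.2 fun j => inner0_eq_zero_iff.1 (hg.1 (e j) (mem_range_self j))] with ω heω hgω
    exact (hdense hsep).eq_zero_of_inner_right ℂ fun j => by rw [← heω j]; exact hgω j
  rw [hg0, inner0_eq_zero_symm, inner0_zero_left]

end EigenBases

/-! ### Fibrewise diagonal operators -/

section FibrewiseDiagonal

variable {Ω S : Type*} [MeasurableSpace Ω] [MeasurableSpace S]
variable {μ : Measure Ω} {m : Measure S}

theorem chiLe_apply (l l' : L0h μ) : ∀ᵐ ω ∂μ, chiLe l l' ω = if l ω ≤ l' ω then 1 else 0 := by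
  filter_upwards [chi_apply (μ := μ) {ω | l ω ≤ l' ω}
    (measurableSet_le l.measurable l'.measurable)] with ω hω
  rw [chiLe, hω, indicator_apply]
  rfl

section SFinite

variable [SFinite m] {x : ℕ → KH μ m} {a b : ℕ → Ω → ℂ} {c d : Ω → ℂ} {u v w z : KH μ m}

/-- On almost every fibre, `w` is the image of `u` under the diagonal operator with eigenvectors
`x n`, eigenvalues `a n`, that is multiplication by `c` on the orthogonal complement of the
`x n`. -/
def IsFibDiag (x : ℕ → KH μ m) (a : ℕ → Ω → ℂ) (c : Ω → ℂ) (u w : KH μ m) : Prop :=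
  ∀ᵐ ω ∂μ, IsDiag ℂ (fun n => fib (x n) ω) (fun n => a n ω) (c ω) (fib u ω) (fib w ω)

theorem IsFibDiag.congr (hw : IsFibDiag x a c u w) (hab : ∀ᵐ ω ∂μ, ∀ n, a n ω = b n ω)
    (hcd : ∀ᵐ ω ∂μ, c ω = d ω) : IsFibDiag x b d u w := by
  filter_upwards [hw, hab, hcd] with ω hwω habω hcdω
  exact hwω.congr habω hcdω

theorem IsFibDiag.unique (hw : IsFibDiag x a c u w) (hz : IsFibDiag x a c u z) : w = z := by
  apply KH_ext
  filter_upwards [hw, hz] with ω hwω hzω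
  exact hwω.unique hzω

theorem IsFibDiag.add (hw : IsFibDiag x a c u w) (hz : IsFibDiag x a c v z) :
    IsFibDiag x a c (u + v) (w + z) := by
  filter_upwards [hw, hz, fib_add u v, fib_add w z] with ω hwω hzω huv hwz
  rw [huv, hwz]
  exact hwω.add hzω

theorem IsFibDiag.smul (r : L0 μ) (hw : IsFibDiag x a c u w) :
    IsFibDiag x a c (r • u) (r • w) := by
  filter_upwards [hw, fib_smul r u, fib_smul r w] with ω hwω hu hw
  rw [hu, hw]
  exact hwω.smul _

theorem ae_orthonormal_fib (hx : ∀ i j, inner0 (x i) (x j) = if i = j then 1 else 0) :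
    ∀ᵐ ω ∂μ, Orthonormal ℂ fun n => fib (x n) ω := by
  filter_upwards [ae_all_iff.2 fun i => ae_all_iff.2 fun j => inner0_apply (x i) (x j),
    ae_all_iff.2 fun i : ℕ => ae_all_iff.2 fun j : ℕ => coeFn_ite (μ := μ) (i = j)]
    with ω hinner hite
  rw [orthonormal_iff_ite]
  intro i j
  rw [← hinner, hx, hite]
  simp only [eq_comm]

theorem IsFibDiag.norm_fib_le (hx : ∀ i j, inner0 (x i) (x j) = if i = j then 1 else 0) {C : ℝ}
    (ha : ∀ᵐ ω ∂μ, ∀ n, ‖a n ω‖ ≤ C) (hc : ∀ᵐ ω ∂μ, ‖c ω‖ ≤ C) (hw : IsFibDiag x a c u w) :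
    ∀ᵐ ω ∂μ, ‖fib w ω‖ ≤ C * ‖fib u ω‖ := by
  filter_upwards [hw, ae_orthonormal_fib hx, ha, hc] with ω hwω hort haω hcω
  exact hwω.norm_le hort haω hcω

/-- The partial sums of the expansion of a diagonal operator on the module. -/
def diagSumKH (x : ℕ → KH μ m) (a : ℕ → L0 μ) (c : L0 μ) (u : KH μ m) (N : ℕ) : KH μ m :=
  (∑ n ∈ Finset.range N, a n • inner0 u (x n) • x n) +
    c • (u - ∑ n ∈ Finset.range N, inner0 u (x n) • x n)

theorem fib_diagSumKH (x : ℕ → KH μ m) (a : ℕ → L0 μ) (c : L0 μ) (u : KH μ m) :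
    ∀ᵐ ω ∂μ, ∀ N, fib (diagSumKH x a c u N) ω =
      diagSum (fun n => fib (x n) ω) (fun n => a n ω) (c ω) (fib u ω) N := by
  rw [ae_all_iff]
  intro N
  filter_upwards [fib_add (∑ n ∈ Finset.range N, a n • inner0 u (x n) • x n)
      (c • (u - ∑ n ∈ Finset.range N, inner0 u (x n) • x n)),
    fib_sum (Finset.range N) fun n => a n • inner0 u (x n) • x n,
    fib_smul c (u - ∑ n ∈ Finset.range N, inner0 u (x n) • x n),
    fib_sub_sum_inner0_smul (Finset.range N) u x,
    ae_all_iff.2 fun n => fib_smul (a n) (inner0 u (x n) • x n),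
    ae_all_iff.2 fun n => fib_smul (inner0 u (x n)) (x n),
    ae_all_iff.2 fun n => inner0_apply u (x n)] with ω hadd hsum hsmul hrest ha hinner hcoeff
  rw [diagSumKH, hadd, hsum, hsmul, hrest, diagSum]
  simp_rw [ha, hinner, hcoeff, smul_smul]

section Embedding

variable [SFinite μ]

theorem toKH_injective : Function.Injective (toKH : L22 μ m → KH μ m) := fun _ _ h =>
  Subtype.ext (congrArg (fun u : KH μ m => (u : Ω × S →ₘ[μ.prod m] ℂ)) h)

theorem toKH_add (f g : L22 μ m) : toKH (f + g) = toKH f + toKH g := rfl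

theorem fib_toKH_smul (r : ℂ) (f : L22 μ m) :
    ∀ᵐ ω ∂μ, fib (toKH (r • f)) ω = r • fib (toKH f) ω := by
  apply fib_congr (g := fun ω => r • fib (toKH f) ω)
  filter_upwards [Measure.ae_ae_of_ae_prod (Lp.coeFn_smul r f), coeFn_fib (toKH f)]
    with ω hsmul hfib
  filter_upwards [hsmul, hfib, Lp.coeFn_smul r (fib (toKH f) ω)] with s hs hfs hrs
  rw [hrs, Pi.smul_apply, hfs]
  exact hs

theorem IsFibDiag.toKH_add {f f' g g' : L22 μ m} (hg : IsFibDiag x a c (toKH f) (toKH g))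
    (hg' : IsFibDiag x a c (toKH f') (toKH g')) :
    IsFibDiag x a c (toKH (f + f')) (toKH (g + g')) := by
  rw [PartInt.toKH_add, PartInt.toKH_add]
  exact hg.add hg'

theorem IsFibDiag.toKH_smul {f g : L22 μ m} (r : ℂ) (hg : IsFibDiag x a c (toKH f) (toKH g)) :
    IsFibDiag x a c (toKH (r • f)) (toKH (r • g)) := by
  filter_upwards [hg, fib_toKH_smul r f, fib_toKH_smul r g] with ω hgω hrf hrg
  rw [hrf, hrg]
  exact hgω.smul r

end Embedding

end SFinite

section Finite

variable [IsFiniteMeasure μ] [IsFiniteMeasure m]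

theorem norm_le_of_fib_le {f g : L22 μ m} {C : ℝ} (hC : 0 ≤ C)
    (h : ∀ᵐ ω ∂μ, ‖fib (toKH f) ω‖ ≤ C * ‖fib (toKH g) ω‖) : ‖f‖ ≤ C * ‖g‖ := by
  have hnorm := norm22_le_of_fib_le hC h
  rw [norm22_toKH, norm22_toKH, ← ofReal_norm, ← ofReal_norm, ← ENNReal.ofReal_mul hC] at hnorm
  exact (ENNReal.ofReal_le_ofReal_iff (by positivity)).1 hnorm

theorem inner_L22 (f g : L22 μ m) :
    inner ℂ f g = ∫ ω, inner ℂ (fib (toKH f) ω) (fib (toKH g) ω) ∂μ := by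
  rw [L2.inner_def, integral_prod _ (L2.integrable_inner f g)]
  refine integral_congr_ae ?_
  filter_upwards [coeFn_fib (toKH f), coeFn_fib (toKH g)] with ω hf hg
  rw [L2.inner_def]
  refine integral_congr_ae ?_
  filter_upwards [hf, hg] with s hfs hgs
  rw [hfs, hgs]
  rfl

variable {x : ℕ → KH μ m} {a : ℕ → L0 μ} {c : L0 μ} {C : ℝ}

theorem exists_isFibDiag (hx : ∀ i j, inner0 (x i) (x j) = if i = j then 1 else 0) (c : L0 μ)
    (ha : ∀ᵐ ω ∂μ, ∃ B, ∀ n, ‖a n ω‖ ≤ B) (u : KH μ m) :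
    ∃ w : KH μ m, IsFibDiag x (fun n => a n) c u w := by
  have hlim : ∀ᵐ ω ∂μ, ∃ y,
      IsDiag ℂ (fun n => fib (x n) ω) (fun n => a n ω) (c ω) (fib u ω) y ∧
      Tendsto (fun N => fib (diagSumKH x a c u N) ω) atTop (𝓝 y) := by
    filter_upwards [fib_diagSumKH x a c u, ae_orthonormal_fib hx, ha] with ω hsum hort ⟨B, hB⟩
    simp_rw [hsum]
    exact exists_tendsto_diagSum hort hB (c ω) (fib u ω)
  obtain ⟨w, hw⟩ := exists_fib_limit (diagSumKH x a c u)
    (hlim.mono fun ω ⟨y, _, hy⟩ => ⟨y, hy⟩)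
  refine ⟨w, ?_⟩
  filter_upwards [hlim, hw] with ω ⟨y, hdiag, hy⟩ hwω
  rwa [tendsto_nhds_unique hwω hy]

theorem exists_diagKH (hx : ∀ i j, inner0 (x i) (x j) = if i = j then 1 else 0) (c : L0 μ)
    (ha : ∀ᵐ ω ∂μ, ∃ B, ∀ n, ‖a n ω‖ ≤ B) :
    ∃ D : KH μ m →ₗ[L0 μ] KH μ m, ∀ u, IsFibDiag x (fun n => a n) c u (D u) := by
  choose D hD using exists_isFibDiag hx c ha
  exact ⟨⟨⟨D, fun u v => (hD (u + v)).unique ((hD u).add (hD v))⟩,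
    fun r u => (hD (r • u)).unique ((hD u).smul r)⟩, hD⟩

theorem exists_diag22 (hx : ∀ i j, inner0 (x i) (x j) = if i = j then 1 else 0)
    (ha : ∀ᵐ ω ∂μ, ∀ n, ‖a n ω‖ ≤ C) (hc : ∀ᵐ ω ∂μ, ‖c ω‖ ≤ C) (hC : 0 ≤ C) :
    ∃ D : L22 μ m →L[ℂ] L22 μ m,
      ∀ f, IsFibDiag x (fun n => a n) c (toKH f) (toKH (D f)) := by
  have hexists (f : L22 μ m) :
      ∃ g : L22 μ m, IsFibDiag x (fun n => a n) c (toKH f) (toKH g) := by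
    obtain ⟨w, hw⟩ := exists_isFibDiag hx c (ha.mono fun ω haω => ⟨C, haω⟩) (toKH f)
    obtain ⟨g, rfl⟩ := exists_L22_of_fib_le hC f (hw.norm_fib_le hx ha hc)
    exact ⟨g, hw⟩
  choose D hD using hexists
  refine ⟨LinearMap.mkContinuous ⟨⟨D, fun f g => toKH_injective ?_⟩,
    fun r f => toKH_injective ?_⟩ C fun f => ?_, hD⟩
  · exact (hD (f + g)).unique ((hD f).toKH_add (hD g))
  · exact (hD (r • f)).unique ((hD f).toKH_smul r)
  · exact norm_le_of_fib_le hC ((hD f).norm_fib_le hx ha hc)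

theorem IsFibDiag.tendsto_norm22 (hx : ∀ i j, inner0 (x i) (x j) = if i = j then 1 else 0)
    (ha : ∀ᵐ ω ∂μ, ∀ n, ‖a n ω‖ ≤ C) (hc : ∀ᵐ ω ∂μ, ‖c ω‖ ≤ C) {f : L22 μ m} {w : KH μ m}
    (hw : IsFibDiag x (fun n => a n) c (toKH f) w) :
    Tendsto (fun N => norm22 (w - diagSumKH x a c (toKH f) N)) atTop (𝓝 0) := by
  refine tendsto_norm22_zero_of_le _ (C := C + C) f (fun N => ?_) ?_
  · filter_upwards [fib_sub w (diagSumKH x a c (toKH f) N), fib_diagSumKH x a c (toKH f),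
      hw.norm_fib_le hx ha hc, ae_orthonormal_fib hx, ha, hc] with ω hsub hsum hle hort haω hcω
    rw [hsub, hsum, add_mul]
    exact (norm_sub_le _ _).trans (add_le_add hle (norm_diagSum_le hort haω hcω _ _))
  · filter_upwards [ae_all_iff.2 fun N => fib_sub w (diagSumKH x a c (toKH f) N),
      fib_diagSumKH x a c (toKH f), hw, ae_orthonormal_fib hx, ha] with ω hsub hsum hwω hort haω
    simp_rw [hsub, hsum]
    simpa only [sub_self] using (hwω.tendsto hort haω).const_sub (fib w ω)

theorem isSelfAdjoint_of_isFibDiag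
    (hx : ∀ i j, inner0 (x i) (x j) = if i = j then 1 else 0) {a : ℕ → Ω → ℂ} {c : Ω → ℂ}
    (ha : ∀ᵐ ω ∂μ, ∀ n, ‖a n ω‖ ≤ C) (ha_conj : ∀ᵐ ω ∂μ, ∀ n, conj (a n ω) = a n ω)
    (hc_conj : ∀ᵐ ω ∂μ, conj (c ω) = c ω) {D : L22 μ m →L[ℂ] L22 μ m}
    (hD : ∀ f, IsFibDiag x a c (toKH f) (toKH (D f))) : IsSelfAdjoint D := by
  rw [ContinuousLinearMap.isSelfAdjoint_iff_isSymmetric]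
  intro f g
  change inner ℂ (D f) g = inner ℂ f (D g)
  rw [inner_L22, inner_L22]
  refine integral_congr_ae ?_
  filter_upwards [hD f, hD g, ha, ha_conj, hc_conj, ae_orthonormal_fib hx]
    with ω hf hg haω hacω hccω hort
  exact hg.inner_symm hort haω (hf.congr (fun n => (hacω n).symm) hccω.symm)

theorem isStarProjection_of_isFibDiag
    (hx : ∀ i j, inner0 (x i) (x j) = if i = j then 1 else 0) {a : ℕ → Ω → ℂ} {c : Ω → ℂ}
    (ha : ∀ᵐ ω ∂μ, ∀ n, a n ω = 0 ∨ a n ω = 1) (hc : ∀ᵐ ω ∂μ, c ω = 0 ∨ c ω = 1)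
    {D : L22 μ m →L[ℂ] L22 μ m} (hD : ∀ f, IsFibDiag x a c (toKH f) (toKH (D f))) :
    IsStarProjection D := by
  have hidem {z : ℂ} (hz : z = 0 ∨ z = 1) : z * z = z := by rcases hz with h | h <;> simp [h]
  have hconj {z : ℂ} (hz : z = 0 ∨ z = 1) : conj z = z := by rcases hz with h | h <;> simp [h]
  have hnorm {z : ℂ} (hz : z = 0 ∨ z = 1) : ‖z‖ ≤ 1 := by rcases hz with h | h <;> simp [h]
  refine ⟨?_, isSelfAdjoint_of_isFibDiag hx (ha.mono fun ω hω n => hnorm (hω n))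
    (ha.mono fun ω hω n => hconj (hω n)) (hc.mono fun ω hω => hconj hω) hD⟩
  refine ContinuousLinearMap.ext fun f => toKH_injective (KH_ext ?_)
  filter_upwards [hD f, hD (D f), ha, hc] with ω hf hDf haω hcω
  exact ((hf.comp hDf).congr (fun n => hidem (haω n)) (hidem hcω)).unique hf

theorem exists_spectralFamily (hx : ∀ i j, inner0 (x i) (x j) = if i = j then 1 else 0)
    (lam : ℕ → L0h μ) :
    ∃ E : L0h μ → L22 μ m →L[ℂ] L22 μ m, IsSpectralFamily lam x E ∧
      ∀ l f, IsFibDiag x (fun n ω => if lam n ω ≤ l ω then 1 else 0)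
        (fun ω => if 0 ≤ l ω then 1 else 0) (toKH f) (toKH (E l f)) := by
  have hcoeff (l : L0h μ) :
      ∀ᵐ ω ∂μ, ∀ n, chiLe (lam n) l ω = if lam n ω ≤ l ω then 1 else 0 :=
    ae_all_iff.2 fun n => chiLe_apply _ _
  have hperp (l : L0h μ) : ∀ᵐ ω ∂μ, chiLe 0 l ω = if 0 ≤ l ω then 1 else 0 := by
    filter_upwards [chiLe_apply 0 l, (AEEqFun.coeFn_zero : ⇑(0 : L0h μ) =ᵐ[μ] 0)] with ω hω hzero
    rw [hω, hzero, Pi.zero_apply]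
  have hnorm (p : Prop) [Decidable p] : ‖(if p then 1 else 0 : ℂ)‖ ≤ 1 := by split_ifs <;> simp
  have hcoeff_le (l : L0h μ) : ∀ᵐ ω ∂μ, ∀ n, ‖chiLe (lam n) l ω‖ ≤ 1 :=
    (hcoeff l).mono fun ω hω n => hω n ▸ hnorm _
  have hperp_le (l : L0h μ) : ∀ᵐ ω ∂μ, ‖chiLe 0 l ω‖ ≤ 1 :=
    (hperp l).mono fun ω hω => hω ▸ hnorm _
  choose E hE using fun l : L0h μ => exists_diag22 hx (hcoeff_le l) (hperp_le l) zero_le_one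
  have hdiag (l : L0h μ) (f : L22 μ m) := (hE l f).congr (hcoeff l) (hperp l)
  refine ⟨E, fun l => ⟨isStarProjection_of_isFibDiag hx ?_ ?_ (hdiag l), fun f =>
    (hE l f).tendsto_norm22 hx (hcoeff_le l) (hperp_le l)⟩, hdiag⟩
  · exact Eventually.of_forall fun ω n => (ite_eq_or_eq _ _ _).symm
  · exact Eventually.of_forall fun ω => (ite_eq_or_eq _ _ _).symm

theorem exists_fourier_projection (hx : ∀ i j, inner0 (x i) (x j) = if i = j then 1 else 0)
    (u : KH μ m) :
    ∃ P : KH μ m, IsFibDiag x (fun _ => (1 : L0 μ)) (0 : L0 μ) u P ∧ u - P ∈ perp (range x) := by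
  have hone : ∀ᵐ ω ∂μ, (1 : L0 μ) ω = 1 := AEEqFun.coeFn_one
  obtain ⟨P, hP⟩ := exists_isFibDiag hx (a := fun _ => 1) 0
    (hone.mono fun ω hω => ⟨1, fun _ => by rw [hω, norm_one]⟩) u
  refine ⟨P, hP, ?_⟩
  rintro _ ⟨n, rfl⟩
  rw [inner0_eq_zero_iff]
  filter_upwards [hP, fib_sub u P, hone] with ω hPω hsub hω
  rw [hsub, inner_sub_right, hPω.inner_eq, hω, one_mul, sub_self]

theorem isCompleteSystem_of_perp_eq_bot
    (hx : ∀ i j, inner0 (x i) (x j) = if i = j then 1 else 0) (hperp : perp (range x) = ⊥) :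
    IsCompleteSystem x := by
  intro f
  obtain ⟨P, hP, hmem⟩ := exists_fourier_projection hx (toKH f)
  obtain rfl : toKH f = P := by rwa [hperp, Submodule.mem_bot, sub_eq_zero] at hmem
  have hone : ∀ᵐ ω ∂μ, (1 : L0 μ) ω = 1 := AEEqFun.coeFn_one
  have hzero : ∀ᵐ ω ∂μ, (0 : L0 μ) ω = 0 := AEEqFun.coeFn_zero
  have hlim := hP.tendsto_norm22 hx (C := 1) (hone.mono fun ω hω _ => by rw [hω, norm_one])
    (hzero.mono fun ω hω => by rw [hω, norm_zero]; exact zero_le_one)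
  simpa only [fourierSum, diagSumKH, zero_smul, add_zero, one_smul] using hlim

end Finite

end FibrewiseDiagonal

section EigenBasis

variable {Ω S : Type*} [MeasurableSpace Ω] [MeasurableSpace S]
variable {μ : Measure Ω} {m : Measure S} [IsFiniteMeasure μ] [IsFiniteMeasure m]
variable {k : Kernel μ m} {lam : ℕ → L0h μ} {x : ℕ → KH μ m}

theorem IsEigenBasis.fibOp_eq (h : IsEigenBasis k lam x) :
    ∀ᵐ ω ∂μ, ∀ n, fibOp k ω (fib (x n) ω) = (lam n ω : ℂ) • fib (x n) ω := by
  rw [ae_all_iff]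
  intro n
  filter_upwards [fib_opKH k (x n), fib_smul (ofReal0 (lam n)) (x n), ofReal0_apply (lam n)]
    with ω hT hsmul hof
  rw [← hT, h.eigen, hsmul, hof]

theorem IsEigenBasis.sum_sq_le (h : IsEigenBasis k lam x) :
    ∀ᵐ ω ∂μ, ∀ s : Finset ℕ, ∑ n ∈ s, |lam n ω| ^ 2 ≤ rowBound m ‖k‖₊ ^ 2 * m.real univ := by
  filter_upwards [h.fibOp_eq, ae_orthonormal_fib h.orthonormal] with ω heig hort s
  have hsum := sum_sq_fibOp_le k ω (v := fun n => fib (x n) ω)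
    ⟨fun n => Or.inr (hort.1 n), fun _ _ hij => hort.2 hij⟩ s
  simpa only [heig, norm_smul, hort.1, mul_one, Complex.norm_real, Real.norm_eq_abs] using hsum

theorem IsEigenBasis.tendsto (h : IsEigenBasis k lam x) :
    ∀ᵐ ω ∂μ, Tendsto (fun n => lam n ω) atTop (𝓝 0) := by
  filter_upwards [h.sum_sq_le] with ω hω
  have hsq : Tendsto (fun n => √(|lam n ω| ^ 2)) atTop (𝓝 (√0)) :=
    (summable_of_sum_le (fun n => by positivity) hω).tendsto_atTop_zero.sqrt
  simp_rw [Real.sqrt_sq (abs_nonneg _), Real.sqrt_zero] at hsq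
  exact (tendsto_zero_iff_abs_tendsto_zero _).2 hsq

theorem IsEigenBasis.exists_bound (h : IsEigenBasis k lam x) :
    ∃ C : ℝ, 0 ≤ C ∧ ∀ᵐ ω ∂μ, ∀ n, |lam n ω| ≤ C := by
  refine ⟨√(rowBound m ‖k‖₊ ^ 2 * m.real univ), Real.sqrt_nonneg _, ?_⟩
  filter_upwards [h.sum_sq_le] with ω hω n
  exact Real.le_sqrt_of_sq_le (by simpa only [Finset.sum_singleton] using hω {n})

theorem IsEigenBasis.lam_nonneg (h : IsEigenBasis k lam x) (hpos : IsPosSemidefKernel k) :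
    ∀ᵐ ω ∂μ, ∀ n, 0 ≤ lam n ω := by
  filter_upwards [h.fibOp_eq, ae_orthonormal_fib h.orthonormal,
    ae_all_iff.2 fun n => inner_fibOp_nonneg hpos (x n)] with ω heig hort hnonneg n
  have hn := hnonneg n
  rw [heig, inner_smul_right, inner_self_eq_norm_sq_to_K, hort.1] at hn
  simpa using hn

theorem IsEigenBasis.isFibDiag_opKH (h : IsEigenBasis k lam x) (u : KH μ m) :
    IsFibDiag x (fun n ω => (lam n ω : ℂ)) 0 u (opKH k u) := by
  obtain ⟨C, -, hC⟩ := h.exists_bound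
  obtain ⟨P, hP, hmem⟩ := exists_fourier_projection h.orthonormal u
  have hTP : opKH k u = opKH k P := by
    rw [← sub_eq_zero, ← map_sub]
    exact h.perp_le_ker hmem
  filter_upwards [hP, (AEEqFun.coeFn_one : ⇑(1 : L0 μ) =ᵐ[μ] 1),
    (AEEqFun.coeFn_zero : ⇑(0 : L0 μ) =ᵐ[μ] 0), hC, h.fibOp_eq, fib_opKH k P,
    ae_orthonormal_fib h.orthonormal] with ω hPω hone hzero hCω heig hT hort
  simp only [hone, hzero, Pi.one_apply, Pi.zero_apply] at hPω
  obtain ⟨y, hy, hlim⟩ := exists_tendsto_diagSum hort (a := fun n => (lam n ω : ℂ)) (C := C)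
    (fun n => by rw [Complex.norm_real]; exact hCω n) 0 (fib u ω)
  have hTlim := ((fibOp k ω).continuous.tendsto _).comp
    (hPω.tendsto hort (C := 1) fun n => norm_one.le)
  rw [hTP, hT, tendsto_nhds_unique hTlim (hlim.congr fun N => ?_)]
  · exact hy
  · simp only [Function.comp_apply, diagSum, zero_smul, add_zero, map_sum, map_smul, heig,
      smul_smul, one_mul, mul_comm]

theorem IsEigenBasis.hasEigenExpansion (h : IsEigenBasis k lam x) :
    HasEigenExpansion k lam x := by
  intro f
  obtain ⟨C, hC, hle⟩ := h.exists_bound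
  have hof := ae_all_iff.2 fun n => ofReal0_apply (lam n)
  have hzero : ⇑(0 : L0 μ) =ᵐ[μ] 0 := AEEqFun.coeFn_zero
  have hdiag : IsFibDiag x (fun n => ofReal0 (lam n)) (0 : L0 μ) (toKH f) (opKH k (toKH f)) :=
    (h.isFibDiag_opKH (toKH f)).congr (hof.mono fun ω hω n => (hω n).symm) hzero.symm
  have hlim := hdiag.tendsto_norm22 h.orthonormal (C := C)
    (by filter_upwards [hle, hof] with ω hleω hofω n
        rw [hofω, Complex.norm_real]
        exact hleω n)
    (hzero.mono fun ω hω => by rw [hω, Pi.zero_apply, norm_zero]; exact hC)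
  simpa only [toKH_op22, diagSumKH, zero_smul, add_zero] using hlim

end EigenBasis

/-! ### Numerical range and functional calculus -/

section NumericalRange

variable {Ω S : Type*} [MeasurableSpace Ω] [MeasurableSpace S]
variable {μ : Measure Ω} {m : Measure S} [IsFiniteMeasure μ] [IsFiniteMeasure m]
variable {k : Kernel μ m} {lam : ℕ → L0h μ} {x : ℕ → KH μ m} {a b : L0h μ}

theorem mem_numericalRange_iff : a ∈ numericalRange k ↔ ∃ u : KH μ m, ∀ᵐ ω ∂μ,
    ‖fib u ω‖ = 1 ∧ inner ℂ (fib u ω) (fibOp k ω (fib u ω)) = (a ω : ℂ) := by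
  have hone : ⇑(1 : L0h μ) =ᵐ[μ] 1 := AEEqFun.coeFn_one
  refine exists_congr fun u => ⟨fun ⟨hu, ha⟩ => ?_, fun h => ⟨AEEqFun.ext ?_, AEEqFun.ext ?_⟩⟩
  · have hnorm := norm0_apply u
    have hinner := inner0_apply (opKH k u) u
    rw [hu] at hnorm
    rw [← ha] at hinner
    filter_upwards [hnorm, hinner, hone, ofReal0_apply a, fib_opKH k u]
      with ω hnorm hinner hone hof hT
    rw [← hnorm, hone, ← hT, ← hinner, hof]
    exact ⟨rfl, rfl⟩
  · filter_upwards [h, norm0_apply u, hone] with ω hω hnorm hone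
    rw [hnorm, hω.1, hone, Pi.one_apply]
  · filter_upwards [h, inner0_apply (opKH k u) u, ofReal0_apply a, fib_opKH k u]
      with ω hω hinner hof hT
    rw [hof, hinner, hT, hω.2]

theorem IsEigenBasis.lam_mem_numericalRange (h : IsEigenBasis k lam x) (n : ℕ) :
    lam n ∈ numericalRange k := by
  refine mem_numericalRange_iff.2 ⟨x n, ?_⟩
  filter_upwards [ae_orthonormal_fib h.orthonormal, h.fibOp_eq] with ω hort heig
  refine ⟨hort.1 n, ?_⟩
  rw [heig, inner_smul_right, inner_self_eq_norm_sq_to_K, hort.1, RCLike.ofReal_one, one_pow,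
    mul_one]

theorem IsEigenBasis.isGLB_numericalRange (h : IsEigenBasis k lam x)
    (hpos : IsPosSemidefKernel k) : IsGLB (numericalRange k) 0 := by
  have hzero : ⇑(0 : L0h μ) =ᵐ[μ] 0 := AEEqFun.coeFn_zero
  refine ⟨fun a ha => AEEqFun.coeFn_le.1 ?_, fun c hc => AEEqFun.coeFn_le.1 ?_⟩
  · obtain ⟨u, hu⟩ := mem_numericalRange_iff.1 ha
    filter_upwards [hu, inner_fibOp_nonneg hpos u, hzero] with ω ⟨_, huω⟩ hnonneg hzero
    rw [huω] at hnonneg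
    rw [hzero]
    exact_mod_cast hnonneg
  · filter_upwards [h.tendsto, ae_all_iff.2 fun n =>
      AEEqFun.coeFn_le.2 (hc (h.lam_mem_numericalRange n)), hzero] with ω hlim hle hzero
    rw [hzero]
    exact ge_of_tendsto' hlim hle

theorem IsEigenBasis.exists_ae_isLUB (h : IsEigenBasis k lam x) :
    ∃ b : L0h μ, ∀ᵐ ω ∂μ, IsLUB (range fun n => lam n ω) (b ω) := by
  obtain ⟨C, -, hC⟩ := h.exists_bound
  have hmeas : Measurable fun ω => ⨆ n, lam n ω := Measurable.iSup fun n => (lam n).measurable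
  refine ⟨AEEqFun.mk _ hmeas.aestronglyMeasurable, ?_⟩
  filter_upwards [AEEqFun.coeFn_mk _ hmeas.aestronglyMeasurable, hC] with ω hmk hCω
  rw [hmk]
  exact isLUB_ciSup ⟨C, forall_mem_range.2 fun n => (le_abs_self _).trans (hCω n)⟩

theorem IsEigenBasis.mem_upperBounds_numericalRange (h : IsEigenBasis k lam x)
    (hpos : IsPosSemidefKernel k) (hb : ∀ᵐ ω ∂μ, ∀ n, lam n ω ≤ b ω) :
    b ∈ upperBounds (numericalRange k) := by
  intro a ha
  obtain ⟨u, hu⟩ := mem_numericalRange_iff.1 ha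
  rw [← AEEqFun.coeFn_le]
  filter_upwards [hu, hb, h.lam_nonneg hpos, h.isFibDiag_opKH u, fib_opKH k u,
    ae_orthonormal_fib h.orthonormal] with ω ⟨hnorm, hinner⟩ hbω hnonneg hdiag hT hort
  have hbound : ‖fibOp k ω (fib u ω)‖ ≤ b ω * ‖fib u ω‖ := by
    rw [← hT]
    refine hdiag.norm_le hort (fun n => ?_) ?_
    · rw [Complex.norm_real, Real.norm_of_nonneg (hnonneg n)]
      exact hbω n
    · rw [Pi.zero_apply, norm_zero]
      exact (hnonneg 0).trans (hbω 0)
  calc a ω ≤ ‖(a ω : ℂ)‖ := (le_abs_self _).trans_eq (Complex.norm_real _).symm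
    _ ≤ ‖fib u ω‖ * ‖fibOp k ω (fib u ω)‖ := hinner ▸ norm_inner_le_norm _ _
    _ ≤ b ω := by simpa only [hnorm, one_mul, mul_one] using hbound

theorem IsEigenBasis.isLUB_numericalRange (h : IsEigenBasis k lam x)
    (hpos : IsPosSemidefKernel k) (hb : ∀ᵐ ω ∂μ, IsLUB (range fun n => lam n ω) (b ω)) :
    IsLUB (numericalRange k) b := by
  refine ⟨h.mem_upperBounds_numericalRange hpos
    (hb.mono fun ω hω n => hω.1 (mem_range_self n)), fun c hc => ?_⟩
  rw [← AEEqFun.coeFn_le]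
  filter_upwards [hb, ae_all_iff.2 fun n =>
    AEEqFun.coeFn_le.2 (hc (h.lam_mem_numericalRange n))] with ω hω hle
  exact hω.2 (forall_mem_range.2 hle)

end NumericalRange

section FunctionalCalculus

theorem exists_complex_polynomial_near {F : ℝ → ℂ} {α β η : ℝ} (hF : ContinuousOn F (Icc α β))
    (hη : 0 < η) : ∃ P : Polynomial ℂ, ∀ t ∈ Icc α β, ‖F t - P.eval (t : ℂ)‖ ≤ η := by
  obtain ⟨p, hp⟩ := exists_polynomial_near_of_continuousOn α β (fun t => (F t).re)
    (Complex.continuous_re.comp_continuousOn hF) (η / 2) (half_pos hη)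
  obtain ⟨q, hq⟩ := exists_polynomial_near_of_continuousOn α β (fun t => (F t).im)
    (Complex.continuous_im.comp_continuousOn hF) (η / 2) (half_pos hη)
  refine ⟨p.map Complex.ofRealHom + Polynomial.C Complex.I * q.map Complex.ofRealHom,
    fun t ht => ?_⟩
  have heval (r : Polynomial ℝ) :
      (r.map Complex.ofRealHom).eval (t : ℂ) = ((r.eval t : ℝ) : ℂ) :=
    Polynomial.eval_map_apply (f := Complex.ofRealHom) t
  rw [Polynomial.eval_add, Polynomial.eval_mul, Polynomial.eval_C, heval, heval]
  refine (Complex.norm_le_abs_re_add_abs_im _).trans ?_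
  have hre : |(F t).re - p.eval t| < η / 2 := abs_sub_comm (p.eval t) _ ▸ hp t ht
  have him : |(F t).im - q.eval t| < η / 2 := abs_sub_comm (q.eval t) _ ▸ hq t ht
  simpa using (add_lt_add hre him).le

variable {Ω S : Type*} [MeasurableSpace Ω] [MeasurableSpace S]
variable {μ : Measure Ω} {m : Measure S}

section SFinite

variable [SFinite μ] [SFinite m] {x : ℕ → KH μ m} {a : ℕ → Ω → ℂ} {c : Ω → ℂ}
  {A : L22 μ m →L[ℂ] L22 μ m}

theorem isFibDiag_pow (hA : ∀ f, IsFibDiag x a c (toKH f) (toKH (A f))) (j : ℕ) (g : L22 μ m) :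
    IsFibDiag x (fun n ω => a n ω ^ j) (fun ω => c ω ^ j) (toKH g) (toKH ((A ^ j) g)) := by
  induction j with
  | zero =>
    refine Eventually.of_forall fun ω => ?_
    have hself := isDiag_self (𝕜 := ℂ) (v := fun n => fib (x n) ω) (h := fib (toKH g) ω) 1
    rw [one_smul] at hself
    exact hself.congr (fun n => (pow_zero _).symm) (pow_zero _).symm
  | succ j ih =>
    filter_upwards [ih, hA ((A ^ j) g)] with ω hpow hstep
    rw [pow_succ' A]
    exact (hpow.comp hstep).congr (fun n => (pow_succ' _ _).symm) (pow_succ' _ _).symm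

theorem isFibDiag_aeval (hA : ∀ f, IsFibDiag x a c (toKH f) (toKH (A f))) (P : Polynomial ℂ)
    (g : L22 μ m) :
    IsFibDiag x (fun n ω => P.eval (a n ω)) (fun ω => P.eval (c ω)) (toKH g)
      (toKH (Polynomial.aeval A P g)) := by
  induction P using Polynomial.induction_on' with
  | add p q hp hq =>
    filter_upwards [hp, hq, fib_add (toKH (Polynomial.aeval A p g))
      (toKH (Polynomial.aeval A q g))] with ω hpω hqω hadd
    rw [map_add, add_apply, toKH_add, hadd]
    exact (hpω.add_coeff hqω).congr (fun n => Polynomial.eval_add.symm) Polynomial.eval_add.symm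
  | monomial j z =>
    filter_upwards [isFibDiag_pow hA j g, fib_toKH_smul z ((A ^ j) g)] with ω hpow hsmul
    rw [Polynomial.aeval_monomial, Algebra.algebraMap_eq_smul_one, smul_one_mul,
      smul_apply, hsmul]
    exact (hpow.smul_coeff z).congr (fun n => Polynomial.eval_monomial.symm)
      Polynomial.eval_monomial.symm

end SFinite

section Coefficients

variable [IsFiniteMeasure μ] [IsFiniteMeasure m] {x : ℕ → KH μ m} {a b : ℕ → Ω → ℂ}
  {c d : Ω → ℂ} {A B : L22 μ m →L[ℂ] L22 μ m}

theorem mul_eq_one_of_isFibDiag (hA : ∀ f, IsFibDiag x a c (toKH f) (toKH (A f)))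
    (hB : ∀ f, IsFibDiag x b d (toKH f) (toKH (B f))) (hab : ∀ᵐ ω ∂μ, ∀ n, b n ω * a n ω = 1)
    (hcd : ∀ᵐ ω ∂μ, d ω * c ω = 1) : B * A = 1 := by
  refine ContinuousLinearMap.ext fun f => toKH_injective (KH_ext ?_)
  filter_upwards [hA f, hB (A f), hab, hcd] with ω hAω hBω habω hcdω
  refine ((hAω.comp hBω).congr habω hcdω).unique ?_
  simpa only [one_smul, one_apply_eq_self] using isDiag_self (𝕜 := ℂ) (v := fun n => fib (x n) ω) 1

theorem opNorm_sub_le_of_isFibDiag (hx : ∀ i j, inner0 (x i) (x j) = if i = j then 1 else 0)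
    {C : ℝ} (hC : 0 ≤ C) (hA : ∀ f, IsFibDiag x a c (toKH f) (toKH (A f)))
    (hB : ∀ f, IsFibDiag x b d (toKH f) (toKH (B f)))
    (hab : ∀ᵐ ω ∂μ, ∀ n, ‖a n ω - b n ω‖ ≤ C) (hcd : ∀ᵐ ω ∂μ, ‖c ω - d ω‖ ≤ C) :
    ‖A - B‖ ≤ C := by
  refine ContinuousLinearMap.opNorm_le_bound _ hC fun f => norm_le_of_fib_le hC ?_
  filter_upwards [hA f, hB f, hab, hcd, ae_orthonormal_fib hx,
    fib_sub (toKH (A f)) (toKH (B f))] with ω hAω hBω habω hcdω hort hsub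
  rw [sub_apply, toKH_sub, hsub]
  exact (hAω.sub_coeff hBω).norm_le hort habω hcdω

end Coefficients

variable [IsFiniteMeasure μ] [IsFiniteMeasure m] {x : ℕ → KH μ m} {K : Set ℂ} {a : ℕ → L0 μ}
  {c : L0 μ} {A : L22 μ m →L[ℂ] L22 μ m}

theorem exists_diag22_comp (hx : ∀ i j, inner0 (x i) (x j) = if i = j then 1 else 0)
    (ha : ∀ᵐ ω ∂μ, ∀ n, a n ω ∈ K) (hc : ∀ᵐ ω ∂μ, c ω ∈ K) {φ : ℂ → ℂ} (hφ : Measurable φ)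
    {C : ℝ} (hC : 0 ≤ C) (hφ_le : ∀ z ∈ K, ‖φ z‖ ≤ C) :
    ∃ D : L22 μ m →L[ℂ] L22 μ m, ∀ f,
      IsFibDiag x (fun n ω => φ (a n ω)) (fun ω => φ (c ω)) (toKH f) (toKH (D f)) := by
  have ha_comp := ae_all_iff.2 fun n => AEEqFun.coeFn_compMeasurable φ hφ (a n)
  have hc_comp := AEEqFun.coeFn_compMeasurable φ hφ c
  obtain ⟨D, hD⟩ := exists_diag22 hx (a := fun n => AEEqFun.compMeasurable φ hφ (a n))
    (c := AEEqFun.compMeasurable φ hφ c)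
    (by filter_upwards [ha, ha_comp] with ω haω hcomp n
        rw [hcomp]
        exact hφ_le _ (haω n))
    (by filter_upwards [hc, hc_comp] with ω hcω hcomp
        rw [hcomp]
        exact hφ_le _ hcω) hC
  exact ⟨D, fun f => (hD f).congr ha_comp hc_comp⟩

theorem spectrum_subset_of_isFibDiag
    (hx : ∀ i j, inner0 (x i) (x j) = if i = j then 1 else 0) (hK : IsClosed K)
    (ha : ∀ᵐ ω ∂μ, ∀ n, a n ω ∈ K) (hc : ∀ᵐ ω ∂μ, c ω ∈ K)
    (hA : ∀ f, IsFibDiag x (fun n => a n) c (toKH f) (toKH (A f))) : spectrum ℂ A ⊆ K := by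
  refine fun z => Function.mtr fun hz hmem => hmem ?_
  obtain ⟨r, hr, hball⟩ := Metric.isOpen_iff.1 hK.isOpen_compl z hz
  have hdist {w : ℂ} (hw : w ∈ K) : r ≤ ‖z - w‖ := by
    rw [← dist_eq_norm, dist_comm]
    exact not_lt.1 fun hlt => hball hlt hw
  have hne {w : ℂ} (hw : w ∈ K) : z - w ≠ 0 := norm_pos_iff.1 (hr.trans_le (hdist hw))
  obtain ⟨R, hR⟩ := exists_diag22_comp hx ha hc (φ := fun w => (z - w)⁻¹)
    (measurable_const.sub measurable_id).inv (inv_nonneg.2 hr.le) fun w hw =>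
      (norm_inv _).trans_le (inv_anti₀ hr (hdist hw))
  have hzA (f : L22 μ m) : IsFibDiag x (fun n ω => z - a n ω) (fun ω => z - c ω) (toKH f)
      (toKH ((algebraMap ℂ _ z - A) f)) := by
    have haeval := isFibDiag_aeval hA (Polynomial.C z - Polynomial.X) f
    rw [map_sub, Polynomial.aeval_C, Polynomial.aeval_X] at haeval
    exact haeval.congr (Eventually.of_forall fun ω n => by simp)
      (Eventually.of_forall fun ω => by simp)
  refine isUnit_iff_exists.2 ⟨R, mul_eq_one_of_isFibDiag hR hzA ?_ ?_,
    mul_eq_one_of_isFibDiag hzA hR ?_ ?_⟩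
  · exact ha.mono fun ω hω n => mul_inv_cancel₀ (hne (hω n))
  · exact hc.mono fun ω hω => mul_inv_cancel₀ (hne hω)
  · exact ha.mono fun ω hω n => inv_mul_cancel₀ (hne (hω n))
  · exact hc.mono fun ω hω => inv_mul_cancel₀ (hne hω)

theorem isSelfAdjoint_of_isFibDiag_ofReal
    (hx : ∀ i j, inner0 (x i) (x j) = if i = j then 1 else 0) {α β : ℝ}
    (ha : ∀ᵐ ω ∂μ, ∀ n, a n ω ∈ Complex.ofReal '' Icc α β)
    (hc : ∀ᵐ ω ∂μ, c ω ∈ Complex.ofReal '' Icc α β)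
    (hA : ∀ f, IsFibDiag x (fun n => a n) c (toKH f) (toKH (A f))) : IsSelfAdjoint A := by
  obtain ⟨B, hB⟩ := (isCompact_Icc.image Complex.continuous_ofReal).isBounded.exists_norm_le
  have hconj {z : ℂ} (hz : z ∈ Complex.ofReal '' Icc α β) : conj z = z := by
    obtain ⟨t, -, rfl⟩ := hz
    exact Complex.conj_ofReal t
  exact isSelfAdjoint_of_isFibDiag hx (ha.mono fun ω hω n => hB _ (hω n))
    (ha.mono fun ω hω n => hconj (hω n)) (hc.mono fun ω hω => hconj hω) hA

theorem isFibDiag_cfc (hx : ∀ i j, inner0 (x i) (x j) = if i = j then 1 else 0) {α β : ℝ}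
    (ha : ∀ᵐ ω ∂μ, ∀ n, a n ω ∈ Complex.ofReal '' Icc α β)
    (hc : ∀ᵐ ω ∂μ, c ω ∈ Complex.ofReal '' Icc α β)
    (hA : ∀ f, IsFibDiag x (fun n => a n) c (toKH f) (toKH (A f))) {F : ℝ → ℂ}
    (hF : Continuous F) (g : L22 μ m) :
    IsFibDiag x (fun n ω => F (a n ω).re) (fun ω => F (c ω).re) (toKH g)
      (toKH (cfc (fun z : ℂ => F z.re) A g)) := by
  have hK : IsCompact (Complex.ofReal '' Icc α β) :=
    isCompact_Icc.image Complex.continuous_ofReal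
  have hFre : Continuous fun z : ℂ => F z.re := hF.comp Complex.continuous_re
  obtain ⟨C, hC⟩ := hK.exists_bound_of_continuousOn hFre.continuousOn
  have hself := isSelfAdjoint_of_isFibDiag_ofReal hx ha hc hA
  obtain ⟨D, hD⟩ := exists_diag22_comp hx ha hc hFre.measurable (le_max_right C 0) fun z hz =>
    (hC z hz).trans (le_max_left C 0)
  suffices cfc (fun z : ℂ => F z.re) A = D from this ▸ hD g
  refine eq_of_forall_dist_le fun η hη => ?_
  obtain ⟨P, hP⟩ := exists_complex_polynomial_near (hF.continuousOn (s := Icc α β)) (half_pos hη)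
  have hFP {z : ℂ} (hz : z ∈ Complex.ofReal '' Icc α β) : ‖F z.re - P.eval z‖ ≤ η / 2 := by
    obtain ⟨t, ht, rfl⟩ := hz
    exact hP t ht
  have hcfc : ‖cfc (fun z : ℂ => F z.re) A - Polynomial.aeval A P‖ ≤ η / 2 := by
    rw [← cfc_polynomial P A hself.isStarNormal,
      ← cfc_sub _ _ _ hFre.continuousOn P.continuous.continuousOn]
    exact norm_cfc_le (half_pos hη).le fun z hz =>
      hFP (spectrum_subset_of_isFibDiag hx hK.isClosed ha hc hA hz)
  have hdiag : ‖D - Polynomial.aeval A P‖ ≤ η / 2 :=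
    opNorm_sub_le_of_isFibDiag hx (half_pos hη).le hD (isFibDiag_aeval hA P)
      (ha.mono fun ω hω n => hFP (hω n)) (hc.mono fun ω hω => hFP hω)
  rw [dist_eq_norm]
  calc _ ≤ _ := norm_sub_le_norm_sub_add_norm_sub _ (Polynomial.aeval A P) _
    _ ≤ η / 2 + η / 2 := add_le_add hcfc (norm_sub_rev D _ ▸ hdiag)
    _ = η := add_halves η

end FunctionalCalculus

/-! ### Spectral integrals -/

section StepFunctions

/-- The Riemann-Stieltjes sum of `f` with respect to the step function `r ↦ 1_{t ≤ r}`, whose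
Stieltjes measure is the Dirac mass at `t`. -/
def stepSum (f : ℝ → ℂ) (n : ℕ) (p ξ : ℕ → ℝ) (t : ℝ) : ℂ :=
  f (p 0) * (if t ≤ p 0 then 1 else 0) +
    ∑ i ∈ Finset.range n, f (ξ i) * ((if t ≤ p (i + 1) then 1 else 0) - if t ≤ p i then 1 else 0)

variable {f : ℝ → ℂ} {n : ℕ} {p ξ : ℕ → ℝ} {t δ : ℝ}

theorem stepSum_succ : stepSum f (n + 1) p ξ t = stepSum f n p ξ t +
    f (ξ n) * ((if t ≤ p (n + 1) then 1 else 0) - if t ≤ p n then 1 else 0) := by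
  rw [stepSum, stepSum, Finset.sum_range_succ, add_assoc]

theorem le_of_forall_step (hp : ∀ i < n, p i ≤ p (i + 1)) {i j : ℕ} (hij : i ≤ j) (hj : j ≤ n) :
    p i ≤ p j := by
  induction j, hij using Nat.le_induction with
  | base => exact le_rfl
  | succ j _ ih => exact (ih (by lia)).trans (hp j (by lia))

theorem stepSum_eq_zero (hp : ∀ i < n, p i ≤ p (i + 1)) (ht : p n < t) :
    stepSum f n p ξ t = 0 := by
  have hlt {i : ℕ} (hi : i ≤ n) : ¬ t ≤ p i :=
    not_le.2 ((le_of_forall_step hp hi le_rfl).trans_lt ht)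
  rw [stepSum, if_neg (hlt (Nat.zero_le n)), mul_zero, zero_add]
  refine Finset.sum_eq_zero fun i hi => ?_
  have hi := Finset.mem_range.1 hi
  rw [if_neg (hlt hi), if_neg (hlt hi.le), sub_zero, mul_zero]

theorem exists_stepSum_eq (hδ : 0 ≤ δ)
    (hp : ∀ i < n, p i ≤ ξ i ∧ ξ i ≤ p (i + 1) ∧ p (i + 1) ≤ p i + δ) (ht₀ : p 0 ≤ t)
    (ht : t ≤ p n) : ∃ s ∈ Icc (p 0) (p n), |s - t| ≤ δ ∧ stepSum f n p ξ t = f s := by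
  induction n with
  | zero =>
    obtain rfl : t = p 0 := le_antisymm ht ht₀
    exact ⟨p 0, by simp, by simpa using hδ, by simp [stepSum]⟩
  | succ n ih =>
    obtain ⟨hξ, hξ', hmesh⟩ := hp n n.lt_succ_self
    have hp' := fun i (hi : i < n) => hp i (hi.trans n.lt_succ_self)
    have hmono : ∀ i < n, p i ≤ p (i + 1) := fun i hi => (hp' i hi).1.trans (hp' i hi).2.1
    rw [stepSum_succ, if_pos ht]
    rcases le_or_gt t (p n) with htn | htn
    · obtain ⟨s, hs, hst, heq⟩ := ih hp' htn
      refine ⟨s, ⟨hs.1, hs.2.trans (hξ.trans hξ')⟩, hst, ?_⟩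
      rw [if_pos htn, sub_self, mul_zero, add_zero, heq]
    · refine ⟨ξ n, ⟨(le_of_forall_step hmono n.zero_le le_rfl).trans hξ, hξ'⟩,
        abs_sub_le_iff.2 ⟨by linarith, by linarith⟩, ?_⟩
      rw [stepSum_eq_zero hmono htn, if_neg htn.not_ge, zero_add, sub_zero, mul_one]

theorem norm_stepSum_sub_le {η : ℝ} (hδ : 0 ≤ δ)
    (hp : ∀ i < n, p i ≤ ξ i ∧ ξ i ≤ p (i + 1) ∧ p (i + 1) ≤ p i + δ) (ht : t ∈ Icc (p 0) (p n))
    (hf : ∀ s, p 0 ≤ s → |s - t| ≤ δ → ‖f s - f t‖ ≤ η) : ‖stepSum f n p ξ t - f t‖ ≤ η := by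
  obtain ⟨s, hs, hst, heq⟩ := exists_stepSum_eq (f := f) hδ hp ht.1 ht.2
  rw [heq]
  exact hf s hs.1 hst

end StepFunctions

section SpectralIntegrals

variable {Ω S : Type*} [MeasurableSpace Ω] [MeasurableSpace S]
variable {μ : Measure Ω} {m : Measure S}

theorem IsTaggedPartition.ae {a b : L0h μ} {δ : ℝ} {n : ℕ} {p ξ : ℕ → L0h μ}
    (h : IsTaggedPartition a b δ n p ξ) : ∀ᵐ ω ∂μ, p 0 ω = a ω ∧ p n ω = b ω ∧
      ∀ i < n, p i ω ≤ ξ i ω ∧ ξ i ω ≤ p (i + 1) ω ∧ p (i + 1) ω ≤ p i ω + δ := by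
  obtain ⟨hleft, hright, hstep⟩ := h
  have hae : ∀ᵐ ω ∂μ, ∀ i, i < n → p i ω ≤ ξ i ω ∧ ξ i ω ≤ p (i + 1) ω ∧
      p (i + 1) ω ≤ p i ω + δ := by
    refine ae_all_iff.2 fun i => ae_all_iff.2 fun hi => ?_
    obtain ⟨hξ, hξ', hmesh⟩ := hstep i hi
    filter_upwards [AEEqFun.coeFn_le.2 hξ, AEEqFun.coeFn_le.2 hξ', AEEqFun.coeFn_le.2 hmesh,
      AEEqFun.coeFn_add (p i) (AEEqFun.const Ω δ), AEEqFun.coeFn_const (μ := μ) Ω δ]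
      with ω hξω hξω' hmeshω hadd hconst
    rw [hadd, Pi.add_apply, hconst] at hmeshω
    exact ⟨hξω, hξω', hmeshω⟩
  filter_upwards [hae] with ω hω
  exact ⟨by rw [hleft], by rw [hright], hω⟩

-- Stieltjes sums of an arbitrary `f` need not be measurable, so Tonelli's theorem is not available.
theorem lintegral_prod_le [SFinite m] (F : Ω × S → ℝ≥0∞) :
    ∫⁻ z, F z ∂μ.prod m ≤ ∫⁻ ω, ∫⁻ s, F (ω, s) ∂m ∂μ := by
  obtain ⟨G, hG, hGF, heq⟩ := exists_measurable_le_lintegral_eq (μ.prod m) F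
  rw [heq, lintegral_prod _ hG.aemeasurable]
  exact lintegral_mono fun ω => lintegral_mono fun s => hGF (ω, s)

theorem exists_Icc_continuousOn (hμ : μ ≠ 0) {f : ℝ → ℂ} {b : Ω → ℝ} {α C ε : ℝ}
    (hb : ∀ᵐ ω ∂μ, b ω ∈ Icc α C) (hε : 0 < ε)
    (hf : ∀ᵐ ω ∂μ, ContinuousOn f (Icc α (b ω + ε))) :
    ∃ β, α ≤ β ∧ (∀ᵐ ω ∂μ, b ω ≤ β) ∧ ContinuousOn f (Icc α (β + ε / 2)) := by
  have : (ae μ).NeBot := ae_neBot.2 hμ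
  have hle : ∀ᵐ ω ∂μ, b ω ≤ essSup b μ := ae_le_essSup ⟨C, hb.mono fun ω hω => hω.2⟩
  have hcobdd : (ae μ).IsCoboundedUnder (· ≤ ·) b :=
    IsBoundedUnder.isCoboundedUnder_le ⟨α, hb.mono fun ω hω => hω.1⟩
  have hlt : ∃ᵐ ω ∂μ, essSup b μ - ε / 2 < b ω :=
    frequently_lt_of_lt_limsup hcobdd (sub_lt_self _ (half_pos hε))
  obtain ⟨ω, hω, hbω, hleω, hfω⟩ := (hlt.and_eventually (hb.and (hle.and hf))).exists
  exact ⟨essSup b μ, hbω.1.trans hleω, hle, hfω.mono (Icc_subset_Icc_right (by linarith))⟩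

section SFinite

variable [SFinite μ] [SFinite m]

theorem eLpNorm_le_of_fib_le {G : Ω × S → ℂ} {g : L22 μ m} {C : ℝ} (hC : 0 ≤ C)
    (hG : ∀ᵐ ω ∂μ, eLpNorm (fun s => G (ω, s)) 2 m ≤ ENNReal.ofReal (C * ‖fib (toKH g) ω‖)) :
    eLpNorm G 2 (μ.prod m) ≤ ENNReal.ofReal (C * ‖g‖) := by
  rw [ENNReal.ofReal_mul hC, ofReal_norm, ← norm22_toKH,
    ← ENNReal.pow_le_pow_left_iff (n := 2) (by norm_num), mul_pow, norm22_sq, eLpNorm_two_sq,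
    ← lintegral_const_mul'' _ ((aemeasurable_enorm_fib (toKH g)).pow_const 2)]
  refine (lintegral_prod_le _).trans (lintegral_mono_ae ?_)
  filter_upwards [hG] with ω hω
  rw [← eLpNorm_two_sq m fun s => G (ω, s), ← mul_pow, ← ofReal_norm, ← ENNReal.ofReal_mul hC]
  gcongr

theorem stieltjesSum_section (f : ℝ → ℂ) (E : L0h μ → L22 μ m →L[ℂ] L22 μ m) (n : ℕ)
    (p ξ : ℕ → L0h μ) (g : L22 μ m) : ∀ᵐ ω ∂μ, (fun s => stieltjesSum f E n p ξ g (ω, s)) =ᵐ[m]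
      (f (p 0 ω) • fib (toKH (E (p 0) g)) ω + ∑ i ∈ Finset.range n, f (ξ i ω) •
        (fib (toKH (E (p (i + 1)) g)) ω - fib (toKH (E (p i) g)) ω) : Lp ℂ 2 m) := by
  filter_upwards [coeFn_fib (toKH (E (p 0) g)),
    ae_all_iff.2 fun i => coeFn_fib (toKH (E (p (i + 1)) g - E (p i) g)),
    ae_all_iff.2 fun i => fib_sub (toKH (E (p (i + 1)) g)) (toKH (E (p i) g))]
    with ω hleft hdiff hsub
  simp_rw [← hsub, ← toKH_sub]
  filter_upwards [hleft, ae_all_iff.2 hdiff,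
    Lp.coeFn_add (f (p 0 ω) • fib (toKH (E (p 0) g)) ω) (∑ i ∈ Finset.range n,
      f (ξ i ω) • fib (toKH (E (p (i + 1)) g - E (p i) g)) ω),
    Lp.coeFn_smul (f (p 0 ω)) (fib (toKH (E (p 0) g)) ω),
    Lp.coeFn_finsetSum (Finset.range n)
      fun i => f (ξ i ω) • fib (toKH (E (p (i + 1)) g - E (p i) g)) ω,
    ae_all_iff.2 fun i =>
      Lp.coeFn_smul (f (ξ i ω)) (fib (toKH (E (p (i + 1)) g - E (p i) g)) ω)]
    with s hleft hdiff hadd hsmul hsum hsmul'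
  rw [hadd, Pi.add_apply, hsmul, hsum, Finset.sum_apply, Pi.smul_apply, hleft]
  simp_rw [hsmul', Pi.smul_apply, hdiff]
  rfl

variable {x : ℕ → KH μ m} {lam : ℕ → L0h μ}
variable {a b : L0h μ} {f : ℝ → ℂ} {E : L0h μ → L22 μ m →L[ℂ] L22 μ m} {D : L22 μ m →L[ℂ] L22 μ m}

theorem isDiag_stieltjesSum (f : ℝ → ℂ) (n : ℕ) (p ξ : ℕ → L0h μ) {g : L22 μ m}
    (hE : ∀ l, IsFibDiag x (fun n ω => if lam n ω ≤ l ω then 1 else 0)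
      (fun ω => if 0 ≤ l ω then 1 else 0) (toKH g) (toKH (E l g))) :
    ∀ᵐ ω ∂μ, IsDiag ℂ (fun j => fib (x j) ω)
      (fun j => stepSum f n (fun i => p i ω) (fun i => ξ i ω) (lam j ω))
      (stepSum f n (fun i => p i ω) (fun i => ξ i ω) 0) (fib (toKH g) ω)
      (f (p 0 ω) • fib (toKH (E (p 0) g)) ω + ∑ i ∈ Finset.range n, f (ξ i ω) •
        (fib (toKH (E (p (i + 1)) g)) ω - fib (toKH (E (p i) g)) ω)) := by
  filter_upwards [ae_all_iff.2 fun i => hE (p i)] with ω hω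
  exact ((hω 0).smul_coeff _).add_coeff (isDiag_sum (Finset.range n) _ _ _ fun i _ =>
    ((hω (i + 1)).sub_coeff (hω i)).smul_coeff _)

theorem eLpNorm_stieltjesSum_sub_le
    (hx : ∀ i j, inner0 (x i) (x j) = if i = j then 1 else 0) {g : L22 μ m} {n : ℕ}
    {p ξ : ℕ → L0h μ} {η : ℝ} (hη : 0 ≤ η)
    (hE : ∀ l, IsFibDiag x (fun n ω => if lam n ω ≤ l ω then 1 else 0)
      (fun ω => if 0 ≤ l ω then 1 else 0) (toKH g) (toKH (E l g)))
    (hD : IsFibDiag x (fun n ω => f (lam n ω)) (fun _ => f 0) (toKH g) (toKH (D g)))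
    (hlam : ∀ᵐ ω ∂μ, ∀ j,
      ‖stepSum f n (fun i => p i ω) (fun i => ξ i ω) (lam j ω) - f (lam j ω)‖ ≤ η)
    (hzero : ∀ᵐ ω ∂μ, ‖stepSum f n (fun i => p i ω) (fun i => ξ i ω) 0 - f 0‖ ≤ η) :
    eLpNorm (fun z => stieltjesSum f E n p ξ g z - D g z) 2 (μ.prod m) ≤
      ENNReal.ofReal (η * ‖g‖) := by
  refine eLpNorm_le_of_fib_le hη ?_
  filter_upwards [stieltjesSum_section f E n p ξ g, isDiag_stieltjesSum f n p ξ hE, hD,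
    coeFn_fib (toKH (D g)), ae_orthonormal_fib hx, hlam, hzero]
    with ω hsum hdiag hDω hfib hort hlamω hzeroω
  have hle := (hdiag.sub_coeff hDω).norm_le hort hlamω hzeroω
  refine le_of_eq_of_le (eLpNorm_congr_ae ?_)
    (((Lp.enorm_def _).symm.trans (ofReal_norm _).symm).trans_le (ENNReal.ofReal_le_ofReal hle))
  refine (hsum.sub ?_).trans (Lp.coeFn_sub _ _).symm
  exact hfib.mono fun s hs => hs.symm

theorem hasSpectralIntegral_of_isFibDiag
    (hx : ∀ i j, inner0 (x i) (x j) = if i = j then 1 else 0)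
    (hE : ∀ l g, IsFibDiag x (fun n ω => if lam n ω ≤ l ω then 1 else 0)
      (fun ω => if 0 ≤ l ω then 1 else 0) (toKH g) (toKH (E l g)))
    (hD : ∀ g, IsFibDiag x (fun n ω => f (lam n ω)) (fun _ => f 0) (toKH g) (toKH (D g)))
    {α β γ : ℝ} (hf : ContinuousOn f (Icc α γ)) (hβγ : β < γ) (ha : ∀ᵐ ω ∂μ, α ≤ a ω)
    (hlam : ∀ᵐ ω ∂μ, ∀ n, lam n ω ∈ Icc (a ω) (b ω) ∧ lam n ω ≤ β)
    (hzero : ∀ᵐ ω ∂μ, 0 ∈ Icc (a ω) (b ω)) (hβ : 0 ≤ β) : HasSpectralIntegral f E a b D := by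
  intro g η hη
  have hη' : 0 < η / (‖g‖ + 1) := by positivity
  obtain ⟨δ₀, hδ₀, hunif⟩ := Metric.uniformContinuousOn_iff.1
    (isCompact_Icc.uniformContinuousOn_of_continuous hf) _ hη'
  have hδ : 0 < min (δ₀ / 2) (γ - β) := lt_min (half_pos hδ₀) (sub_pos.2 hβγ)
  refine ⟨min (δ₀ / 2) (γ - β), hδ, fun n p ξ hpart => ?_⟩
  have hclose {r s t : ℝ} (hr : α ≤ r) (ht : r ≤ t) (htβ : t ≤ β) (hs : r ≤ s)
      (hst : |s - t| ≤ min (δ₀ / 2) (γ - β)) : ‖f s - f t‖ ≤ η / (‖g‖ + 1) := by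
    obtain ⟨hst₀, hstγ⟩ := le_min_iff.1 hst
    rw [← dist_eq_norm]
    refine (hunif s ⟨hr.trans hs, ?_⟩ t ⟨hr.trans ht, htβ.trans hβγ.le⟩ ?_).le
    · linarith [le_of_abs_le hstγ]
    · rw [Real.dist_eq]
      linarith
  refine (eLpNorm_stieltjesSum_sub_le hx hη'.le (hE · g) (hD g) ?_ ?_).trans
    (ENNReal.ofReal_le_ofReal ?_)
  · filter_upwards [hpart.ae, ha, hlam] with ω ⟨hleft, hright, hstep⟩ haω hlamω j
    rw [← hleft, ← hright] at hlamω
    rw [← hleft] at haω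
    exact norm_stepSum_sub_le hδ.le hstep (hlamω j).1 fun s hs hst =>
      hclose haω (hlamω j).1.1 (hlamω j).2 hs hst
  · filter_upwards [hpart.ae, ha, hzero] with ω ⟨hleft, hright, hstep⟩ haω hzeroω
    rw [← hleft, ← hright] at hzeroω
    rw [← hleft] at haω
    exact norm_stepSum_sub_le hδ.le hstep hzeroω fun s hs hst => hclose haω hzeroω.1 hβ hs hst
  · rw [div_mul_eq_mul_div, div_le_iff₀ (by positivity)]
    gcongr
    linarith

end SFinite

section EigenBasis

variable [IsFiniteMeasure μ] [IsFiniteMeasure m] {k : Kernel μ m} {lam : ℕ → L0h μ}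
variable {x : ℕ → KH μ m} {b : L0h μ} {E : L0h μ → L22 μ m →L[ℂ] L22 μ m} {ε : ℝ}

theorem IsEigenBasis.exists_forall_mem_Icc (h : IsEigenBasis k lam x) (hpos : IsPosSemidefKernel k)
    (hb : ∀ᵐ ω ∂μ, IsLUB (range fun n => lam n ω) (b ω)) : ∃ C, ∀ᵐ ω ∂μ, b ω ∈ Icc 0 C := by
  obtain ⟨C, -, hC⟩ := h.exists_bound
  refine ⟨C, ?_⟩
  filter_upwards [h.lam_nonneg hpos, hb, hC] with ω hnonneg hbω hCω
  exact ⟨(hnonneg 0).trans (hbω.1 (mem_range_self 0)),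
    hbω.2 (forall_mem_range.2 fun n => (le_abs_self _).trans (hCω n))⟩

theorem IsEigenBasis.hasSpectralIntegral (h : IsEigenBasis k lam x) (hμ : μ ≠ 0)
    (hpos : IsPosSemidefKernel k) (hb : ∀ᵐ ω ∂μ, IsLUB (range fun n => lam n ω) (b ω))
    (hE : ∀ l g, IsFibDiag x (fun n ω => if lam n ω ≤ l ω then 1 else 0)
      (fun ω => if 0 ≤ l ω then 1 else 0) (toKH g) (toKH (E l g))) (hε : 0 < ε) {f : ℝ → ℂ}
    (hf : ∀ᵐ ω ∂μ, ContinuousOn f (Icc 0 (b ω + ε))) {D : L22 μ m →L[ℂ] L22 μ m}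
    (hD : ∀ g, IsFibDiag x (fun n ω => f (lam n ω)) (fun _ => f 0) (toKH g) (toKH (D g))) :
    HasSpectralIntegral f E 0 (b + AEEqFun.const Ω ε) D := by
  obtain ⟨C, hC⟩ := h.exists_forall_mem_Icc hpos hb
  obtain ⟨β, hβ, hbβ, hfβ⟩ := exists_Icc_continuousOn hμ hC hε hf
  have hzero : ∀ᵐ ω ∂μ, (0 : L0h μ) ω = 0 := AEEqFun.coeFn_zero
  have htop : ∀ᵐ ω ∂μ, b ω ≤ (b + AEEqFun.const Ω ε : L0h μ) ω := by
    filter_upwards [AEEqFun.coeFn_add b (AEEqFun.const Ω ε), AEEqFun.coeFn_const (μ := μ) Ω ε]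
      with ω hadd hconst
    rw [hadd, Pi.add_apply, hconst]
    exact le_add_of_nonneg_right hε.le
  refine hasSpectralIntegral_of_isFibDiag h.orthonormal hE hD hfβ
    (lt_add_of_pos_right β (half_pos hε)) (hzero.mono fun ω hω => hω.ge) ?_ ?_ hβ
  · filter_upwards [h.lam_nonneg hpos, hb, hbβ, hzero, htop] with ω hnonneg hbω hβω h₀ hle n
    have hlam : lam n ω ≤ b ω := hbω.1 (mem_range_self n)
    exact ⟨⟨h₀.trans_le (hnonneg n), hlam.trans hle⟩, hlam.trans hβω⟩
  · filter_upwards [hC, hzero, htop] with ω hCω h₀ hle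
    exact ⟨h₀.le, hCω.1.trans hle⟩

theorem IsEigenBasis.hasSpectralIntegral_op22 (h : IsEigenBasis k lam x) (hμ : μ ≠ 0)
    (hpos : IsPosSemidefKernel k) (hb : ∀ᵐ ω ∂μ, IsLUB (range fun n => lam n ω) (b ω))
    (hE : ∀ l g, IsFibDiag x (fun n ω => if lam n ω ≤ l ω then 1 else 0)
      (fun ω => if 0 ≤ l ω then 1 else 0) (toKH g) (toKH (E l g))) (hε : 0 < ε) :
    HasSpectralIntegral (fun r => (r : ℂ)) E 0 (b + AEEqFun.const Ω ε) (op22 k) :=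
  h.hasSpectralIntegral hμ hpos hb hE hε
    (Eventually.of_forall fun _ => Complex.continuous_ofReal.continuousOn) fun g =>
    (h.isFibDiag_opKH (toKH g)).congr (Eventually.of_forall fun _ _ => rfl)
      (Eventually.of_forall fun _ => Complex.ofReal_zero.symm)

theorem IsEigenBasis.isFibDiag_cfc_op22 (h : IsEigenBasis k lam x) {β : ℝ} (hβ : 0 ≤ β)
    (hlam : ∀ᵐ ω ∂μ, ∀ n, lam n ω ∈ Icc 0 β) {f : ℝ → ℂ} (hf : ContinuousOn f (Icc 0 β))
    (g : L22 μ m) : IsFibDiag x (fun n ω => f (lam n ω)) (fun _ => f 0) (toKH g)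
      (toKH (cfc (fun z : ℂ => f z.re) (op22 k) g)) := by
  have hof : ∀ᵐ ω ∂μ, ∀ n, ofReal0 (lam n) ω = (lam n ω : ℂ) :=
    ae_all_iff.2 fun n => ofReal0_apply (lam n)
  have hzero : ∀ᵐ ω ∂μ, (0 : L0 μ) ω = 0 := AEEqFun.coeFn_zero
  have ha : ∀ᵐ ω ∂μ, ∀ n, ofReal0 (lam n) ω ∈ Complex.ofReal '' Icc 0 β := by
    filter_upwards [hof, hlam] with ω hofω hlamω n
    exact ⟨lam n ω, hlamω n, (hofω n).symm⟩
  have hc : ∀ᵐ ω ∂μ, (0 : L0 μ) ω ∈ Complex.ofReal '' Icc 0 β :=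
    hzero.mono fun ω hω => ⟨0, ⟨le_rfl, hβ⟩, hω.symm⟩
  have hop (g : L22 μ m) : IsFibDiag x (fun n => ofReal0 (lam n)) (0 : L0 μ) (toKH g)
      (toKH (op22 k g)) :=
    (h.isFibDiag_opKH (toKH g)).congr (hof.mono fun ω hω n => (hω n).symm)
      (hzero.mono fun ω hω => hω.symm)
  set F : ℝ → ℂ := IccExtend hβ ((Icc 0 β).domRestrict f)
  have hF : EqOn F f (Icc 0 β) := fun t ht => IccExtend_of_mem hβ _ ht
  have hcfc : cfc (fun z : ℂ => f z.re) (op22 k) = cfc (fun z : ℂ => F z.re) (op22 k) := by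
    refine cfc_congr fun z hz => ?_
    obtain ⟨t, ht, rfl⟩ := spectrum_subset_of_isFibDiag h.orthonormal
      (isCompact_Icc.image Complex.continuous_ofReal).isClosed ha hc hop hz
    exact (hF ht).symm
  rw [hcfc]
  refine (isFibDiag_cfc h.orthonormal ha hc hop hf.domRestrict.Icc_extend' g).congr ?_ ?_
  · filter_upwards [hof, hlam] with ω hofω hlamω n
    rw [hofω, Complex.ofReal_re]
    exact hF (hlamω n)
  · filter_upwards [hzero] with ω hω
    rw [hω, Complex.zero_re]
    exact hF ⟨le_rfl, hβ⟩

theorem IsEigenBasis.hasSpectralIntegral_cfc (h : IsEigenBasis k lam x) (hμ : μ ≠ 0)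
    (hpos : IsPosSemidefKernel k) (hb : ∀ᵐ ω ∂μ, IsLUB (range fun n => lam n ω) (b ω))
    (hE : ∀ l g, IsFibDiag x (fun n ω => if lam n ω ≤ l ω then 1 else 0)
      (fun ω => if 0 ≤ l ω then 1 else 0) (toKH g) (toKH (E l g))) (hε : 0 < ε) {f : ℝ → ℂ}
    (hf : ∀ᵐ ω ∂μ, ContinuousOn f (Icc 0 (b ω + ε))) :
    HasSpectralIntegral f E 0 (b + AEEqFun.const Ω ε)
      (cfc (fun z : ℂ => f z.re) (op22 k)) := by
  obtain ⟨C, hC⟩ := h.exists_forall_mem_Icc hpos hb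
  obtain ⟨β, hβ, hbβ, hfβ⟩ := exists_Icc_continuousOn hμ hC hε hf
  refine h.hasSpectralIntegral hμ hpos hb hE hε hf (h.isFibDiag_cfc_op22 hβ ?_
    (hfβ.mono (Icc_subset_Icc_right (le_add_of_nonneg_right (half_pos hε).le))))
  filter_upwards [h.lam_nonneg hpos, hb, hbβ] with ω hnonneg hbω hβω n
  exact ⟨hnonneg n, (hbω.1 (mem_range_self n)).trans hβω⟩

end EigenBasis

end SpectralIntegrals

/-! ### Modular spectra and eigenmodules -/

section EigenvectorExpansion

variable {𝕜 H : Type*} [RCLike 𝕜] [NormedAddCommGroup H] [InnerProductSpace 𝕜 H]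
variable {v : ℕ → H} {a : ℕ → 𝕜} {c l : 𝕜} {h : H}

theorem IsDiag.inner_eq_zero_of_ne (hy : IsDiag 𝕜 v a c h (l • h)) {n : ℕ} (hn : a n ≠ l) :
    inner 𝕜 (v n) h = 0 := by
  have heq := hy.inner_eq n
  rw [inner_smul_right] at heq
  exact (mul_eq_mul_right_iff.1 heq).resolve_left hn.symm

theorem IsDiag.eq_sum_of_eigenvector (hv : Orthonormal 𝕜 v) (hy : IsDiag 𝕜 v a 0 h (l • h))
    (hl : l ≠ 0) {N : ℕ} (hN : ∀ n, N ≤ n → a n ≠ l) :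
    h = ∑ n ∈ Finset.range N, inner 𝕜 (v n) h • v n := by
  refine smul_right_injective H hl (hy.unique ⟨fun n => ?_, fun w hw => ?_⟩)
  · rw [inner_smul_right, inner_sum]
    simp only [inner_smul_right, orthonormal_iff_ite.1 hv n, mul_ite, mul_one, mul_zero,
      Finset.sum_ite_eq, Finset.mem_range]
    split_ifs with hn
    · rw [← inner_smul_right, hy.inner_eq]
    · rw [hy.inner_eq_zero_of_ne (hN n (not_lt.1 hn)), mul_zero]
  · rw [inner_smul_right, inner_sum, zero_mul, Finset.sum_eq_zero, mul_zero]
    intro n _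
    rw [inner_smul_right, inner_eq_zero_symm.1 (hw n), mul_zero]

end EigenvectorExpansion

section Mixings

variable {Ω : Type*}

theorem tsum_indicator_of_mem {A : ℕ → Set Ω} (hA : Pairwise (Function.onFun Disjoint A))
    (v : ℕ → Ω → ℂ) {ω : Ω} {n : ℕ} (hω : ω ∈ A n) :
    ∑' i, (A i).indicator (v i) ω = v n ω := by
  rw [tsum_eq_single n, indicator_of_mem hω]
  exact fun i hi => indicator_of_notMem (fun hmem => disjoint_left.1 (hA hi) hmem hω) _

variable [MeasurableSpace Ω] {μ : Measure Ω}

theorem isPartition_disjointed {B : ℕ → Set Ω} (hB : ∀ n, MeasurableSet (B n))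
    (hcover : ⋃ n, B n = univ) : IsPartition (disjointed B) where
  measurable := MeasurableSet.disjointed hB
  disjoint := disjoint_disjointed B
  cover := by rw [iUnion_disjointed, hcover]

theorem subset_mix (K : Set (L0 μ)) : K ⊆ mix K := fun v hv =>
  ⟨disjointed fun _ => univ, fun _ => v,
    isPartition_disjointed (fun _ => MeasurableSet.univ) (iUnion_const univ), fun _ => hv,
    fun _ => Eventually.of_forall fun _ _ => rfl⟩

theorem mem_disjointSums {v : ℕ → L0 μ} {l : L0 μ} (hl : ∀ᵐ ω ∂μ, ∃ n, l ω = v n ω) :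
    l ∈ disjointSums v := by
  have hmeas (n : ℕ) : MeasurableSet {ω | l ω = v n ω} :=
    measurableSet_eq_fun l.measurable (v n).measurable
  refine ⟨_, MeasurableSet.disjointed hmeas, disjoint_disjointed _, ?_⟩
  filter_upwards [hl] with ω hω
  have hmem : ω ∈ ⋃ n, disjointed (fun n => {ω | l ω = v n ω}) n := by
    rw [iUnion_disjointed]
    exact mem_iUnion.2 hω
  obtain ⟨n, hn⟩ := mem_iUnion.1 hmem
  rw [tsum_indicator_of_mem (disjoint_disjointed _) (fun n => v n) hn]
  exact disjointed_subset _ n hn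

theorem exists_eq_of_mem_disjointSums {v : ℕ → L0 μ} (hv : v 0 = 0) {l : L0 μ}
    (hl : l ∈ disjointSums v) : ∀ᵐ ω ∂μ, ∃ n, l ω = v n ω := by
  obtain ⟨A, -, hA, hl⟩ := hl
  filter_upwards [hl, (AEEqFun.coeFn_zero : ⇑(0 : L0 μ) =ᵐ[μ] 0)] with ω hω hzero
  by_cases hmem : ∃ n, ω ∈ A n
  · obtain ⟨n, hn⟩ := hmem
    exact ⟨n, hω.trans (tsum_indicator_of_mem hA (fun n => v n) hn)⟩
  · refine ⟨0, ?_⟩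
    rw [hω, hv, hzero]
    exact (tsum_congr fun n => indicator_of_notMem (fun hn => hmem ⟨n, hn⟩) _).trans tsum_zero

theorem mem_mix_disjointSums {v : ℕ → L0 μ} (hv : v 0 = 0) {l : L0 μ} :
    l ∈ mix (disjointSums v) ↔ ∀ᵐ ω ∂μ, ∃ n, l ω = v n ω := by
  refine ⟨?_, fun hl => subset_mix _ (mem_disjointSums hl)⟩
  rintro ⟨A, u, hA, hu, hl⟩
  filter_upwards [ae_all_iff.2 hl, ae_all_iff.2 fun n => exists_eq_of_mem_disjointSums hv (hu n)]
    with ω hω huω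
  obtain ⟨n, hn⟩ := mem_iUnion.1 (hA.cover.ge (mem_univ ω))
  rw [hω n hn]
  exact huω n

end Mixings

section Idempotents

variable {Ω S : Type*} [MeasurableSpace Ω] [MeasurableSpace S]
variable {μ : Measure Ω} {m : Measure S}

theorem ae_eq_zero_or_one {π : L0 μ} (hπ : IsIdempotentElem π) :
    ∀ᵐ ω ∂μ, π ω = 0 ∨ π ω = 1 := by
  filter_upwards [AEEqFun.coeFn_mul π π] with ω hω
  rw [hπ.eq] at hω
  exact IsIdempotentElem.iff_eq_zero_or_one.1 hω.symm

theorem isIdempotentElem_chi (A : Set Ω) (hA : MeasurableSet A) :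
    IsIdempotentElem (chi μ A hA) := by
  apply AEEqFun.ext
  filter_upwards [AEEqFun.coeFn_mul (chi μ A hA) (chi μ A hA), chi_apply (μ := μ) A hA]
    with ω hmul hchi
  rw [hmul, Pi.mul_apply, hchi]
  by_cases hω : ω ∈ A <;> simp [hω]

variable [SFinite m]

theorem fib_chi_smul {A : Set Ω} (hA : MeasurableSet A) (u : KH μ m) :
    ∀ᵐ ω ∂μ, fib (chi μ A hA • u) ω = A.indicator (fib u) ω := by
  filter_upwards [fib_smul (chi μ A hA) u, chi_apply (μ := μ) A hA] with ω hsmul hchi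
  rw [hsmul, hchi]
  by_cases hω : ω ∈ A <;> simp [hω]

theorem chi_smul_eq_chi_smul {A : Set Ω} (hA : MeasurableSet A) {u w : KH μ m}
    (h : ∀ᵐ ω ∂μ, ω ∈ A → fib u ω = fib w ω) : chi μ A hA • u = chi μ A hA • w := by
  apply KH_ext
  filter_upwards [fib_chi_smul hA u, fib_chi_smul hA w, h] with ω hu hw hω
  rw [hu, hw]
  by_cases hmem : ω ∈ A
  · rw [indicator_of_mem hmem, indicator_of_mem hmem, hω hmem]
  · rw [indicator_of_notMem hmem, indicator_of_notMem hmem]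

end Idempotents

section Invertibility

variable {Ω S : Type*} [MeasurableSpace Ω] [MeasurableSpace S]
variable {μ : Measure Ω} {m : Measure S}

section SFinite

variable [SFinite m] {x : ℕ → KH μ m} {a b : ℕ → Ω → ℂ} {c d : Ω → ℂ}
variable {D R : KH μ m →ₗ[L0 μ] KH μ m} {A : Set Ω}

theorem chi_smul_comp_chi_smul (hD : ∀ u, IsFibDiag x a c u (D u))
    (hR : ∀ u, IsFibDiag x b d u (R u)) (hA : MeasurableSet A)
    (hab : ∀ ω ∈ A, ∀ n, a n ω * b n ω = 1) (hcd : ∀ ω ∈ A, c ω * d ω = 1) :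
    (chi μ A hA • D) ∘ₗ (chi μ A hA • R) = chi μ A hA • LinearMap.id := by
  refine LinearMap.ext fun u => ?_
  rw [LinearMap.comp_apply, LinearMap.smul_apply, LinearMap.smul_apply, map_smul, smul_smul,
    (isIdempotentElem_chi A hA).eq, LinearMap.smul_apply, LinearMap.id_apply]
  apply chi_smul_eq_chi_smul
  filter_upwards [hD (R u), hR u] with ω hDω hRω hω
  have hcomp := (hRω.comp hDω).congr (hab ω hω) (hcd ω hω)
  have hself := isDiag_self (𝕜 := ℂ) (v := fun n => fib (x n) ω) (h := fib u ω) 1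
  rw [one_smul] at hself
  exact hcomp.unique hself

end SFinite

variable [IsFiniteMeasure m]
variable {x : ℕ → KH μ m} {a : ℕ → Ω → ℂ} {c : Ω → ℂ} {D : KH μ m →ₗ[L0 μ] KH μ m} {A : Set Ω}

theorem isL0Bounded_of_isFibDiag (hx : ∀ i j, inner0 (x i) (x j) = if i = j then 1 else 0)
    (ha_meas : ∀ n, Measurable (a n)) (hc_meas : Measurable c)
    (ha : ∀ᵐ ω ∂μ, ∃ B, ∀ n, ‖a n ω‖ ≤ B) (hD : ∀ u, IsFibDiag x a c u (D u)) :
    IsL0Bounded D := by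
  have hmeas : Measurable fun ω => max (⨆ n, ‖a n ω‖) ‖c ω‖ :=
    (Measurable.iSup fun n => (ha_meas n).norm).max hc_meas.norm
  refine ⟨AEEqFun.mk _ hmeas.aestronglyMeasurable, fun u => ?_⟩
  rw [← AEEqFun.coeFn_le]
  filter_upwards [AEEqFun.coeFn_mul (AEEqFun.mk _ hmeas.aestronglyMeasurable) (norm0 u),
    AEEqFun.coeFn_mk _ hmeas.aestronglyMeasurable, norm0_apply u, norm0_apply (D u), hD u, ha,
    ae_orthonormal_fib hx] with ω hmul hmk hu hDu hdiag ⟨B, hB⟩ hort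
  rw [hmul, Pi.mul_apply, hmk, hu, hDu]
  refine hdiag.norm_le hort (fun n => ?_) (le_max_right _ _)
  exact (le_ciSup (f := fun n => ‖a n ω‖) ⟨B, forall_mem_range.2 hB⟩ n).trans (le_max_left _ _)

variable [IsFiniteMeasure μ]

theorem isInvertibleOn_chi_of_isFibDiag
    (hx : ∀ i j, inner0 (x i) (x j) = if i = j then 1 else 0)
    (ha_meas : ∀ n, Measurable (a n)) (hc_meas : Measurable c)
    (hD : ∀ u, IsFibDiag x a c u (D u)) (hA : MeasurableSet A)
    (ha : ∀ ω ∈ A, ∀ n, a n ω ≠ 0) (hc : ∀ ω ∈ A, c ω ≠ 0)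
    (hbdd : ∀ᵐ ω ∂μ, ω ∈ A → ∃ B, ∀ n, ‖(a n ω)⁻¹‖ ≤ B) :
    IsInvertibleOn (chi μ A hA) D := by
  have hinv_meas (n : ℕ) : Measurable (A.indicator (a n)⁻¹) := (ha_meas n).inv.indicator hA
  have hinv : ∀ᵐ ω ∂μ, ∀ n, toL0 μ _ (hinv_meas n) ω = A.indicator (a n)⁻¹ ω :=
    ae_all_iff.2 fun n => toL0_apply _ _
  have hinv_bdd : ∀ᵐ ω ∂μ, ∃ B, ∀ n, ‖toL0 μ _ (hinv_meas n) ω‖ ≤ B := by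
    filter_upwards [hinv, hbdd] with ω hω hbddω
    simp_rw [hω]
    by_cases hmem : ω ∈ A
    · simpa only [indicator_of_mem hmem, Pi.inv_apply] using hbddω hmem
    · exact ⟨0, fun n => by rw [indicator_of_notMem hmem, norm_zero]⟩
  obtain ⟨R, hR⟩ := exists_diagKH hx (toL0 μ _ (hc_meas.inv.indicator hA)) hinv_bdd
  have hR' (u : KH μ m) := (hR u).congr hinv (toL0_apply _ _)
  refine ⟨R, isL0Bounded_of_isFibDiag hx (fun n => AEEqFun.measurable _)
    (AEEqFun.measurable _) hinv_bdd hR, ?_, ?_⟩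
  · refine chi_smul_comp_chi_smul hD hR' hA (fun ω hω n => ?_) fun ω hω => ?_
    · rw [indicator_of_mem hω, Pi.inv_apply, mul_inv_cancel₀ (ha ω hω n)]
    · rw [indicator_of_mem hω, Pi.inv_apply, mul_inv_cancel₀ (hc ω hω)]
  · refine chi_smul_comp_chi_smul hR' hD hA (fun ω hω n => ?_) fun ω hω => ?_
    · rw [indicator_of_mem hω, Pi.inv_apply, inv_mul_cancel₀ (ha ω hω n)]
    · rw [indicator_of_mem hω, Pi.inv_apply, inv_mul_cancel₀ (hc ω hω)]

end Invertibility

section CyclicSpectrum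

variable {Ω S : Type*} [MeasurableSpace Ω] [MeasurableSpace S]
variable {μ : Measure Ω} {m : Measure S} [IsFiniteMeasure μ] [IsFiniteMeasure m]
variable {k : Kernel μ m} {lam : ℕ → L0h μ} {x : ℕ → KH μ m} {l : L0 μ}

theorem IsEigenBasis.isFibDiag_opKH_sub (h : IsEigenBasis k lam x) (l : L0 μ) (u : KH μ m) :
    IsFibDiag x (fun n ω => (lam n ω : ℂ) - l ω) (fun ω => -l ω) u
      ((opKH k - l • LinearMap.id : KH μ m →ₗ[L0 μ] KH μ m) u) := by
  rw [LinearMap.sub_apply, LinearMap.smul_apply, LinearMap.id_apply]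
  filter_upwards [h.isFibDiag_opKH u, fib_sub (opKH k u) (l • u), fib_smul l u]
    with ω hdiag hsub hsmul
  rw [hsub, hsmul]
  exact (hdiag.sub_coeff (isDiag_self _)).congr (fun _ => rfl) (zero_sub _)

theorem IsEigenBasis.tendsto_ofReal_sub (h : IsEigenBasis k lam x) (l : L0 μ) :
    ∀ᵐ ω ∂μ, Tendsto (fun n => (lam n ω : ℂ) - l ω) atTop (𝓝 (-l ω)) := by
  filter_upwards [h.tendsto] with ω hω
  simpa using ((Complex.continuous_ofReal.tendsto 0).comp hω).sub_const (l ω)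

theorem IsEigenBasis.isInvertibleOn_chi (h : IsEigenBasis k lam x) {A : Set Ω}
    (hA : MeasurableSet A) (hl₀ : ∀ ω ∈ A, l ω ≠ 0) (hl : ∀ ω ∈ A, ∀ n, l ω ≠ lam n ω) :
    IsInvertibleOn (chi μ A hA) (opKH k - l • LinearMap.id) := by
  refine isInvertibleOn_chi_of_isFibDiag h.orthonormal
    (fun n => (Complex.measurable_ofReal.comp (lam n).measurable).sub l.measurable) l.measurable.neg
    (h.isFibDiag_opKH_sub l) hA (fun ω hω n => sub_ne_zero.2 (hl ω hω n).symm)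
    (fun ω hω => neg_ne_zero.2 (hl₀ ω hω)) ?_
  filter_upwards [h.tendsto_ofReal_sub l] with ω hlim hω
  obtain ⟨B, hB⟩ := (hlim.inv₀ (neg_ne_zero.2 (hl₀ ω hω))).norm.bddAbove_range
  exact ⟨B, fun n => hB ⟨n, rfl⟩⟩

theorem IsEigenBasis.ae_one_le_of_leftInverse (h : IsEigenBasis k lam x) {π : L0 μ}
    {R : KH μ m →ₗ[L0 μ] KH μ m} {C : L0h μ} (hC : ∀ u, norm0 (R u) ≤ C * norm0 u)
    (hR : (π • R) ∘ₗ (π • (opKH k - l • LinearMap.id)) = π • LinearMap.id) :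
    ∀ᵐ ω ∂μ, π ω = 1 → ∀ n, 1 ≤ ‖(lam n ω : ℂ) - l ω‖ * C ω := by
  have hRx (n : ℕ) :
      π • (ofReal0 (lam n) • π • R (x n) - l • π • R (x n)) = π • x n := by
    simpa only [LinearMap.comp_apply, LinearMap.smul_apply, LinearMap.sub_apply,
      LinearMap.id_apply, h.eigen, map_smul, map_sub] using LinearMap.congr_fun hR (x n)
  filter_upwards [ae_all_iff.2 fun n => ofReal0_apply (lam n),
    ae_all_iff.2 fun n => fib_smul π (ofReal0 (lam n) • π • R (x n) - l • π • R (x n)),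
    ae_all_iff.2 fun n => fib_sub (ofReal0 (lam n) • π • R (x n)) (l • π • R (x n)),
    ae_all_iff.2 fun n => fib_smul (ofReal0 (lam n)) (π • R (x n)),
    ae_all_iff.2 fun n => fib_smul l (π • R (x n)),
    ae_all_iff.2 fun n => fib_smul π (R (x n)), ae_all_iff.2 fun n => fib_smul π (x n),
    ae_all_iff.2 fun n => AEEqFun.coeFn_le.2 (hC (x n)),
    ae_all_iff.2 fun n => AEEqFun.coeFn_mul C (norm0 (x n)),
    ae_all_iff.2 fun n => norm0_apply (x n), ae_all_iff.2 fun n => norm0_apply (R (x n)),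
    ae_orthonormal_fib h.orthonormal]
    with ω hof hπ hsub hlam hl hπR hπx hle hmul hnorm hnormR hort hone n
  have hfib : ((lam n ω : ℂ) - l ω) • fib (R (x n)) ω = fib (x n) ω := by
    have hπn := hπ n
    rw [hRx, hπx, hsub, hlam, hl, hπR, hone, one_smul, one_smul, one_smul, hof] at hπn
    rw [hπn, sub_smul]
  have hRle : ‖fib (R (x n)) ω‖ ≤ C ω := by
    have hn := hle n
    rwa [hmul, Pi.mul_apply, hnorm, hnormR, hort.1, mul_one] at hn
  calc 1 = ‖(lam n ω : ℂ) - l ω‖ * ‖fib (R (x n)) ω‖ := by rw [← norm_smul, hfib, hort.1]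
    _ ≤ ‖(lam n ω : ℂ) - l ω‖ * C ω := by gcongr

theorem IsEigenBasis.not_isInvertibleOn (h : IsEigenBasis k lam x)
    (hl : ∀ᵐ ω ∂μ, l ω = 0 ∨ ∃ n, l ω = lam n ω) {π : L0 μ} (hπ : IsIdempotentElem π)
    (hπ₀ : π ≠ 0) : ¬ IsInvertibleOn π (opKH k - l • LinearMap.id) := by
  rintro ⟨R, ⟨C, hC⟩, -, hR⟩
  refine hπ₀ (AEEqFun.ext ?_)
  filter_upwards [h.ae_one_le_of_leftInverse hC hR, hl, ae_eq_zero_or_one hπ,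
    h.tendsto_ofReal_sub l, (AEEqFun.coeFn_zero : ⇑(0 : L0 μ) =ᵐ[μ] 0)]
    with ω hle hlω hπω hlim hzero
  rw [hzero, Pi.zero_apply]
  refine hπω.resolve_right fun hone => ?_
  obtain hlω | ⟨n, hn⟩ := hlω
  · have hlim_mul := hlim.norm.mul_const (C ω)
    rw [hlω, neg_zero, norm_zero, zero_mul] at hlim_mul
    refine absurd (ge_of_tendsto' hlim_mul fun n => ?_) one_pos.not_ge
    simpa only [hlω] using hle hone n
  · have hlen := hle hone n
    rw [hn, sub_self, norm_zero, zero_mul] at hlen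
    exact one_pos.not_ge hlen

theorem IsEigenBasis.ae_eq_of_mem_cyclicSpectrum (h : IsEigenBasis k lam x)
    (hl : l ∈ cyclicSpectrum (opKH k)) : ∀ᵐ ω ∂μ, l ω = 0 ∨ ∃ n, l ω = lam n ω := by
  let A : Set Ω := {ω | l ω = 0}ᶜ ∩ ⋂ n, {ω | l ω = lam n ω}ᶜ
  have hA : MeasurableSet A :=
    (measurableSet_eq_fun l.measurable measurable_const).compl.inter <| .iInter fun n =>
      (measurableSet_eq_fun l.measurable
        (Complex.measurable_ofReal.comp (lam n).measurable)).compl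
  have hchi : chi μ A hA = 0 := by
    by_contra hne
    exact hl.2 _ (isIdempotentElem_chi A hA) hne
      (h.isInvertibleOn_chi hA (fun ω hω => hω.1) fun ω hω n => mem_iInter.1 hω.2 n)
  filter_upwards [chi_apply (μ := μ) A hA, (AEEqFun.coeFn_zero : ⇑(0 : L0 μ) =ᵐ[μ] 0)]
    with ω hω hzero
  rw [hchi, hzero, Pi.zero_apply] at hω
  by_contra! hne
  have hmem : ω ∈ A := ⟨hne.1, mem_iInter.2 hne.2⟩
  rw [indicator_of_mem hmem, Pi.one_apply] at hω
  exact zero_ne_one hω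

theorem IsEigenBasis.mem_cyclicSpectrum_iff (h : IsEigenBasis k lam x) (hμ : μ ≠ 0) :
    l ∈ cyclicSpectrum (opKH k) ↔ ∀ᵐ ω ∂μ, l ω = 0 ∨ ∃ n, l ω = lam n ω := by
  have hone_ne : (1 : L0 μ) ≠ 0 := fun h_one => by
    have : (ae μ).NeBot := ae_neBot.2 hμ
    obtain ⟨ω, hone, hzero⟩ := ((AEEqFun.coeFn_one : ⇑(1 : L0 μ) =ᵐ[μ] 1).and
      (AEEqFun.coeFn_zero : ⇑(0 : L0 μ) =ᵐ[μ] 0)).exists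
    rw [h_one, hzero] at hone
    exact zero_ne_one hone
  exact ⟨h.ae_eq_of_mem_cyclicSpectrum, fun hl =>
    ⟨h.not_isInvertibleOn hl IsIdempotentElem.one hone_ne,
      fun _ hπ hπ₀ => h.not_isInvertibleOn hl hπ hπ₀⟩⟩

theorem IsEigenBasis.cyclicSpectrum_eq (h : IsEigenBasis k lam x) (hμ : μ ≠ 0) :
    cyclicSpectrum (opKH k) = mix (disjointSums (withZero lam)) := by
  ext l
  rw [h.mem_cyclicSpectrum_iff hμ, mem_mix_disjointSums rfl]
  refine eventually_congr ?_
  filter_upwards [(AEEqFun.coeFn_zero : ⇑(0 : L0 μ) =ᵐ[μ] 0),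
    ae_all_iff.2 fun n => ofReal0_apply (lam n)] with ω hzero hof
  rw [← Nat.or_exists_add_one (p := fun n => l ω = withZero lam n ω)]
  simp only [withZero, hzero, hof, Pi.zero_apply]

end CyclicSpectrum

section Eigenmodules

variable {Ω S : Type*} [MeasurableSpace Ω] [MeasurableSpace S]
variable {μ : Measure Ω} {m : Measure S}

theorem exists_isPartition_forall_ne {r : ℕ → Ω → ℂ} {l : Ω → ℂ} (hr : ∀ n, Measurable (r n))
    (hl : Measurable l)
    (hrl : ∀ᵐ ω ∂μ, ∀ᶠ n in atTop, r n ω ≠ l ω) :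
    ∃ A : ℕ → Set Ω, IsPartition A ∧ ∀ᵐ ω ∂μ, ∀ N, ω ∈ A N → ∀ n, N ≤ n → r n ω ≠ l ω := by
  let B : ℕ → Set Ω := fun N => ⋂ n, ⋂ (_ : N ≤ n), {ω | r n ω = l ω}ᶜ
  have hB (N : ℕ) : MeasurableSet (B N) :=
    .iInter fun n => .iInter fun _ => (measurableSet_eq_fun (hr n) hl).compl
  refine ⟨disjointed fun N => B N ∪ (⋃ n, B n)ᶜ, isPartition_disjointed
    (fun N => (hB N).union (MeasurableSet.iUnion hB).compl) ?_, ?_⟩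
  · rw [← iUnion_union, union_compl_self]
  · filter_upwards [hrl] with ω hω N hN
    obtain ⟨M, hM⟩ := eventually_atTop.1 hω
    have hmem : ω ∈ ⋃ n, B n := mem_iUnion.2 ⟨M, mem_iInter₂.2 hM⟩
    exact mem_iInter₂.1 ((disjointed_subset _ N hN).resolve_right fun hcompl => hcompl hmem)

variable [IsFiniteMeasure μ] [IsFiniteMeasure m]
variable {k : Kernel μ m} {lam : ℕ → L0h μ} {x : ℕ → KH μ m} {l : L0 μ} {A : Set Ω}

theorem IsEigenBasis.chi_smul_mem_ker (h : IsEigenBasis k lam x) (hA : MeasurableSet A) {n : ℕ}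
    (hlam : ∀ ω ∈ A, (lam n ω : ℂ) = l ω) :
    chi μ A hA • x n ∈ LinearMap.ker (l • LinearMap.id - opKH k) := by
  rw [LinearMap.mem_ker, LinearMap.sub_apply, LinearMap.smul_apply, LinearMap.id_apply, map_smul,
    h.eigen, sub_eq_zero, smul_comm]
  apply chi_smul_eq_chi_smul
  filter_upwards [fib_smul l (x n), fib_smul (ofReal0 (lam n)) (x n), ofReal0_apply (lam n)]
    with ω hl hof hofω hω
  rw [hl, hof, hofω, hlam ω hω]

theorem IsEigenBasis.chi_smul_eq_sum (h : IsEigenBasis k lam x) (hl : ∀ᵐ ω ∂μ, l ω ≠ 0)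
    (hA : MeasurableSet A) {N : ℕ} (hN : ∀ᵐ ω ∂μ, ω ∈ A → ∀ n, N ≤ n → (lam n ω : ℂ) ≠ l ω)
    (hB : ∀ n, MeasurableSet {ω | (lam n ω : ℂ) = l ω}) {u : KH μ m} (hu : opKH k u = l • u) :
    chi μ A hA • u = chi μ A hA • ∑ n ∈ Finset.range N, inner0 u (x n) • chi μ _ (hB n) • x n := by
  apply chi_smul_eq_chi_smul
  filter_upwards [hl, hN, h.isFibDiag_opKH u, fib_smul l u, ae_orthonormal_fib h.orthonormal,
    fib_sum (Finset.range N) fun n => inner0 u (x n) • chi μ _ (hB n) • x n,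
    ae_all_iff.2 fun n => fib_smul (inner0 u (x n)) (chi μ _ (hB n) • x n),
    ae_all_iff.2 fun n => fib_chi_smul (hB n) (x n),
    ae_all_iff.2 fun n => inner0_apply u (x n)]
    with ω hlω hNω hdiag hsmul hort hsum hcoeff hchi hinner hω
  rw [hu, hsmul] at hdiag
  rw [hsum]
  refine (hdiag.eq_sum_of_eigenvector hort hlω (hNω hω)).trans (Finset.sum_congr rfl fun n _ => ?_)
  rw [hcoeff, hinner, hchi]
  by_cases hn : (lam n ω : ℂ) = l ω
  · rw [indicator_of_mem (mem_ofPred_eq ▸ hn)]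
  · rw [hdiag.inner_eq_zero_of_ne hn, zero_smul, zero_smul]

theorem IsEigenBasis.isSigmaFG_ker (h : IsEigenBasis k lam x) (hl : ∀ᵐ ω ∂μ, l ω ≠ 0) :
    IsSigmaFG (LinearMap.ker (l • LinearMap.id - opKH k)) := by
  have hlam_meas (n : ℕ) : Measurable fun ω => (lam n ω : ℂ) :=
    Complex.measurable_ofReal.comp (lam n).measurable
  have hne : ∀ᵐ ω ∂μ, ∀ᶠ n in atTop, (lam n ω : ℂ) ≠ l ω := by
    filter_upwards [hl, h.tendsto] with ω hlω hlim
    exact ((Complex.continuous_ofReal.tendsto 0).comp hlim).eventually_ne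
      (by rwa [Complex.ofReal_zero, ne_comm])
  obtain ⟨A, hA, hAne⟩ := exists_isPartition_forall_ne hlam_meas l.measurable hne
  refine ⟨A, hA, fun N => Submodule.fg_def.2 ?_⟩
  have hB (n : ℕ) : MeasurableSet {ω | (lam n ω : ℂ) = l ω} :=
    measurableSet_eq_fun (hlam_meas n) l.measurable
  let χ : L0 μ := chi μ (A N) (hA.measurable N)
  let gen (n : ℕ) : KH μ m := χ • chi μ _ (hB n) • x n
  refine ⟨gen '' Iio N, (finite_Iio N).image _, le_antisymm (Submodule.span_le.2 ?_) ?_⟩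
  · rintro _ ⟨n, -, rfl⟩
    exact ⟨_, h.chi_smul_mem_ker (hB n) fun ω hω => hω, rfl⟩
  · rintro _ ⟨u, hu, rfl⟩
    have hTu : opKH k u = l • u := (sub_eq_zero.1 (LinearMap.mem_ker.1 hu)).symm
    rw [LinearMap.lsmul_apply, h.chi_smul_eq_sum hl (hA.measurable N)
      (hAne.mono fun ω hω => hω N) hB hTu, Finset.smul_sum]
    refine Submodule.sum_mem _ fun n hn => ?_
    rw [smul_comm]
    exact Submodule.smul_mem _ _
      (Submodule.subset_span (mem_image_of_mem gen (Finset.mem_range.1 hn)))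

end Eigenmodules

end

end PartInt

theorem mainTheorem1 {Ω S : Type*} [MeasurableSpace Ω] [MeasurableSpace S]
    (μ : MeasureTheory.Measure Ω) (m : MeasureTheory.Measure S)
    [MeasureTheory.IsFiniteMeasure μ] [MeasureTheory.IsFiniteMeasure m]
    (hμ : μ ≠ 0) (hm : ¬ FiniteDimensional ℂ (MeasureTheory.Lp ℂ 2 m))
    (k : PartInt.Kernel μ m)
    (hk : PartInt.IsHermitianKernel k) (hpos : PartInt.IsPosSemidefKernel k) :
    ∃ (lam : ℕ → PartInt.L0h μ) (x : ℕ → PartInt.KH μ m),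
      -- (1) expansion in eigenfunctions, a basis whenever `L₂(S)` is separable
      (PartInt.IsEigenSystem k lam x ∧ PartInt.HasEigenExpansion k lam x ∧
        (TopologicalSpace.SeparableSpace (MeasureTheory.Lp ℂ 2 m) →
          PartInt.IsCompleteSystem x)) ∧
      -- (2), (3) spectral integrals
      (∃ (E : PartInt.L0h μ → PartInt.L22 μ m →L[ℂ] PartInt.L22 μ m) (a b : PartInt.L0h μ),
        PartInt.IsSpectralFamily lam x E ∧
        IsGLB (PartInt.numericalRange k) a ∧ IsLUB (PartInt.numericalRange k) b ∧
        ∀ ε : ℝ, 0 < ε →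
          PartInt.HasSpectralIntegral (fun r => (r : ℂ)) E a
            (b + MeasureTheory.AEEqFun.const Ω ε) (PartInt.op22 k) ∧
          ∀ f : ℝ → ℂ, (∀ᵐ ω ∂μ, ContinuousOn f (Set.Icc (a ω) (b ω + ε))) →
            PartInt.HasSpectralIntegral f E a (b + MeasureTheory.AEEqFun.const Ω ε)
              (cfc (fun z : ℂ => f z.re) (PartInt.op22 k))) ∧
      -- (4) eigenmodules
      (∀ l ∈ PartInt.discreteCyclicSpectrum (PartInt.opKH k),
        PartInt.IsSigmaFG (LinearMap.ker (l • LinearMap.id - PartInt.opKH k))) ∧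
      -- (5) the cyclic modular spectrum
      PartInt.cyclicSpectrum (PartInt.opKH k) =
        PartInt.mix (PartInt.disjointSums (PartInt.withZero lam)) := by
  obtain ⟨lam, x, h, hperp⟩ := PartInt.exists_isEigenBasis hm hk
  obtain ⟨E, hE, hdiag⟩ := PartInt.exists_spectralFamily h.orthonormal lam
  obtain ⟨b, hb⟩ := h.exists_ae_isLUB
  refine ⟨lam, x, ⟨⟨h.eigen, h.orthonormal, h.tendsto⟩, h.hasEigenExpansion, fun hsep =>
      PartInt.isCompleteSystem_of_perp_eq_bot h.orthonormal (hperp hsep)⟩,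
    ⟨E, 0, b, hE, h.isGLB_numericalRange hpos, h.isLUB_numericalRange hpos hb, fun ε hε =>
      ⟨h.hasSpectralIntegral_op22 hμ hpos hb hdiag hε, fun f hf =>
        h.hasSpectralIntegral_cfc hμ hpos hb hdiag hε ?_⟩⟩,
    fun l hl => h.isSigmaFG_ker hl.2, h.cyclicSpectrum_eq hμ⟩
  filter_upwards [hf, (AEEqFun.coeFn_zero : ⇑(0 : PartInt.L0h μ) =ᵐ[μ] 0)] with ω hfω hzero
  rwa [hzero] at hfω
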